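/- Let $\mathbb H^2_+(\mathbb R)\subset L^2(\mathbb R)$ be the Hardy space of the upper half-plane: the boundary values (as limits in $L^2(\mathbb R)$ of $F(\cdot+iy)$ as $y\downarrow 0$) of functions $F$ holomorphic in $\{\operatorname{Im} z>0\}$ with $\sup_{y>0}\int_{\mathbb R}|F(x+iy)|^2\,dx<\infty$. A bounded operator $\mathbf H$ in $\mathbb H^2_+(\mathbb R)$ is called the Hankel operator with symbol $\sigma\in L^\infty(\mathbb R)$ if $$(\mathbf H w,w)=\int_{\mathbb R}\sigma(\lambda)\,w(-\lambda)\,\overline{w(\lambda)}\,d\lambda\qquad\text{for all } w\in\mathbb H^2_+(\mathbb R).$$ Let $M\ge 0$, let $\alpha_1,\dots,\alpha_M\in\mathbb C$ be distinct with $\operatorname{Re}\alpha_m>0$, let $K_m\in\{0,1,2,\dots\}$, and let $Q_m$ be complex polynomials with $\deg Q_m\le K_m$ and $Q_m(-i\alpha_m)\ne 0$. Put $$\varphi(\lambda)=\sum_{m=1}^M Q_m(\lambda)\,(\alpha_m-i\lambda)^{-K_m-1}.$$ Then the Hankel operator $\mathbf H$ in $\mathbb H^2_+(\mathbb R)$ with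 symbol $\pi i\operatorname{sgn}\lambda+\varphi(\lambda)$ exists as a bounded operator. Suppose that $\mathbf H$ is self-adjoint. Then its strictly negative spectrum consists of eigenvalues, and the total number $N_-(\mathbf H)$ of its strictly negative eigenvalues, counted with multiplicity, is finite and equals $$N_-(\mathbf H)=\sum_{m:\ \operatorname{Im}\alpha_m=0}\mathcal N_-^{(m)}\;+\sum_{m:\ \operatorname{Im}\alpha_m>0}K_m\;+\;M_1,\qquad M_1=\#\{m:\operatorname{Im}\alpha_m>0\},$$ where, for $\operatorname{Im}\alpha_m=0$ (in which case $\mathsf p_m:=Q_m(-i\alpha_m)$ is real by self-adjointness of $\mathbf H$), $$\mathcal N_-^{(m)}=\begin{cases}(K_m+1)/2 & \text{if } K_m \text{ is odd},\\ K_m/2 & \text{if } K_m \text{ is even and } \mathsf p_m>0,\\ K_m/2+1 & \text{if } K_m \text{ is even and } \mathsf p_m<0.\end{cases}$$ -/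

import Mathlib

open MeasureTheory Filter Topology Complex
open scoped NNReal ENNReal Polynomial ComplexConjugate

noncomputable section

/-- The space `L²(ℝ)` of complex valued functions, with Lebesgue measure. -/
abbrev L2R : Type := Lp ℂ 2 (volume : Measure ℝ)

/-- `F` is holomorphic in the upper half-plane, has uniformly bounded `L²` norms on the horizontal
lines `Im z = y`, `y > 0`, and `f` is its boundary value on the real line, in the sense that
`F(· + i y) → f` in `L²(ℝ)` as `y ↓ 0`. -/
structure IsHardyExtension (F : ℂ → ℂ) (f : ℝ → ℂ) : Prop where
  holomorphic : DifferentiableOn ℂ F {z : ℂ | 0 < z.im}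
  bounded : ∃ C : ℝ≥0, ∀ y : ℝ, 0 < y →
    eLpNorm (fun x : ℝ => F ((x : ℂ) + (y : ℂ) * I)) 2 volume ≤ (C : ℝ≥0∞)
  boundary : Tendsto (fun y : ℝ => eLpNorm (fun x : ℝ => F ((x : ℂ) + (y : ℂ) * I) - f x) 2 volume)
    (𝓝[>] 0) (𝓝 0)

lemma IsHardyExtension.continuous_line {F : ℂ → ℂ} {f : ℝ → ℂ} (h : IsHardyExtension F f)
    {y : ℝ} (hy : 0 < y) : Continuous (fun x : ℝ => F ((x : ℂ) + (y : ℂ) * I)) := by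
  refine h.holomorphic.continuousOn.comp_continuous (by fun_prop) ?_
  intro x
  simpa using hy

lemma IsHardyExtension.congr {F : ℂ → ℂ} {f g : ℝ → ℂ} (h : IsHardyExtension F f)
    (hfg : f =ᵐ[volume] g) : IsHardyExtension F g := by
  refine ⟨h.holomorphic, h.bounded, ?_⟩
  refine h.boundary.congr fun y => eLpNorm_congr_ae ?_
  filter_upwards [hfg] with x hx
  rw [hx]

lemma IsHardyExtension.add {F G : ℂ → ℂ} {f g : ℝ → ℂ} (hF : IsHardyExtension F f)
    (hG : IsHardyExtension G g) (hf : AEStronglyMeasurable f volume)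
    (hg : AEStronglyMeasurable g volume) :
    IsHardyExtension (fun z => F z + G z) (fun x => f x + g x) := by
  refine ⟨hF.holomorphic.add hG.holomorphic, ?_, ?_⟩
  · obtain ⟨C, hC⟩ := hF.bounded
    obtain ⟨D, hD⟩ := hG.bounded
    refine ⟨C + D, fun y hy => ?_⟩
    have h := eLpNorm_add_le (p := 2) (μ := (volume : Measure ℝ))
      (hF.continuous_line hy).aestronglyMeasurable
      (hG.continuous_line hy).aestronglyMeasurable (by norm_num)
    refine h.trans ?_
    push_cast
    exact add_le_add (hC y hy) (hD y hy)
  · have h0 := hF.boundary.add hG.boundary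
    rw [add_zero] at h0
    refine tendsto_of_tendsto_of_tendsto_of_le_of_le' tendsto_const_nhds h0
      (Eventually.of_forall fun _ => zero_le) ?_
    filter_upwards [self_mem_nhdsWithin] with y hy
    have h := eLpNorm_add_le (p := 2) (μ := (volume : Measure ℝ))
      ((hF.continuous_line hy).aestronglyMeasurable.sub hf)
      ((hG.continuous_line hy).aestronglyMeasurable.sub hg) (by norm_num)
    refine le_trans (le_of_eq ?_) h
    congr 1
    funext x
    simp only [Pi.add_apply, Pi.sub_apply]
    ring

lemma IsHardyExtension.const_smul {F : ℂ → ℂ} {f : ℝ → ℂ} (hF : IsHardyExtension F f) (c : ℂ) :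
    IsHardyExtension (fun z => c * F z) (fun x => c * f x) := by
  refine ⟨hF.holomorphic.const_mul c, ?_, ?_⟩
  · obtain ⟨C, hC⟩ := hF.bounded
    refine ⟨‖c‖₊ * C, fun y hy => ?_⟩
    have h := eLpNorm_const_smul (p := 2) (μ := (volume : Measure ℝ)) c
      (fun x : ℝ => F ((x : ℂ) + (y : ℂ) * I))
    refine (le_of_eq h).trans ?_
    push_cast
    exact mul_le_mul' le_rfl (hC y hy)
  · have h0 : Tendsto (fun y : ℝ => ‖c‖ₑ *
        eLpNorm (fun x : ℝ => F ((x : ℂ) + (y : ℂ) * I) - f x) 2 volume) (𝓝[>] 0) (𝓝 (‖c‖ₑ * 0)) :=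
      ENNReal.Tendsto.const_mul hF.boundary (Or.inr enorm_ne_top)
    rw [mul_zero] at h0
    refine h0.congr fun y => ?_
    rw [← eLpNorm_const_smul (p := 2) (μ := (volume : Measure ℝ)) c
      (fun x : ℝ => F ((x : ℂ) + (y : ℂ) * I) - f x)]
    congr 1
    funext x
    simp only [Pi.smul_apply, smul_eq_mul]
    ring

lemma isHardyExtension_zero : IsHardyExtension (fun _ => 0) (fun _ => 0) :=
  ⟨differentiableOn_const _, ⟨0, fun _ _ => by simp⟩, by simp⟩

/-- The Hardy space `ℍ²₊(ℝ)` of the upper half-plane, realized as the subspace of `L²(ℝ)` formed by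
the boundary values. The norm and the inner product are those of `L²(ℝ)`. -/
def hardySpace : Submodule ℂ L2R where
  carrier := {f | ∃ F : ℂ → ℂ, IsHardyExtension F f}
  zero_mem' := ⟨_, isHardyExtension_zero.congr (Lp.coeFn_zero ℂ 2 volume).symm⟩
  add_mem' := by
    rintro f g ⟨F, hF⟩ ⟨G, hG⟩
    exact ⟨_, (hF.add hG (Lp.aestronglyMeasurable f) (Lp.aestronglyMeasurable g)).congr
      (Lp.coeFn_add f g).symm⟩
  smul_mem' := by
    rintro c f ⟨F, hF⟩
    exact ⟨_, (hF.const_smul c).congr (Lp.coeFn_smul c f).symm⟩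

/-- The bounded operator `H` in `ℍ²₊(ℝ)` is the Hankel operator with symbol `σ ∈ L^∞(ℝ)`:
`(H w, w) = ∫ σ(x) w(-x) \overline{w(x)} dx` for all `w ∈ ℍ²₊(ℝ)`.
(Mathlib's inner product is linear in the second argument.) -/
structure IsHankelOperator (σ : ℝ → ℂ) (H : hardySpace →L[ℂ] hardySpace) : Prop where
  memLp_symbol : MemLp σ ⊤ volume
  form_eq : ∀ w : hardySpace,
    inner ℂ w (H w) = ∫ x : ℝ, σ x * (w : L2R) (-x) * conj ((w : L2R) x)

/-- The symbol `π i sgn x` (of the Carleman operator). -/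
def carlemanSymbol (x : ℝ) : ℂ := (Real.pi : ℂ) * I * (Real.sign x : ℂ)

/-- The rational function `∑ₘ Qₘ(x) (αₘ - i x)^{-Kₘ-1}`. -/
def rationalSymbol {M : ℕ} (α : Fin M → ℂ) (K : Fin M → ℕ) (Q : Fin M → ℂ[X]) (x : ℝ) : ℂ :=
  ∑ m, (Q m).eval (x : ℂ) / (α m - I * (x : ℂ)) ^ (K m + 1)

/-- The contribution to the number of negative eigenvalues of a term with real `α`, where `K + 1` is
the order of the pole and `p` is the (real, nonzero) leading coefficient. -/
def negIndex (K : ℕ) (p : ℝ) : ℕ :=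
  if Odd K then (K + 1) / 2 else if 0 < p then K / 2 else K / 2 + 1

/-- The number of strictly negative eigenvalues of an operator, counted with (geometric)
multiplicity, as a cardinal. -/
def negEigenvalueCount {E : Type} [NormedAddCommGroup E] [InnerProductSpace ℂ E]
    (A : E →L[ℂ] E) : Cardinal.{0} :=
  Cardinal.sum fun μ : Set.Iio (0 : ℝ) =>
    Module.rank ℂ (Module.End.eigenspace (A : E →ₗ[ℂ] E) ((μ : ℝ) : ℂ))

end

/-!
The functions `f = ∑ c_b / (b - i x)` with `b > 0` are dense in the Hardy space. Let
`g s = ∑ c_b / (s + b)`. The symbol `π i sgn x` contributes `2π ‖g‖²`, with the norm of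
`L²(0, ∞)`, to the form `(H f, f)`, and by the residue theorem the rational symbol contributes a
Hermitian form `h` in the Taylor coefficients of `g` of order at most `Kₘ` at `αₘ` and at its
conjugate. Hence `(H f, f)` is nonnegative as soon as the coefficients that carry the negative part
of `h` vanish, which bounds `N₋(H)` from above by the negative index of `h`. Conversely,
finitely many Taylor coefficients of `g` can be prescribed while `‖g‖` is arbitrarily small, so
every negative subspace of `h` lifts to one of `H`. The negative index of `h` is read off a block
matrix: a real `αₘ` gives a triangular Hankel block on the diagonal, and a conjugate pair gives two
mutually adjoint invertible blocks off the diagonal, hence the index `Kₘ + 1`.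
-/

noncomputable section

section ClosedRange

variable {𝕜 E F : Type*} [RCLike 𝕜] [NormedAddCommGroup E] [InnerProductSpace 𝕜 E]

lemma finiteDimensional_orthogonal_ker [AddCommGroup F] [Module 𝕜 F] [FiniteDimensional 𝕜 F]
    (L : E →ₗ[𝕜] F) : FiniteDimensional 𝕜 (LinearMap.ker L)ᗮ := by
  refine FiniteDimensional.of_injective (L ∘ₗ (LinearMap.ker L)ᗮ.subtype) ?_
  rw [← LinearMap.ker_eq_bot, LinearMap.ker_eq_bot']
  intro x hx
  have hker : (x : E) ∈ LinearMap.ker L := hx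
  simpa using Submodule.inner_right_of_mem_orthogonal hker x.2

lemma isClosed_range_of_antilipschitzWith_subtypeL [NormedAddCommGroup F] [NormedSpace 𝕜 F]
    {B : E →L[𝕜] F} {V : Submodule 𝕜 E} [CompleteSpace V] [FiniteDimensional 𝕜 Vᗮ] {C : ℝ≥0}
    (hB : AntilipschitzWith C (B ∘L V.subtypeL)) : IsClosed (B.range : Set F) := by
  have hV : (B ∘L V.subtypeL).range = V.map (B : E →ₗ[𝕜] F) := by
    ext y
    simp
  have hclosed : IsClosed (V.map (B : E →ₗ[𝕜] F) : Set F) := by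
    rw [← hV]
    exact hB.isClosed_range (B ∘L V.subtypeL).uniformContinuous
  have hsup := Submodule.isClosed_sup_finiteDimensional _ (Vᗮ.map (B : E →ₗ[𝕜] F)) hclosed
  rwa [← Submodule.map_sup, Submodule.sup_orthogonal_of_hasOrthogonalProjection,
    Submodule.map_top] at hsup

lemma hasEigenvalue_of_mem_spectrum_of_isClosed_range [CompleteSpace E] {A : E →L[𝕜] E}
    (hA : (A : E →ₗ[𝕜] E).IsSymmetric) {μ : ℝ}
    (hclosed : IsClosed ((algebraMap 𝕜 (E →L[𝕜] E) μ - A).range : Set E))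
    (hμ : (μ : 𝕜) ∈ spectrum 𝕜 A) : Module.End.HasEigenvalue (A : E →ₗ[𝕜] E) (μ : 𝕜) := by
  contrapose! hμ with hne
  set B : E →L[𝕜] E := algebraMap 𝕜 (E →L[𝕜] E) μ - A
  have hB (x : E) : B x = (μ : 𝕜) • x - A x := rfl
  have hsymm : (B : E →ₗ[𝕜] E).IsSymmetric := fun x y => by
    have hAxy : inner 𝕜 (A x) y = inner 𝕜 x (A y) := hA x y
    simp only [ContinuousLinearMap.coe_coe, hB, inner_sub_left, inner_sub_right, inner_smul_left,
      inner_smul_right, hAxy, RCLike.conj_ofReal]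
  have hker : B.ker = ⊥ := by
    rw [Module.End.hasEigenvalue_iff, not_not] at hne
    rw [← hne]
    ext x
    rw [LinearMap.mem_ker, ContinuousLinearMap.coe_coe, hB, sub_eq_zero,
      Module.End.mem_eigenspace_iff, ContinuousLinearMap.coe_coe, eq_comm]
  have hrange : B.range = ⊤ := by
    have := hclosed.completeSpace_coe
    rw [← Submodule.orthogonal_eq_bot_iff, ← hker]
    exact hsymm.orthogonal_range
  rw [spectrum.notMem_iff, ContinuousLinearMap.isUnit_iff_bijective]
  exact ⟨LinearMap.ker_eq_bot.1 hker, LinearMap.range_eq_top.1 hrange⟩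

lemma neg_mul_norm_le_norm_smul_sub {x y : E} (h : 0 ≤ RCLike.re (inner 𝕜 x y)) (μ : ℝ) :
    -μ * ‖x‖ ≤ ‖(μ : 𝕜) • x - y‖ := by
  rcases (norm_nonneg x).eq_or_lt with hx | hx
  · simp [← hx]
  refine le_of_mul_le_mul_left ?_ hx
  calc ‖x‖ * (-μ * ‖x‖) = -(μ * ‖x‖ ^ 2) := by ring
    _ ≤ -RCLike.re (inner 𝕜 x ((μ : 𝕜) • x - y)) := by
        rw [inner_sub_right, inner_smul_right, map_sub, RCLike.re_ofReal_mul,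
          inner_self_eq_norm_sq]
        linarith
    _ ≤ ‖inner 𝕜 x ((μ : 𝕜) • x - y)‖ := (neg_le_abs _).trans (RCLike.abs_re_le_norm _)
    _ ≤ ‖x‖ * ‖(μ : 𝕜) • x - y‖ := norm_inner_le_norm _ _

lemma hasEigenvalue_of_mem_spectrum_of_neg [CompleteSpace E] [NormedAddCommGroup F]
    [NormedSpace 𝕜 F] [FiniteDimensional 𝕜 F] {A : E →L[𝕜] E}
    (hA : (A : E →ₗ[𝕜] E).IsSymmetric) (L : E →L[𝕜] F)
    (hL : ∀ w, L w = 0 → 0 ≤ RCLike.re (inner 𝕜 w (A w))) {μ : ℝ} (hμ : μ < 0)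
    (hmem : (μ : 𝕜) ∈ spectrum 𝕜 A) :
    Module.End.HasEigenvalue (A : E →ₗ[𝕜] E) (μ : 𝕜) := by
  have : CompleteSpace L.ker := L.isClosed_ker.completeSpace_coe
  have : FiniteDimensional 𝕜 L.kerᗮ := finiteDimensional_orthogonal_ker (L : E →ₗ[𝕜] F)
  refine hasEigenvalue_of_mem_spectrum_of_isClosed_range hA
    (isClosed_range_of_antilipschitzWith_subtypeL (V := L.ker) (C := Real.toNNReal (-μ)⁻¹) ?_) hmem
  refine ContinuousLinearMap.antilipschitz_of_bound _ fun x => ?_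
  rw [Real.coe_toNNReal _ (by simpa using hμ.le), ← div_eq_inv_mul, le_div_iff₀' (by linarith)]
  simpa [Algebra.algebraMap_eq_smul_one] using neg_mul_norm_le_norm_smul_sub (hL x x.2) μ

end ClosedRange

section NegativeSpectrum

variable {E : Type} [NormedAddCommGroup E] [InnerProductSpace ℂ E] {A : E →L[ℂ] E}

lemma re_inner_nonneg_of_spectrum [CompleteSpace E] (hA : (A : E →ₗ[ℂ] E).IsSymmetric)
    (hspec : ∀ μ : ℝ, μ < 0 → (μ : ℂ) ∉ spectrum ℂ A) (x : E) : 0 ≤ (inner ℂ x (A x)).re := by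
  have hsa : IsSelfAdjoint A := ContinuousLinearMap.isSelfAdjoint_iff_isSymmetric.2 hA
  have hnonneg : 0 ≤ A := by
    rw [nonneg_iff_isSelfAdjoint_and_quasispectrumRestricts]
    refine ⟨hsa, ?_⟩
    rw [quasispectrumRestricts_iff_spectrumRestricts, SpectrumRestricts.nnreal_iff]
    intro μ hμ
    by_contra! hneg
    rw [← spectrum.preimage_algebraMap ℂ] at hμ
    exact hspec μ hneg (by simpa using hμ)
  exact ((ContinuousLinearMap.nonneg_iff_isPositive A).1 hnonneg).re_inner_nonneg_right x

/-- The eigenspace of `A` at the negative real number `μ`. -/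
abbrev negEigenspace (A : E →L[ℂ] E) (μ : Set.Iio (0 : ℝ)) : Submodule ℂ E :=
  Module.End.eigenspace (A : E →ₗ[ℂ] E) ((μ : ℝ) : ℂ)

/-- The algebraic span of the eigenvectors of `A` with negative eigenvalues. -/
def negEigenspan (A : E →L[ℂ] E) : Submodule ℂ E := ⨆ μ, negEigenspace A μ

lemma mem_orthogonal_negEigenspan {x : E} :
    x ∈ (negEigenspan A)ᗮ ↔ ∀ μ : ℝ, μ < 0 → ∀ v, A v = (μ : ℂ) • v → inner ℂ v x = 0 := by
  simp only [negEigenspan, ← Submodule.iInf_orthogonal, Submodule.mem_iInf,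
    Submodule.mem_orthogonal, Module.End.mem_eigenspace_iff, Subtype.forall, Set.mem_Iio,
    ContinuousLinearMap.coe_coe]

section Symmetric

variable (hA : (A : E →ₗ[ℂ] E).IsSymmetric)
include hA

lemma orthogonalFamily_negEigenspace :
    OrthogonalFamily ℂ (fun μ => negEigenspace A μ) fun μ => (negEigenspace A μ).subtypeₗᵢ :=
  hA.orthogonalFamily_eigenspaces.comp (γ := Set.Iio (0 : ℝ)) (f := fun μ => ((μ : ℝ) : ℂ))
    (Complex.ofReal_injective.comp Subtype.val_injective)

lemma rank_negEigenspan : Module.rank ℂ (negEigenspan A) = negEigenvalueCount A := by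
  have hindep := (orthogonalFamily_negEigenspace hA).independent
  rw [negEigenvalueCount, negEigenspan, ← DirectSum.range_coeLinearMap,
    rank_range_of_injective (DirectSum.coeLinearMap (negEigenspace A))
      hindep.dfinsupp_lsum_injective, rank_directSum]

lemma re_inner_neg_of_mem_negEigenspan {x : E} (hx : x ∈ negEigenspan A) (hx0 : x ≠ 0) :
    (inner ℂ x (A x)).re < 0 := by
  classical
  obtain ⟨c, rfl⟩ := (Submodule.mem_iSup_iff_exists_dfinsupp' _ _).1 hx
  have hAc (μ : Set.Iio (0 : ℝ)) : A (c μ : E) = (((μ : ℝ) : ℂ) • c μ : negEigenspace A μ) := by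
    simpa using Module.End.mem_eigenspace_iff.1 (c μ).2
  have hdiag := (orthogonalFamily_negEigenspace hA).inner_sum (fun μ => c μ)
    (fun μ => ((μ : ℝ) : ℂ) • c μ) c.support
  simp only [Submodule.coe_subtypeₗᵢ, Submodule.subtype_apply] at hdiag
  simp only [DFinsupp.sum, map_sum, hAc]
  rw [hdiag, Complex.re_sum]
  refine Finset.sum_neg (fun μ hμ => ?_) (Finset.nonempty_iff_ne_empty.2 fun h => hx0 ?_)
  · have hpos : 0 < ‖c μ‖ ^ 2 := pow_pos (norm_pos_iff.2 (DFinsupp.mem_support_iff.1 hμ)) 2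
    rw [inner_smul_right, re_ofReal_mul]
    exact mul_neg_of_neg_of_pos μ.2 (by rwa [← inner_self_eq_norm_sq (𝕜 := ℂ)] at hpos)
  · simp [DFinsupp.sum, h]

lemma negEigenvalueCount_le {F : Type*} [AddCommGroup F] [Module ℂ F] [FiniteDimensional ℂ F]
    (L : E →ₗ[ℂ] F) (hL : ∀ w, L w = 0 → 0 ≤ (inner ℂ w (A w)).re) :
    negEigenvalueCount A ≤ Module.finrank ℂ F := by
  have hinj : Function.Injective (L ∘ₗ (negEigenspan A).subtype) := by
    rw [injective_iff_map_eq_zero]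
    intro x hx
    by_contra hx0
    exact (hL x hx).not_gt
      (re_inner_neg_of_mem_negEigenspan hA x.2 (by simpa using hx0))
  have := FiniteDimensional.of_injective _ hinj
  rw [← rank_negEigenspan hA, ← Module.finrank_eq_rank]
  exact_mod_cast LinearMap.finrank_le_finrank_of_injective hinj

lemma apply_mem_orthogonal_negEigenspan {x : E} (hx : x ∈ (negEigenspan A)ᗮ) :
    A x ∈ (negEigenspan A)ᗮ := by
  rw [mem_orthogonal_negEigenspan] at hx ⊢
  intro μ hμ v hv
  have hswap : inner ℂ (A v) x = inner ℂ v (A x) := hA v x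
  rw [← hswap, hv, inner_smul_left, hx μ hμ v hv, mul_zero]

lemma re_inner_nonneg_of_mem_orthogonal_negEigenspan [CompleteSpace E] {F : Type*}
    [NormedAddCommGroup F] [NormedSpace ℂ F] [FiniteDimensional ℂ F] (L : E →L[ℂ] F)
    (hL : ∀ w, L w = 0 → 0 ≤ (inner ℂ w (A w)).re) {x : E} (hx : x ∈ (negEigenspan A)ᗮ) :
    0 ≤ (inner ℂ x (A x)).re := by
  let A' : (negEigenspan A)ᗮ →L[ℂ] (negEigenspan A)ᗮ :=
    (A ∘L (negEigenspan A)ᗮ.subtypeL).codRestrict _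
      fun v => apply_mem_orthogonal_negEigenspan hA v.2
  have hA' : (A' : (negEigenspan A)ᗮ →ₗ[ℂ] (negEigenspan A)ᗮ).IsSymmetric := fun u v => hA u v
  refine re_inner_nonneg_of_spectrum hA' (fun μ hμ hmem => ?_) ⟨x, hx⟩
  obtain ⟨v, hv⟩ := (hasEigenvalue_of_mem_spectrum_of_neg hA'
    (L ∘L (negEigenspan A)ᗮ.subtypeL) (fun w hw => hL w hw) hμ hmem).exists_hasEigenvector
  have hAv : A (v : E) = (μ : ℂ) • (v : E) := congrArg Subtype.val hv.apply_eq_smul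
  have hv0 := mem_orthogonal_negEigenspan.1 v.2 μ hμ v hAv
  exact hv.2 (Subtype.ext (inner_self_eq_zero.1 hv0))

theorem negEigenvalueCount_eq [CompleteSpace E] {F : Type*} [NormedAddCommGroup F]
    [NormedSpace ℂ F] [FiniteDimensional ℂ F] (L : E →L[ℂ] F)
    (hL : ∀ w, L w = 0 → 0 ≤ (inner ℂ w (A w)).re)
    {W : Type*} [AddCommGroup W] [Module ℂ W] [FiniteDimensional ℂ W] (J : W →ₗ[ℂ] E)
    (hJ : ∀ x, x ≠ 0 → (inner ℂ (J x) (A (J x))).re < 0)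
    (hdim : Module.finrank ℂ F ≤ Module.finrank ℂ W) :
    negEigenvalueCount A = Module.finrank ℂ F := by
  refine le_antisymm (negEigenvalueCount_le hA (L : E →ₗ[ℂ] F) hL) ?_
  by_contra! hlt
  rw [← rank_negEigenspan hA] at hlt
  have : FiniteDimensional ℂ (negEigenspan A) :=
    Module.rank_lt_aleph0_iff.1 (hlt.trans Cardinal.natCast_lt_aleph0)
  have hlt' : Module.finrank ℂ (negEigenspan A) < Module.finrank ℂ W := by
    rw [← Module.finrank_eq_rank ℂ (negEigenspan A), Nat.cast_lt] at hlt
    exact hlt.trans_le hdim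
  obtain ⟨x, hx, hx0⟩ := Submodule.exists_mem_ne_zero_of_ne_bot
    (LinearMap.ker_ne_bot_of_finrank_lt
      (f := ((negEigenspan A).orthogonalProjectionOnto : E →ₗ[ℂ] _) ∘ₗ J) hlt')
  exact (re_inner_nonneg_of_mem_orthogonal_negEigenspan hA L hL (by simpa using hx)).not_gt
    (hJ x hx0)

end Symmetric

end NegativeSpectrum

section CauchyKernel

/-- The Cauchy kernel `(a - i x)^{-k-1}`, which for `Re a > 0` belongs to the Hardy space. The order
is shifted by one, so that `k = 0` is the simple pole. -/
def cauchyKernel (a : ℂ) (k : ℕ) (x : ℝ) : ℂ := 1 / (a - I * x) ^ (k + 1)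

lemma sub_I_mul_ne_zero {a : ℂ} (ha : 0 < a.re) (x : ℝ) : a - I * x ≠ 0 := by
  intro h
  have := congrArg Complex.re h
  simp at this
  linarith

lemma add_I_mul_ne_zero {a : ℂ} (ha : 0 < a.re) (x : ℝ) : a + I * x ≠ 0 := by
  simpa using sub_I_mul_ne_zero ha (-x)

lemma add_ne_zero_of_re_pos {a b : ℂ} (ha : 0 < a.re) (hb : 0 < b.re) : a + b ≠ 0 := by
  intro h
  have := congrArg Complex.re h
  simp at this
  linarith

lemma cauchyKernel_neg (a : ℂ) (k : ℕ) (x : ℝ) :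
    cauchyKernel a k (-x) = 1 / (a + I * x) ^ (k + 1) := by
  simp [cauchyKernel]

lemma conj_cauchyKernel (a : ℂ) (k : ℕ) (x : ℝ) :
    conj (cauchyKernel a k x) = cauchyKernel (conj a) k (-x) := by
  simp [cauchyKernel]

lemma continuous_cauchyKernel {a : ℂ} (ha : 0 < a.re) (k : ℕ) : Continuous (cauchyKernel a k) :=
  continuous_const.div (by fun_prop) fun x => pow_ne_zero _ (sub_I_mul_ne_zero ha x)

lemma norm_cauchyKernel_le {a : ℂ} (ha : 0 < a.re) (k : ℕ) (x : ℝ) :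
    ‖cauchyKernel a k x‖ ≤ (1 / a.re) ^ (k + 1) := by
  have hre : a.re ≤ ‖a - I * x‖ := by simpa using Complex.re_le_norm (a - I * x)
  rw [cauchyKernel, norm_div, norm_one, norm_pow, ← one_div_pow]
  gcongr

lemma sq_norm_cauchyKernel_zero (a : ℂ) (x : ℝ) :
    ‖cauchyKernel a 0 x‖ ^ 2 = 1 / (a.re ^ 2 + (x - a.im) ^ 2) := by
  rw [cauchyKernel, norm_div, norm_one, zero_add, pow_one, div_pow, one_pow, ← normSq_eq_norm_sq,
    normSq_apply]
  simp
  ring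

lemma integrable_sq_norm_cauchyKernel_zero {a : ℂ} (ha : 0 < a.re) :
    Integrable (fun x => ‖cauchyKernel a 0 x‖ ^ 2) := by
  refine (((integrable_inv_one_add_sq.comp_div ha.ne').comp_sub_right a.im).const_mul
    (1 / a.re ^ 2)).congr (Eventually.of_forall fun x => ?_)
  simp only [sq_norm_cauchyKernel_zero]
  field_simp

lemma memLp_cauchyKernel {a : ℂ} (ha : 0 < a.re) (k : ℕ) :
    MemLp (cauchyKernel a k) 2 (volume : Measure ℝ) := by
  induction k with
  | zero =>
    exact (memLp_two_iff_integrable_sq_norm (continuous_cauchyKernel ha 0).aestronglyMeasurable).2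
      (integrable_sq_norm_cauchyKernel_zero ha)
  | succ k ih =>
    refine ih.of_le_mul (c := (1 / a.re) ^ (0 + 1))
      (continuous_cauchyKernel ha _).aestronglyMeasurable (Eventually.of_forall fun x => ?_)
    have hsucc : cauchyKernel a (k + 1) x = cauchyKernel a 0 x * cauchyKernel a k x := by
      simp [cauchyKernel, pow_succ]
    rw [hsucc, norm_mul]
    exact mul_le_mul_of_nonneg_right (norm_cauchyKernel_le ha 0 x) (norm_nonneg _)

lemma memLp_cauchyKernel_neg {a : ℂ} (ha : 0 < a.re) (k : ℕ) :
    MemLp (fun x => cauchyKernel a k (-x)) 2 (volume : Measure ℝ) :=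
  (memLp_cauchyKernel ha k).comp_measurePreserving (Measure.measurePreserving_neg volume)

end CauchyKernel

section LineIntegrals

lemma tendsto_log_add_mul_sub_log (b : ℂ) {u : ℂ} (hu : u ∈ slitPlane) :
    Tendsto (fun x : ℝ => log (b + u * x) - (Real.log x : ℂ)) atTop (𝓝 (log u)) := by
  have h : Tendsto (fun x : ℝ => b * ((x⁻¹ : ℝ) : ℂ) + u) atTop (𝓝 u) := by
    have : Tendsto (fun x : ℝ => ((x⁻¹ : ℝ) : ℂ)) atTop (𝓝 ((0 : ℝ) : ℂ)) :=
      (continuous_ofReal.tendsto 0).comp tendsto_inv_atTop_zero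
    simpa using (this.const_mul b).add_const u
  refine (h.clog hu).congr' ?_
  filter_upwards [eventually_gt_atTop 0, h.eventually_ne (slitPlane_ne_zero hu)] with x hx hne
  have hx' : (x : ℂ) ≠ 0 := by exact_mod_cast hx.ne'
  have : b + u * x = (x : ℂ) * (b * ((x⁻¹ : ℝ) : ℂ) + u) := by
    push_cast
    field_simp
  rw [this, log_ofReal_mul hx hne]
  ring

lemma tendsto_log_add_mul_sub_log_add_mul (b c : ℂ) {u v : ℂ} (hu : u ∈ slitPlane)
    (hv : v ∈ slitPlane) :
    Tendsto (fun x : ℝ => log (b + u * x) - log (c + v * x)) atTop (𝓝 (log u - log v)) := by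
  refine ((tendsto_log_add_mul_sub_log b hu).sub (tendsto_log_add_mul_sub_log c hv)).congr
    fun x => ?_
  ring

lemma hasDerivAt_log_add_mul {b u : ℂ} {x : ℝ} (h : b + u * x ∈ slitPlane) :
    HasDerivAt (fun x : ℝ => log (b + u * x)) (u / (b + u * x)) x := by
  have h1 : HasDerivAt (fun x : ℝ => b + u * (x : ℂ)) u x := by
    simpa using ((hasDerivAt_id x).ofReal_comp.const_mul u).const_add b
  exact h1.clog_real h

lemma integral_one_div_mul_one_div {b c u v : ℂ} (hb : ∀ x : ℝ, b + u * x ∈ slitPlane)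
    (hc : ∀ x : ℝ, c + v * x ∈ slitPlane) (hu : u ∈ slitPlane) (hu' : -u ∈ slitPlane)
    (hv : v ∈ slitPlane) (hv' : -v ∈ slitPlane) (h : u * c - v * b ≠ 0)
    (hint : Integrable fun x : ℝ => 1 / (b + u * x) * (1 / (c + v * x))) :
    ∫ x : ℝ, 1 / (b + u * x) * (1 / (c + v * x)) =
      1 / (u * c - v * b) * (log u - log v) - 1 / (u * c - v * b) * (log (-u) - log (-v)) := by
  have hderiv : ∀ x : ℝ, HasDerivAt
      (fun x : ℝ => 1 / (u * c - v * b) * (log (b + u * x) - log (c + v * x)))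
      (1 / (b + u * x) * (1 / (c + v * x))) x := by
    intro x
    refine (((hasDerivAt_log_add_mul (hb x)).sub (hasDerivAt_log_add_mul (hc x))).const_mul
      (1 / (u * c - v * b))).congr_deriv ?_
    have h1 := slitPlane_ne_zero (hb x)
    have h2 := slitPlane_ne_zero (hc x)
    field_simp
    ring
  have hbot : Tendsto (fun x : ℝ => log (b + u * x) - log (c + v * x)) atBot
      (𝓝 (log (-u) - log (-v))) :=
    ((tendsto_log_add_mul_sub_log_add_mul b c hu' hv').comp tendsto_neg_atBot_atTop).congr
      fun x => by simp
  exact integral_of_hasDerivAt_of_tendsto hderiv hint (hbot.const_mul _)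
    ((tendsto_log_add_mul_sub_log_add_mul b c hu hv).const_mul _)

lemma I_mem_slitPlane : I ∈ slitPlane := by simp [mem_slitPlane_iff]

lemma neg_I_mem_slitPlane : -I ∈ slitPlane := by simp [mem_slitPlane_iff]

lemma add_I_mul_mem_slitPlane {a : ℂ} (ha : 0 < a.re) (x : ℝ) : a + I * x ∈ slitPlane := by
  left; simpa using ha

lemma add_neg_I_mul_mem_slitPlane {a : ℂ} (ha : 0 < a.re) (x : ℝ) : a + -I * x ∈ slitPlane := by
  left; simpa using ha

lemma integrable_cauchyKernel_mul_cauchyKernel {b c : ℂ} (hb : 0 < b.re) (hc : 0 < c.re)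
    (j k : ℕ) : Integrable (fun x => cauchyKernel b j x * cauchyKernel c k x) :=
  (memLp_cauchyKernel hb j).integrable_mul (memLp_cauchyKernel hc k)

lemma integrable_cauchyKernel_neg_mul_cauchyKernel {b c : ℂ} (hb : 0 < b.re) (hc : 0 < c.re)
    (j k : ℕ) : Integrable (fun x => cauchyKernel b j (-x) * cauchyKernel c k x) :=
  (memLp_cauchyKernel_neg hb j).integrable_mul (memLp_cauchyKernel hc k)

lemma integrable_cauchyKernel_succ {a : ℂ} (ha : 0 < a.re) (k : ℕ) :
    Integrable (cauchyKernel a (k + 1)) := by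
  refine (integrable_cauchyKernel_mul_cauchyKernel ha ha 0 k).congr
    (Eventually.of_forall fun x => ?_)
  simp only [cauchyKernel, zero_add, pow_one, one_div, ← mul_inv, ← pow_succ']

lemma hasDerivAt_cauchyKernel {a : ℂ} (ha : 0 < a.re) (k : ℕ) (x : ℝ) :
    HasDerivAt (cauchyKernel a k) ((k + 1) * I * cauchyKernel a (k + 1) x) x := by
  have hz := sub_I_mul_ne_zero ha x
  have hline : HasDerivAt (fun x : ℝ => a - I * (x : ℂ)) (-I) x := by
    simpa using ((hasDerivAt_id x).ofReal_comp.const_mul I).const_sub a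
  have hpow := (hline.pow (k + 1)).inv (pow_ne_zero _ hz)
  refine (hpow.congr_deriv ?_).congr_of_eventuallyEq
    (Eventually.of_forall fun y => one_div ((a - I * (y : ℂ)) ^ (k + 1)))
  simp only [cauchyKernel, Pi.pow_apply, add_tsub_cancel_right]
  push_cast
  field_simp
  ring

lemma tendsto_cauchyKernel_cobounded (a : ℂ) (k : ℕ) :
    Tendsto (cauchyKernel a k) (Bornology.cobounded ℝ) (𝓝 0) := by
  have hline : Tendsto (fun x : ℝ => a - I * (x : ℂ)) (Bornology.cobounded ℝ)
      (Bornology.cobounded ℂ) := by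
    refine (tendsto_const_sub_cobounded a).comp (tendsto_norm_atTop_iff_cobounded.1 ?_)
    simpa only [norm_mul, norm_I, one_mul, norm_real] using tendsto_norm_cobounded_atTop (E := ℝ)
  have hpow := (tendsto_inv₀_cobounded.comp hline).pow (k + 1)
  rw [zero_pow k.succ_ne_zero] at hpow
  refine hpow.congr fun x => ?_
  rw [cauchyKernel, one_div, ← inv_pow, Function.comp_apply]

lemma integral_cauchyKernel_succ {a : ℂ} (ha : 0 < a.re) (k : ℕ) :
    ∫ x, cauchyKernel a (k + 1) x = 0 := by
  have hlim := tendsto_cauchyKernel_cobounded a k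
  rw [IsOrderBornology.cobounded_eq, tendsto_sup] at hlim
  have h := integral_of_hasDerivAt_of_tendsto (hasDerivAt_cauchyKernel ha k)
    ((integrable_cauchyKernel_succ ha k).const_mul _) hlim.1 hlim.2
  rw [integral_const_mul, sub_zero] at h
  exact (mul_eq_zero.1 h).resolve_left (mul_ne_zero k.cast_add_one_ne_zero I_ne_zero)

lemma integral_cauchyKernel_mul_cauchyKernel {b c : ℂ} (hb : 0 < b.re) (hc : 0 < c.re) :
    ∫ x, cauchyKernel b 0 x * cauchyKernel c 0 x = 0 := by
  have hint := integrable_cauchyKernel_mul_cauchyKernel hb hc 0 0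
  obtain rfl | hbc := eq_or_ne b c
  · rw [← integral_cauchyKernel_succ hb 0]
    exact integral_congr_ae (Eventually.of_forall fun x => by simp [cauchyKernel, pow_two])
  · simp only [cauchyKernel, zero_add, pow_one, sub_eq_add_neg, ← neg_mul] at hint ⊢
    have h : -I * c - -I * b ≠ 0 := by
      rw [← mul_sub]
      exact mul_ne_zero (neg_ne_zero.2 I_ne_zero) (sub_ne_zero.2 hbc.symm)
    rw [integral_one_div_mul_one_div (add_neg_I_mul_mem_slitPlane hb)
      (add_neg_I_mul_mem_slitPlane hc) neg_I_mem_slitPlane (by simpa using I_mem_slitPlane)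
      neg_I_mem_slitPlane (by simpa using I_mem_slitPlane) h hint]
    simp

lemma integral_cauchyKernel_zero_neg_mul_cauchyKernel {a b : ℂ} (ha : 0 < a.re) (hb : 0 < b.re) :
    ∫ x, cauchyKernel a 0 (-x) * cauchyKernel b 0 x = 2 * Real.pi / (a + b) := by
  have hab := add_ne_zero_of_re_pos ha hb
  have hint := integrable_cauchyKernel_neg_mul_cauchyKernel ha hb 0 0
  simp only [cauchyKernel, zero_add, pow_one, sub_eq_add_neg, ← neg_mul, ofReal_neg, neg_mul_neg]
    at hint ⊢
  have h : I * b - -I * a = I * (a + b) := by ring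
  rw [integral_one_div_mul_one_div (add_I_mul_mem_slitPlane ha) (add_neg_I_mul_mem_slitPlane hb)
    I_mem_slitPlane neg_I_mem_slitPlane neg_I_mem_slitPlane (by simpa using I_mem_slitPlane)
    (h ▸ mul_ne_zero I_ne_zero hab) hint, h, neg_neg, log_I, log_neg_I]
  field_simp
  ring

lemma integral_cauchyKernel_neg_mul_cauchyKernel {a b : ℂ} (ha : 0 < a.re) (hb : 0 < b.re)
    (k : ℕ) :
    ∫ x, cauchyKernel a k (-x) * cauchyKernel b 0 x = 2 * Real.pi / (a + b) ^ (k + 1) := by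
  have hab := add_ne_zero_of_re_pos ha hb
  induction k with
  | zero => simpa using integral_cauchyKernel_zero_neg_mul_cauchyKernel ha hb
  | succ k ih =>
    have hsplit : ∀ x : ℝ, cauchyKernel a (k + 1) (-x) * cauchyKernel b 0 x =
        1 / (a + b) * (cauchyKernel a (k + 1) (-x) +
          cauchyKernel a k (-x) * cauchyKernel b 0 x) := by
      intro x
      have h1 := add_I_mul_ne_zero ha x
      have h2 := sub_I_mul_ne_zero hb x
      rw [cauchyKernel_neg, cauchyKernel_neg, cauchyKernel]
      field_simp
      ring
    simp only [hsplit]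
    rw [integral_const_mul, integral_add (integrable_cauchyKernel_succ ha k).comp_neg
      (integrable_cauchyKernel_neg_mul_cauchyKernel ha hb k 0),
      integral_neg_eq_self (cauchyKernel a (k + 1)), integral_cauchyKernel_succ ha, ih]
    field_simp
    ring

lemma integrable_cauchyKernel_mul_neg {a b c : ℂ} (ha : 0 < a.re) (hb : 0 < b.re)
    (hc : 0 < c.re) (k : ℕ) :
    Integrable fun x => cauchyKernel a k x * (cauchyKernel b 0 (-x) * cauchyKernel c 0 (-x)) :=
  (integrable_cauchyKernel_mul_cauchyKernel hb hc 0 0).comp_neg.bdd_mul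
    (continuous_cauchyKernel ha k).aestronglyMeasurable
    (Eventually.of_forall (norm_cauchyKernel_le ha k))

/-- One step of the recursion in `k` behind `integral_cauchyKernel_mul_neg`; `g` stands for the
kernel of order one less, which is `1` for `k = 0`. -/
lemma integral_cauchyKernel_mul_neg_of_step {a b c : ℂ} (ha : 0 < a.re) (hb : 0 < b.re)
    (hc : 0 < c.re) (k : ℕ) {g : ℝ → ℂ} (hg : ∀ x, g x = (a - I * x) * cauchyKernel a k x)
    (hint : Integrable fun x => g x * (cauchyKernel b 0 (-x) * cauchyKernel c 0 (-x))) :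
    ∫ x, cauchyKernel a k x * (cauchyKernel b 0 (-x) * cauchyKernel c 0 (-x)) =
      1 / (a + b) * (2 * Real.pi / (a + c) ^ (k + 1) +
        ∫ x, g x * (cauchyKernel b 0 (-x) * cauchyKernel c 0 (-x))) := by
  have hab := add_ne_zero_of_re_pos ha hb
  have hsplit : ∀ x : ℝ, cauchyKernel a k x * (cauchyKernel b 0 (-x) * cauchyKernel c 0 (-x)) =
      1 / (a + b) * (cauchyKernel c 0 (-x) * cauchyKernel a k x +
        g x * (cauchyKernel b 0 (-x) * cauchyKernel c 0 (-x))) := by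
    intro x
    have h2 := add_I_mul_ne_zero hb x
    have h3 := add_I_mul_ne_zero hc x
    rw [hg, cauchyKernel_neg, cauchyKernel_neg]
    field_simp
    ring
  have hac : ∫ x, cauchyKernel c 0 (-x) * cauchyKernel a k x = 2 * Real.pi / (a + c) ^ (k + 1) := by
    rw [← integral_cauchyKernel_neg_mul_cauchyKernel ha hc, ← integral_neg_eq_self]
    simp only [neg_neg, mul_comm]
  simp only [hsplit]
  rw [integral_const_mul, integral_add
    (integrable_cauchyKernel_neg_mul_cauchyKernel hc ha 0 k) hint, hac]

lemma integral_cauchyKernel_mul_neg {a b c : ℂ} (ha : 0 < a.re) (hb : 0 < b.re) (hc : 0 < c.re)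
    (k : ℕ) :
    ∫ x, cauchyKernel a k x * (cauchyKernel b 0 (-x) * cauchyKernel c 0 (-x)) =
      2 * Real.pi * ∑ p ∈ Finset.HasAntidiagonal.antidiagonal k,
        1 / (a + b) ^ (p.1 + 1) * (1 / (a + c) ^ (p.2 + 1)) := by
  have hab := add_ne_zero_of_re_pos ha hb
  have hac := add_ne_zero_of_re_pos ha hc
  induction k with
  | zero =>
    have h0 := integral_cauchyKernel_mul_cauchyKernel hb hc
    rw [← integral_neg_eq_self] at h0
    rw [integral_cauchyKernel_mul_neg_of_step ha hb hc 0 (g := fun _ => 1)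
      (fun x => by
        have := sub_I_mul_ne_zero ha x
        rw [cauchyKernel]
        field_simp
        ring)
      (by simpa only [one_mul] using (integrable_cauchyKernel_mul_cauchyKernel hb hc 0 0).comp_neg)]
    simp only [one_mul, h0, Finset.Nat.antidiagonal_zero, Finset.sum_singleton]
    field_simp
    ring
  | succ k ih =>
    rw [integral_cauchyKernel_mul_neg_of_step ha hb hc (k + 1) (g := cauchyKernel a k)
      (fun x => by
        have := sub_I_mul_ne_zero ha x
        simp only [cauchyKernel]
        field_simp
        ring)
      (integrable_cauchyKernel_mul_neg ha hb hc k), ih, Finset.Nat.sum_antidiagonal_succ]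
    simp only [mul_add, Finset.mul_sum]
    congr 1
    · field_simp
      ring
    · refine Finset.sum_congr rfl fun p _ => ?_
      field_simp
      ring

end LineIntegrals

section CarlemanForm

lemma hasDerivAt_neg_one_div_add {p x : ℝ} (hp : 0 < p) (hx : 0 ≤ x) :
    HasDerivAt (fun x : ℝ => -(x + p)⁻¹) (1 / (x + p) * (1 / (x + p))) x := by
  have hxp : x + p ≠ 0 := by positivity
  refine (((hasDerivAt_id x).add_const p).inv hxp).neg.congr_deriv ?_
  simp only [id]
  field_simp

lemma tendsto_neg_inv_add_atTop (p : ℝ) : Tendsto (fun x : ℝ => -(x + p)⁻¹) atTop (𝓝 0) := by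
  simpa using (tendsto_atTop_add_const_right _ p tendsto_id).inv_tendsto_atTop.neg

lemma integrableOn_Ioi_one_div_add_mul_self {p : ℝ} (hp : 0 < p) :
    IntegrableOn (fun s : ℝ => 1 / (s + p) * (1 / (s + p))) (Set.Ioi 0) :=
  integrableOn_Ioi_deriv_of_nonneg' (fun _ hx => hasDerivAt_neg_one_div_add hp hx)
    (fun _ _ => mul_self_nonneg _) (tendsto_neg_inv_add_atTop p)

lemma integral_Ioi_one_div_add_mul_one_div_add {p q : ℝ} (hp : 0 < p) (hq : 0 < q) :
    ∫ s in Set.Ioi (0 : ℝ), 1 / (s + p) * (1 / (s + q)) =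
      if p = q then 1 / p else (Real.log p - Real.log q) / (p - q) := by
  split_ifs with hpq
  · subst hpq
    rw [integral_Ioi_of_hasDerivAt_of_nonneg' (fun _ hx => hasDerivAt_neg_one_div_add hp hx)
      (fun _ _ => mul_self_nonneg _) (tendsto_neg_inv_add_atTop p)]
    simp
  · have hpq' : q - p ≠ 0 := sub_ne_zero.2 (Ne.symm hpq)
    have hderiv : ∀ x ∈ Set.Ici (0 : ℝ), HasDerivAt
        (fun x : ℝ => 1 / (q - p) * (Real.log (x + p) - Real.log (x + q)))
        (1 / (x + p) * (1 / (x + q))) x := by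
      intro x (hx : 0 ≤ x)
      have h1 : x + p ≠ 0 := by positivity
      have h2 : x + q ≠ 0 := by positivity
      refine (((((hasDerivAt_id x).add_const p).log h1).sub
        (((hasDerivAt_id x).add_const q).log h2)).const_mul (1 / (q - p))).congr_deriv ?_
      simp only [id]
      field_simp
      ring
    have hlim : Tendsto (fun x : ℝ => Real.log (x + p) - Real.log (x + q)) atTop (𝓝 0) := by
      simpa using (Real.tendsto_log_comp_add_sub_log p).sub (Real.tendsto_log_comp_add_sub_log q)
    have hnonneg : ∀ x ∈ Set.Ioi (0 : ℝ), 0 ≤ 1 / (x + p) * (1 / (x + q)) := by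
      intro x (hx : 0 < x)
      positivity
    rw [integral_Ioi_of_hasDerivAt_of_nonneg' hderiv hnonneg (hlim.const_mul _), ← neg_sub q p,
      div_neg]
    simp only [zero_add]
    ring

/-- Both sides have the same closed form; the left one reduces to it by substituting `u = x ^ 2`. -/
lemma integral_Ioi_div_sq_add_sq_mul {b c : ℝ} (hb : 0 < b) (hc : 0 < c) :
    ∫ x in Set.Ioi (0 : ℝ), (b + c) * x / ((x ^ 2 + b ^ 2) * (x ^ 2 + c ^ 2)) =
      ∫ s in Set.Ioi (0 : ℝ), 1 / (s + b) * (1 / (s + c)) := by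
  have hsubst := integral_comp_rpow_Ioi_of_pos (p := 2) two_pos
    (g := fun u : ℝ => 1 / (u + b ^ 2) * (1 / (u + c ^ 2)))
  have hpoint : ∀ x ∈ Set.Ioi (0 : ℝ), (b + c) * x / ((x ^ 2 + b ^ 2) * (x ^ 2 + c ^ 2)) =
      (b + c) / 2 * ((2 * x ^ ((2 : ℝ) - 1)) •
        (1 / (x ^ (2 : ℝ) + b ^ 2) * (1 / (x ^ (2 : ℝ) + c ^ 2)))) := by
    intro x _
    norm_num
    field_simp
  rw [setIntegral_congr_fun measurableSet_Ioi hpoint, integral_const_mul, hsubst,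
    integral_Ioi_one_div_add_mul_one_div_add (by positivity) (by positivity),
    integral_Ioi_one_div_add_mul_one_div_add hb hc]
  obtain rfl | hbc := eq_or_ne b c
  · simp only [if_true]
    field_simp
    ring
  · have h1 : b - c ≠ 0 := sub_ne_zero.2 hbc
    have h2 : b ^ 2 - c ^ 2 ≠ 0 := by
      rw [sq_sub_sq]
      exact mul_ne_zero (by positivity) h1
    rw [if_neg (sub_ne_zero.1 h2), if_neg hbc, Real.log_pow, Real.log_pow]
    push_cast
    field_simp
    ring

lemma measurable_carlemanSymbol : Measurable carlemanSymbol := by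
  have hsign : Measurable Real.sign :=
    Measurable.ite measurableSet_Iio measurable_const
      (Measurable.ite measurableSet_Ioi measurable_const measurable_const)
  exact (measurable_ofReal.comp hsign).const_mul _

lemma norm_carlemanSymbol_le (x : ℝ) : ‖carlemanSymbol x‖ ≤ Real.pi := by
  have h : |Real.sign x| ≤ 1 := by
    rcases Real.sign_apply_eq x with h | h | h <;> simp [h]
  rw [carlemanSymbol, norm_mul, norm_mul, norm_I, mul_one, norm_real, norm_real,
    Real.norm_of_nonneg Real.pi_pos.le, Real.norm_eq_abs]
  exact mul_le_of_le_one_right Real.pi_pos.le h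

lemma integrable_carlemanSymbol_mul {g : ℝ → ℂ} (hg : Integrable g) :
    Integrable fun x => carlemanSymbol x * g x :=
  hg.bdd_mul measurable_carlemanSymbol.aestronglyMeasurable
    (Eventually.of_forall norm_carlemanSymbol_le)

lemma integral_carlemanSymbol_mul_eq_integral_Ioi {g : ℝ → ℂ} (hg : Integrable g) :
    ∫ x, carlemanSymbol x * g x = ∫ x in Set.Ioi (0 : ℝ), Real.pi * I * (g x - g (-x)) := by
  have hint := integrable_carlemanSymbol_mul hg
  rw [← intervalIntegral.integral_Iic_add_Ioi (b := 0) hint.integrableOn hint.integrableOn,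
    ← neg_zero, ← integral_comp_neg_Ioi, neg_zero,
    ← integral_add hint.comp_neg.integrableOn hint.integrableOn]
  refine setIntegral_congr_fun measurableSet_Ioi fun x (hx : 0 < x) => ?_
  simp only [carlemanSymbol, Real.sign_of_pos hx, Real.sign_of_neg (neg_neg_of_pos hx)]
  push_cast
  ring

lemma integral_carlemanSymbol_mul_neg {b c : ℝ} (hb : 0 < b) (hc : 0 < c) :
    ∫ x, carlemanSymbol x * (cauchyKernel b 0 (-x) * cauchyKernel c 0 (-x)) =
      2 * Real.pi * ∫ s in Set.Ioi (0 : ℝ), 1 / ((s : ℂ) + b) * (1 / ((s : ℂ) + c)) := by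
  have hb' : 0 < (b : ℂ).re := by simpa
  have hc' : 0 < (c : ℂ).re := by simpa
  have hodd : ∀ x : ℝ, Real.pi * I * (cauchyKernel b 0 (-x) * cauchyKernel c 0 (-x) -
      cauchyKernel b 0 (- -x) * cauchyKernel c 0 (- -x)) =
      2 * Real.pi * (((b + c) * x / ((x ^ 2 + b ^ 2) * (x ^ 2 + c ^ 2)) : ℝ) : ℂ) := by
    intro x
    have h1 := add_I_mul_ne_zero hb' x
    have h2 := add_I_mul_ne_zero hc' x
    have h3 := sub_I_mul_ne_zero hb' x
    have h4 := sub_I_mul_ne_zero hc' x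
    have hfactor : ∀ a : ℂ, (x : ℂ) ^ 2 + a ^ 2 = (a + I * x) * (a - I * x) := fun a => by
      linear_combination (x : ℂ) ^ 2 * I_sq
    rw [neg_neg, cauchyKernel_neg, cauchyKernel_neg, cauchyKernel, cauchyKernel]
    push_cast
    rw [hfactor, hfactor]
    field_simp
    linear_combination (-2 * x * (b + c)) * I_sq
  rw [integral_carlemanSymbol_mul_eq_integral_Ioi
    (integrable_cauchyKernel_mul_cauchyKernel hb' hc' 0 0).comp_neg]
  simp only [hodd]
  rw [integral_const_mul, integral_complex_ofReal, integral_Ioi_div_sq_add_sq_mul hb hc,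
    ← integral_complex_ofReal]
  push_cast
  rfl

end CarlemanForm

section KernelSpace

lemma inner_linearCombination {V X Y : Type*} [NormedAddCommGroup V] [InnerProductSpace ℂ V]
    (v : X → V) (w : Y → V) (c : X →₀ ℂ) (d : Y →₀ ℂ) :
    inner ℂ (Finsupp.linearCombination ℂ v c) (Finsupp.linearCombination ℂ w d) =
      ∑ i ∈ c.support, ∑ j ∈ d.support, conj (c i) * d j * inner ℂ (v i) (w j) := by
  simp only [Finsupp.linearCombination_apply, Finsupp.sum, sum_inner]
  refine Finset.sum_congr rfl fun i _ => ?_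
  simp only [inner_sum, inner_smul_left, inner_smul_right]
  exact Finset.sum_congr rfl fun j _ => by ring

lemma inner_self_eq_ofReal_norm_sq {V : Type*} [SeminormedAddCommGroup V] [InnerProductSpace ℂ V]
    (v : V) : inner ℂ v v = ((‖v‖ ^ 2 : ℝ) : ℂ) := by
  rw [inner_self_eq_norm_sq_to_K]
  norm_cast

lemma inner_eq_integral_conj_mul {X : Type*} [MeasurableSpace X] {μ : Measure X}
    (f g : Lp ℂ 2 μ) : inner ℂ f g = ∫ x, conj (f x) * g x ∂μ := by
  rw [L2.inner_def]
  exact integral_congr_ae (Eventually.of_forall fun x => by simp [mul_comm])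

lemma coeFn_linearCombination_toLp {X Y : Type*} [MeasurableSpace X] {μ : Measure X} {p : ℝ≥0∞}
    {φ : Y → X → ℂ} (hφ : ∀ b, MemLp (φ b) p μ) (c : Y →₀ ℂ) :
    ⇑(Finsupp.linearCombination ℂ (fun b => (hφ b).toLp (φ b)) c) =ᵐ[μ]
      fun x => Finsupp.linearCombination ℂ (fun b => φ b x) c := by
  induction c using Finsupp.induction_linear with
  | zero =>
    rw [map_zero]
    exact (Lp.coeFn_zero ℂ p μ).trans (Eventually.of_forall fun x => by simp)
  | add c d hc hd =>
    rw [map_add]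
    filter_upwards [Lp.coeFn_add (Finsupp.linearCombination ℂ (fun b => (hφ b).toLp (φ b)) c)
      (Finsupp.linearCombination ℂ (fun b => (hφ b).toLp (φ b)) d), hc, hd] with x h1 h2 h3
    rw [h1, Pi.add_apply, h2, h3, map_add]
  | single b z =>
    simp only [Finsupp.linearCombination_single]
    filter_upwards [Lp.coeFn_smul z ((hφ b).toLp (φ b)), (hφ b).coeFn_toLp] with x h1 h2
    rw [h1, Pi.smul_apply, h2]

/-- The Cauchy kernel `(a - i x)^{-k-1}` as an element of `L²(ℝ)`. -/
def kernelLp (a : ℂ) (ha : 0 < a.re) (k : ℕ) : L2R := (memLp_cauchyKernel ha k).toLp _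

lemma coeFn_kernelLp {a : ℂ} (ha : 0 < a.re) (k : ℕ) :
    ⇑(kernelLp a ha k) =ᵐ[volume] cauchyKernel a k := (memLp_cauchyKernel ha k).coeFn_toLp

lemma conj_re_pos {a : ℂ} (ha : 0 < a.re) : 0 < (conj a).re := by simpa

lemma inner_kernelLp {a b : ℂ} (ha : 0 < a.re) (hb : 0 < b.re) (k : ℕ) :
    inner ℂ (kernelLp a ha k) (kernelLp b hb 0) = 2 * Real.pi / (conj a + b) ^ (k + 1) := by
  rw [inner_eq_integral_conj_mul, ← integral_cauchyKernel_neg_mul_cauchyKernel (conj_re_pos ha) hb]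
  refine integral_congr_ae ?_
  filter_upwards [coeFn_kernelLp ha k, coeFn_kernelLp hb 0] with x h1 h2
  rw [h1, h2, conj_cauchyKernel]

lemma norm_kernelLp_sq {a : ℂ} (ha : 0 < a.re) : ‖kernelLp a ha 0‖ ^ 2 = Real.pi / a.re := by
  have h := inner_kernelLp ha ha 0
  rw [inner_self_eq_ofReal_norm_sq, add_comm, Complex.add_conj, zero_add, pow_one,
    ← ofReal_ofNat, ← ofReal_mul, ← ofReal_div, ofReal_inj] at h
  rw [h, mul_div_mul_left _ _ two_ne_zero]

/-- The positive reals, which index the kernels `(b - i x)^{-1}` with a real parameter. -/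
abbrev PosReal : Type := {b : ℝ // 0 < b}

lemma PosReal.re_pos (b : PosReal) : 0 < ((b : ℝ) : ℂ).re := by simpa using b.2

/-- The linear combination `∑ c_b (b - i x)^{-1}` as an element of `L²(ℝ)`. -/
def kernelComb : (PosReal →₀ ℂ) →ₗ[ℂ] L2R :=
  Finsupp.linearCombination ℂ fun b : PosReal => kernelLp ((b : ℝ) : ℂ) b.re_pos 0

/-- The value `∑ c_b (a + b)^{-k-1}`, which is `(-1)^k / k!` times the `k`-th derivative at `a` of
`s ↦ ∑ c_b (s + b)^{-1}`. The function `kernelComb c` is the restriction of the latter to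
`s = -i x`, and its holomorphic extension to the upper half-plane is `z ↦ jet (-i z) 0 c`. -/
def jet (a : ℂ) (k : ℕ) : (PosReal →₀ ℂ) →ₗ[ℂ] ℂ :=
  Finsupp.linearCombination ℂ fun b : PosReal => 1 / (a + ((b : ℝ) : ℂ)) ^ (k + 1)

lemma inner_kernelLp_kernelComb {a : ℂ} (ha : 0 < a.re) (k : ℕ) (c : PosReal →₀ ℂ) :
    inner ℂ (kernelLp (conj a) (conj_re_pos ha) k) (kernelComb c) = 2 * Real.pi * jet a k c := by
  rw [kernelComb, jet, Finsupp.linearCombination_apply, Finsupp.linearCombination_apply,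
    Finsupp.sum, Finsupp.sum, inner_sum, Finset.mul_sum]
  refine Finset.sum_congr rfl fun b _ => ?_
  rw [inner_smul_right, inner_kernelLp, conj_conj, smul_eq_mul]
  ring

lemma coeFn_kernelComb (c : PosReal →₀ ℂ) :
    ⇑(kernelComb c) =ᵐ[volume] fun x : ℝ => jet (-I * x) 0 c := by
  refine (coeFn_linearCombination_toLp (fun b : PosReal => memLp_cauchyKernel b.re_pos 0) c).trans
    (Eventually.of_forall fun x => ?_)
  have hline : ∀ b : ℂ, b - I * x = -I * x + b := fun b => by ring
  simp only [jet, cauchyKernel, hline]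

/-- Translation by `y` of the parameters of a combination of kernels, that is, passage from the
boundary values to the values on the line `Im z = y`. -/
def shiftComb (y : ℝ≥0) : (PosReal →₀ ℂ) → (PosReal →₀ ℂ) :=
  Finsupp.mapDomain fun b : PosReal => ⟨b + y, add_pos_of_pos_of_nonneg b.2 y.2⟩

lemma linearCombination_shiftComb {V : Type*} [AddCommGroup V] [Module ℂ V] (v : PosReal → V)
    (y : ℝ≥0) (c : PosReal →₀ ℂ) :
    Finsupp.linearCombination ℂ v (shiftComb y c) = Finsupp.linearCombination ℂ
      (fun b : PosReal => v ⟨b + y, add_pos_of_pos_of_nonneg b.2 y.2⟩) c :=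
  Finsupp.linearCombination_mapDomain _ _ _

lemma coeFn_kernelComb_shiftComb (y : ℝ≥0) (c : PosReal →₀ ℂ) :
    ⇑(kernelComb (shiftComb y c)) =ᵐ[volume]
      fun x : ℝ => jet (-I * ((x : ℂ) + ((y : ℝ) : ℂ) * I)) 0 c := by
  refine (coeFn_kernelComb _).trans (Eventually.of_forall fun x => ?_)
  have hpoint : -I * ((x : ℂ) + ((y : ℝ) : ℂ) * I) = -I * x + ((y : ℝ) : ℂ) := by
    linear_combination (-(y : ℝ) : ℂ) * I_mul_I
  simp only [jet, linearCombination_shiftComb, hpoint, ofReal_add, add_assoc,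
    add_comm ((y : ℝ) : ℂ)]

lemma memLp_exp_neg_mul {b : ℝ} (hb : 0 < b) :
    MemLp (fun t : ℝ => ((Real.exp (-b * t) : ℝ) : ℂ)) 2 (volume.restrict (Set.Ioi (0 : ℝ))) := by
  rw [memLp_two_iff_integrable_sq_norm (by fun_prop)]
  refine (exp_neg_integrableOn_Ioi 0 (b := 2 * b) (by positivity)).congr
    (Eventually.of_forall fun t => ?_)
  simp only [norm_real, Real.norm_of_nonneg (Real.exp_pos _).le, ← Real.exp_nat_mul]
  congr 1
  push_cast
  ring

lemma inner_toLp_exp_neg_mul (b c : PosReal) :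
    inner ℂ ((memLp_exp_neg_mul b.2).toLp _) ((memLp_exp_neg_mul c.2).toLp _) =
      1 / (((b : ℝ) : ℂ) + ((c : ℝ) : ℂ)) := by
  have hint : ∫ t in Set.Ioi (0 : ℝ), Real.exp (-((b : ℝ) + c) * t) = 1 / ((b : ℝ) + c) := by
    rw [integral_exp_mul_Ioi (by linarith [b.2, c.2]) 0]
    simp only [mul_zero, Real.exp_zero, neg_div_neg_eq]
  rw [inner_eq_integral_conj_mul, ← ofReal_add, ← ofReal_one, ← ofReal_div, ← hint,
    ← integral_complex_ofReal]
  refine integral_congr_ae ?_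
  filter_upwards [(memLp_exp_neg_mul b.2).coeFn_toLp, (memLp_exp_neg_mul c.2).coeFn_toLp]
    with t hb hc
  rw [hb, hc, conj_ofReal, ← ofReal_mul, ← Real.exp_add]
  ring_nf

/-- The combination `∑ c_b exp(-b t)` of exponentials on the half-line, whose Laplace transform is
`∑ c_b (s + b)^{-1}`. -/
def laplaceComb : (PosReal →₀ ℂ) →ₗ[ℂ] Lp ℂ 2 (volume.restrict (Set.Ioi (0 : ℝ))) :=
  Finsupp.linearCombination ℂ fun b : PosReal => (memLp_exp_neg_mul b.2).toLp _

lemma norm_kernelComb_sq (c : PosReal →₀ ℂ) :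
    ‖kernelComb c‖ ^ 2 = 2 * Real.pi * ‖laplaceComb c‖ ^ 2 := by
  have h : inner ℂ (kernelComb c) (kernelComb c) =
      2 * Real.pi * inner ℂ (laplaceComb c) (laplaceComb c) := by
    simp only [kernelComb, laplaceComb, inner_linearCombination, Finset.mul_sum, inner_kernelLp,
      inner_toLp_exp_neg_mul, conj_ofReal]
    exact Finset.sum_congr rfl fun i _ => Finset.sum_congr rfl fun j _ => by ring
  rw [inner_self_eq_ofReal_norm_sq, inner_self_eq_ofReal_norm_sq] at h
  exact_mod_cast h

/-- On the Laplace side the shift by `y` is multiplication by `exp(-y t) ≤ 1`. -/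
lemma norm_laplaceComb_shiftComb_le (y : ℝ≥0) (c : PosReal →₀ ℂ) :
    ‖laplaceComb (shiftComb y c)‖ ≤ ‖laplaceComb c‖ := by
  have hcoe := coeFn_linearCombination_toLp (fun b : PosReal => memLp_exp_neg_mul b.2)
  refine Lp.norm_le_norm_of_ae_le ?_
  filter_upwards [hcoe c, hcoe (shiftComb y c), ae_restrict_mem measurableSet_Ioi]
    with t h1 h2 (ht : 0 < t)
  have hmul : Finsupp.linearCombination ℂ (fun b : PosReal =>
      ((Real.exp (-((b : ℝ) + y) * t) : ℝ) : ℂ)) c = ((Real.exp (-y * t) : ℝ) : ℂ) *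
        Finsupp.linearCombination ℂ (fun b : PosReal => ((Real.exp (-b * t) : ℝ) : ℂ)) c := by
    simp only [Finsupp.linearCombination_apply, Finsupp.sum, Finset.mul_sum, smul_eq_mul, neg_add,
      add_mul, Real.exp_add, ofReal_mul]
    exact Finset.sum_congr rfl fun b _ => by ring
  rw [laplaceComb, h1, h2, linearCombination_shiftComb, hmul, norm_mul, norm_real,
    Real.norm_of_nonneg (Real.exp_pos _).le]
  refine mul_le_of_le_one_left (norm_nonneg _) (Real.exp_le_one_iff.2 ?_)
  rw [neg_mul]
  exact neg_nonpos.2 (by positivity)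

lemma norm_kernelComb_shiftComb_le (y : ℝ≥0) (c : PosReal →₀ ℂ) :
    ‖kernelComb (shiftComb y c)‖ ≤ ‖kernelComb c‖ := by
  rw [← sq_le_sq₀ (norm_nonneg _) (norm_nonneg _), norm_kernelComb_sq, norm_kernelComb_sq]
  have := norm_laplaceComb_shiftComb_le y c
  have := Real.pi_pos
  gcongr

end KernelSpace

section HardyClosure

lemma line_im_pos {y : ℝ} (hy : 0 < y) (x : ℝ) : 0 < ((x : ℂ) + (y : ℂ) * I).im := by simpa

lemma re_neg_I_mul (z : ℂ) : (-I * z).re = z.im := by simp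

lemma continuous_line_of_differentiableOn {F : ℂ → ℂ}
    (hF : DifferentiableOn ℂ F {z : ℂ | 0 < z.im}) {y : ℝ} (hy : 0 < y) :
    Continuous fun x : ℝ => F ((x : ℂ) + (y : ℂ) * I) :=
  hF.continuousOn.comp_continuous (by fun_prop) (line_im_pos hy)

lemma IsHardyExtension.of_tendsto {F : ℕ → ℂ → ℂ} {f : ℕ → ℝ → ℂ} {G : ℂ → ℂ} {g : ℝ → ℂ}
    {u : ℕ → ℝ≥0∞} (hF : ∀ n, IsHardyExtension (F n) (f n))
    (hf : ∀ n, AEStronglyMeasurable (f n) volume) (hg : AEStronglyMeasurable g volume)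
    (hG : DifferentiableOn ℂ G {z : ℂ | 0 < z.im}) (hu : Tendsto u atTop (𝓝 0))
    (hline : ∀ n (y : ℝ), 0 < y →
      eLpNorm (fun x : ℝ => G ((x : ℂ) + (y : ℂ) * I) - F n ((x : ℂ) + (y : ℂ) * I)) 2 volume ≤ u n)
    (hboundary : ∀ n, eLpNorm (fun x => f n x - g x) 2 volume ≤ u n) :
    IsHardyExtension G g := by
  have hGm : ∀ {y : ℝ}, 0 < y → AEStronglyMeasurable (fun x : ℝ => G ((x : ℂ) + (y : ℂ) * I))
      volume := fun hy => (continuous_line_of_differentiableOn hG hy).aestronglyMeasurable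
  have hFm : ∀ n {y : ℝ}, 0 < y → AEStronglyMeasurable
      (fun x : ℝ => F n ((x : ℂ) + (y : ℂ) * I)) volume :=
    fun n _ hy => ((hF n).continuous_line hy).aestronglyMeasurable
  refine ⟨hG, ?_, ?_⟩
  · obtain ⟨n, hn⟩ := (hu.eventually_lt_const ENNReal.zero_lt_top).exists
    obtain ⟨C, hC⟩ := (hF n).bounded
    refine ⟨(u n).toNNReal + C, fun y hy => ?_⟩
    rw [ENNReal.coe_add, ENNReal.coe_toNNReal hn.ne]
    calc eLpNorm (fun x : ℝ => G ((x : ℂ) + (y : ℂ) * I)) 2 volume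
        = eLpNorm ((fun x : ℝ => G ((x : ℂ) + (y : ℂ) * I) - F n ((x : ℂ) + (y : ℂ) * I)) +
            fun x : ℝ => F n ((x : ℂ) + (y : ℂ) * I)) 2 volume := by
          congr 1
          ext x
          simp
      _ ≤ _ := eLpNorm_add_le ((hGm hy).sub (hFm n hy)) (hFm n hy) (by norm_num)
      _ ≤ u n + C := add_le_add (hline n y hy) (hC y hy)
  · rw [ENNReal.tendsto_nhds_zero]
    intro ε hε
    have hε3 : 0 < ε / 3 := ENNReal.div_pos hε.ne' (by norm_num)
    obtain ⟨n, hn⟩ := (hu.eventually_le_const hε3).exists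
    filter_upwards [self_mem_nhdsWithin,
      ENNReal.tendsto_nhds_zero.1 (hF n).boundary (ε / 3) hε3] with y (hy : 0 < y) hny
    calc eLpNorm (fun x : ℝ => G ((x : ℂ) + (y : ℂ) * I) - g x) 2 volume
        = eLpNorm ((fun x : ℝ => G ((x : ℂ) + (y : ℂ) * I) - F n ((x : ℂ) + (y : ℂ) * I)) +
            ((fun x : ℝ => F n ((x : ℂ) + (y : ℂ) * I) - f n x) + fun x => f n x - g x))
            2 volume := by
          congr 1
          ext x
          simp
      _ ≤ _ := (eLpNorm_add_le ((hGm hy).sub (hFm n hy))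
          (((hFm n hy).sub (hf n)).add ((hf n).sub hg)) (by norm_num)).trans
            (add_le_add le_rfl (eLpNorm_add_le ((hFm n hy).sub (hf n)) ((hf n).sub hg)
              (by norm_num)))
      _ ≤ ε / 3 + (ε / 3 + ε / 3) :=
          add_le_add ((hline n y hy).trans hn) (add_le_add hny ((hboundary n).trans hn))
      _ = ε := by rw [← add_assoc, ENNReal.add_thirds]

lemma differentiableOn_jet (c : PosReal →₀ ℂ) :
    DifferentiableOn ℂ (fun z => jet (-I * z) 0 c) {z : ℂ | 0 < z.im} := by
  simp only [jet, Finsupp.linearCombination_apply, Finsupp.sum]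
  refine DifferentiableOn.fun_sum fun b _ => ?_
  have hden : DifferentiableOn ℂ (fun z : ℂ => (-I * z + ((b : ℝ) : ℂ)) ^ (0 + 1))
      {z : ℂ | 0 < z.im} := by fun_prop
  refine ((differentiableOn_const (1 : ℂ)).fun_div hden fun z hz => ?_).const_smul (c b)
  exact pow_ne_zero _ (add_ne_zero_of_re_pos (by rwa [re_neg_I_mul]) b.re_pos)

lemma eLpNorm_jet_line_le {y : ℝ} (hy : 0 ≤ y) (c : PosReal →₀ ℂ) :
    eLpNorm (fun x : ℝ => jet (-I * ((x : ℂ) + (y : ℂ) * I)) 0 c) 2 volume ≤ ‖kernelComb c‖ₑ := by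
  lift y to ℝ≥0 using hy
  rw [← eLpNorm_congr_ae (coeFn_kernelComb_shiftComb y c), ← Lp.enorm_def, enorm_le_iff_norm_le]
  exact norm_kernelComb_shiftComb_le y c

lemma eLpNorm_cauchyKernel_add_sub_le (b : PosReal) {y : ℝ} (hy : 0 ≤ y) :
    eLpNorm (fun x => cauchyKernel ((b : ℝ) + y) 0 x - cauchyKernel (b : ℝ) 0 x) 2 volume ≤
      ENNReal.ofReal (y * (1 / b)) * eLpNorm (cauchyKernel (b : ℝ) 0) 2 volume := by
  have hby : 0 < (((b : ℝ) : ℂ) + y).re := by simpa using add_pos_of_pos_of_nonneg b.2 hy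
  have hresolvent : ∀ x : ℝ, cauchyKernel ((b : ℝ) + y) 0 x - cauchyKernel (b : ℝ) 0 x =
      -y * cauchyKernel ((b : ℝ) + y) 0 x * cauchyKernel (b : ℝ) 0 x := by
    intro x
    have h1 := sub_I_mul_ne_zero b.re_pos x
    have h2 := sub_I_mul_ne_zero hby x
    simp only [cauchyKernel, zero_add, pow_one]
    field_simp
    ring
  refine eLpNorm_le_mul_eLpNorm_of_ae_le_mul (Eventually.of_forall fun x => ?_) 2
  rw [hresolvent, norm_mul, norm_mul, norm_neg, norm_real, Real.norm_of_nonneg hy]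
  gcongr
  refine (norm_cauchyKernel_le hby 0 x).trans ?_
  rw [zero_add, pow_one, add_re, ofReal_re, ofReal_re]
  exact one_div_le_one_div_of_le b.2 (le_add_of_nonneg_right hy)

lemma isHardyExtension_cauchyKernel (b : PosReal) :
    IsHardyExtension (fun z => 1 / (-I * z + (b : ℝ))) (cauchyKernel (b : ℝ) 0) := by
  have hjet : (fun z => jet (-I * z) 0 (Finsupp.single b 1)) =
      fun z : ℂ => 1 / (-I * z + (b : ℝ)) := by
    ext z
    simp [jet]
  have hline : ∀ x y : ℝ, 1 / (-I * ((x : ℂ) + (y : ℂ) * I) + (b : ℝ)) =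
      cauchyKernel ((b : ℝ) + y) 0 x := by
    intro x y
    rw [cauchyKernel, zero_add, pow_one]
    congr 1
    linear_combination (-y : ℂ) * I_mul_I
  refine ⟨hjet ▸ differentiableOn_jet _, ⟨‖kernelComb (Finsupp.single b 1)‖₊, fun y hy => ?_⟩, ?_⟩
  · have h := eLpNorm_jet_line_le hy.le (Finsupp.single b 1)
    rwa [funext fun x : ℝ => congrFun hjet ((x : ℂ) + (y : ℂ) * I)] at h
  · have hlim : Tendsto (fun y : ℝ => ENNReal.ofReal (y * (1 / b)) *
        eLpNorm (cauchyKernel (b : ℝ) 0) 2 volume) (𝓝[>] 0) (𝓝 0) := by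
      have h0 : Tendsto (fun y : ℝ => ENNReal.ofReal (y * (1 / b))) (𝓝 0) (𝓝 0) :=
        (ENNReal.continuous_ofReal.comp (by fun_prop)).tendsto' _ _ (by simp)
      simpa using ENNReal.Tendsto.mul_const (h0.mono_left nhdsWithin_le_nhds)
        (Or.inr (memLp_cauchyKernel b.re_pos 0).eLpNorm_ne_top)
    refine tendsto_of_tendsto_of_tendsto_of_le_of_le' tendsto_const_nhds hlim
      (Eventually.of_forall fun _ => zero_le) ?_
    filter_upwards [self_mem_nhdsWithin] with y (hy : 0 < y)
    simpa only [hline] using eLpNorm_cauchyKernel_add_sub_le b hy.le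

lemma isHardyExtension_jet (c : PosReal →₀ ℂ) :
    IsHardyExtension (fun z => jet (-I * z) 0 c) (kernelComb c) := by
  induction c using Finsupp.induction_linear with
  | zero =>
    simp only [map_zero]
    exact isHardyExtension_zero.congr (Lp.coeFn_zero ℂ 2 volume).symm
  | add c d hc hd =>
    simp only [map_add]
    exact (hc.add hd (Lp.aestronglyMeasurable _) (Lp.aestronglyMeasurable _)).congr
      (Lp.coeFn_add _ _).symm
  | single b z =>
    simp only [kernelComb, jet, Finsupp.linearCombination_single, smul_eq_mul, zero_add, pow_one]
    refine ((isHardyExtension_cauchyKernel b).const_smul z).congr ?_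
    filter_upwards [Lp.coeFn_smul z (kernelLp ((b : ℝ) : ℂ) b.re_pos 0),
      coeFn_kernelLp b.re_pos 0] with x h1 h2
    rw [h1, Pi.smul_apply, h2, smul_eq_mul]

/-- The value at a point of the upper half-plane of the holomorphic extension of `f`, given by the
reproducing kernel; elsewhere it is the junk value `0`. -/
def hardyEval (f : L2R) (z : ℂ) : ℂ :=
  if hz : 0 < z.im then
    1 / (2 * Real.pi) * inner ℂ (kernelLp (conj (-I * z))
      (conj_re_pos (by rwa [re_neg_I_mul])) 0) f
  else 0

lemma hardyEval_sub (f g : L2R) (z : ℂ) : hardyEval (f - g) z = hardyEval f z - hardyEval g z := by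
  unfold hardyEval
  split_ifs
  · rw [inner_sub_right, mul_sub]
  · rw [sub_zero]

lemma hardyEval_kernelComb (c : PosReal →₀ ℂ) {z : ℂ} (hz : 0 < z.im) :
    hardyEval (kernelComb c) z = jet (-I * z) 0 c := by
  rw [hardyEval, dif_pos hz, inner_kernelLp_kernelComb (by rwa [re_neg_I_mul])]
  have : (Real.pi : ℂ) ≠ 0 := by exact_mod_cast Real.pi_ne_zero
  field_simp

lemma norm_hardyEval_le (f : L2R) {z : ℂ} {r : ℝ} (hr : 0 < r) (hz : r ≤ z.im) :
    ‖hardyEval f z‖ ≤ 1 / (2 * Real.pi) * √(Real.pi / r) * ‖f‖ := by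
  have hz0 : 0 < z.im := hr.trans_le hz
  have hre : 0 < (conj (-I * z)).re := conj_re_pos (by rwa [re_neg_I_mul])
  have hkernel : ‖kernelLp (conj (-I * z)) hre 0‖ ≤ √(Real.pi / r) := by
    refine Real.le_sqrt_of_sq_le ?_
    rw [norm_kernelLp_sq hre, conj_re, re_neg_I_mul]
    gcongr
  rw [hardyEval, dif_pos hz0, norm_mul, mul_assoc, ← ofReal_ofNat, ← ofReal_mul, ← ofReal_one,
    ← ofReal_div, norm_real, Real.norm_of_nonneg (by positivity)]
  gcongr
  exact (norm_inner_le_norm _ _).trans (by gcongr)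

section Limit

variable {c : ℕ → PosReal →₀ ℂ} {f : L2R}

lemma eventually_norm_hardyEval_sub_jet_lt (hf : Tendsto (fun n => kernelComb (c n)) atTop (𝓝 f))
    {r ε : ℝ} (hr : 0 < r) (hε : 0 < ε) :
    ∀ᶠ n in atTop, ∀ z : ℂ, r ≤ z.im → ‖hardyEval f z - jet (-I * z) 0 (c n)‖ < ε := by
  have hnorm : Tendsto (fun n => 1 / (2 * Real.pi) * √(Real.pi / r) * ‖f - kernelComb (c n)‖) atTop
      (𝓝 0) := by
    simpa using ((tendsto_const_nhds (x := f)).sub hf).norm.const_mul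
      (1 / (2 * Real.pi) * √(Real.pi / r))
  filter_upwards [hnorm.eventually_lt_const hε] with n hn z hz
  rw [← hardyEval_kernelComb (c n) (hr.trans_le hz), ← hardyEval_sub]
  exact (norm_hardyEval_le _ hr hz).trans_lt hn

lemma differentiableOn_hardyEval_of_tendsto
    (hf : Tendsto (fun n => kernelComb (c n)) atTop (𝓝 f)) :
    DifferentiableOn ℂ (hardyEval f) {z : ℂ | 0 < z.im} := by
  refine TendstoLocallyUniformlyOn.differentiableOn (φ := atTop)
    (F := fun n z => jet (-I * z) 0 (c n)) ?_
    (Eventually.of_forall fun n => differentiableOn_jet (c n)) (Complex.isOpen_im_gt 0)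
  rw [Metric.tendstoLocallyUniformlyOn_iff]
  intro ε hε z (hz : 0 < z.im)
  refine ⟨{w : ℂ | z.im / 2 < w.im},
    mem_nhdsWithin_of_mem_nhds ((Complex.isOpen_im_gt _).mem_nhds (half_lt_self hz)), ?_⟩
  filter_upwards [eventually_norm_hardyEval_sub_jet_lt hf (half_pos hz) hε] with n hn w hw
  rw [dist_eq_norm]
  exact hn w (le_of_lt hw)

lemma eLpNorm_hardyEval_sub_jet_le (hf : Tendsto (fun n => kernelComb (c n)) atTop (𝓝 f)) (n : ℕ)
    {y : ℝ} (hy : 0 < y) :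
    eLpNorm (fun x : ℝ => hardyEval f ((x : ℂ) + (y : ℂ) * I) -
      jet (-I * ((x : ℂ) + (y : ℂ) * I)) 0 (c n)) 2 volume ≤ ‖f - kernelComb (c n)‖ₑ := by
  have hpoint : ∀ x : ℝ, Tendsto (fun m => jet (-I * ((x : ℂ) + (y : ℂ) * I)) 0 (c m)) atTop
      (𝓝 (hardyEval f ((x : ℂ) + (y : ℂ) * I))) := by
    intro x
    rw [Metric.tendsto_nhds]
    intro ε hε
    filter_upwards [eventually_norm_hardyEval_sub_jet_lt hf hy hε] with m hm
    rw [dist_comm, dist_eq_norm]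
    exact hm _ (by simp)
  have hnorm : Tendsto (fun m => ‖kernelComb (c m - c n)‖ₑ) atTop
      (𝓝 ‖f - kernelComb (c n)‖ₑ) := by
    simp only [map_sub]
    exact (hf.sub_const _).enorm
  refine (Lp.eLpNorm_lim_le_liminf_eLpNorm
    (f := fun m (x : ℝ) => jet (-I * ((x : ℂ) + (y : ℂ) * I)) 0 (c m - c n))
    (fun m => (continuous_line_of_differentiableOn (differentiableOn_jet _)
      hy).aestronglyMeasurable) _
    (Eventually.of_forall fun x => by simpa only [map_sub] using (hpoint x).sub_const _)).trans ?_
  rw [← hnorm.liminf_eq]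
  exact liminf_le_liminf (Eventually.of_forall fun m => eLpNorm_jet_line_le hy.le _)

end Limit

lemma closure_range_kernelComb_le :
    (LinearMap.range kernelComb).topologicalClosure ≤ hardySpace := by
  intro f hf
  obtain ⟨u, hu, hlim⟩ := mem_closure_iff_seq_limit.1
    ((Submodule.mem_toAddSubmonoid _ _).1 hf : f ∈ closure (LinearMap.range kernelComb : Set L2R))
  choose c hc using hu
  obtain rfl : (fun n => kernelComb (c n)) = u := funext hc
  have hnorm : Tendsto (fun n => ‖f - kernelComb (c n)‖ₑ) atTop (𝓝 0) := by
    simpa using ((tendsto_const_nhds (x := f)).sub hlim).enorm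
  refine ⟨hardyEval f, IsHardyExtension.of_tendsto (fun n => isHardyExtension_jet (c n))
    (fun n => Lp.aestronglyMeasurable _) (Lp.aestronglyMeasurable f)
    (differentiableOn_hardyEval_of_tendsto hlim) hnorm
    (fun n y hy => eLpNorm_hardyEval_sub_jet_le hlim n hy) fun n => ?_⟩
  rw [enorm_sub_rev, Lp.enorm_def]
  exact (eLpNorm_congr_ae (Lp.coeFn_sub (kernelComb (c n)) f).symm).le

end HardyClosure

section CauchyFormula

lemma frequently_lt_of_setLIntegral_Ioi_ne_top {U : ℝ → ℝ≥0∞} {a : ℝ}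
    (hU : ∫⁻ x in Set.Ioi a, U x ≠ ⊤) {ε : ℝ≥0∞} (hε : 0 < ε) : ∃ᶠ x in atTop, U x < ε := by
  intro hev
  simp only [not_lt, eventually_atTop] at hev
  obtain ⟨r, hr⟩ := hev
  refine hU (eq_top_iff.2 ?_)
  calc ⊤ = ∫⁻ _ in Set.Ioi (max r a), ε := by
        rw [setLIntegral_const, Real.volume_Ioi, ENNReal.mul_top hε.ne']
    _ ≤ ∫⁻ x in Set.Ioi (max r a), U x :=
        setLIntegral_mono' measurableSet_Ioi fun x hx => hr x ((le_max_left _ _).trans hx.le)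
    _ ≤ ∫⁻ x in Set.Ioi a, U x := lintegral_mono_set (Set.Ioi_subset_Ioi (le_max_right _ _))

section Strip

variable {E : Type*} [NormedAddCommGroup E] {Φ : ℂ → E} {y₁ y₂ : ℝ}

lemma lintegral_sides_ne_top (hΦ : ContinuousOn Φ (im ⁻¹' Set.Icc y₁ y₂)) {a : ℝ} {C : ℝ≥0∞}
    (hC : C ≠ ⊤) (hbd : ∀ y ∈ Set.Ioc y₁ y₂, ∫⁻ x in Set.Ioi a,
      (‖Φ ((x : ℂ) + (y : ℂ) * I)‖ₑ + ‖Φ (((-x : ℝ) : ℂ) + (y : ℂ) * I)‖ₑ) ≤ C) :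
    ∫⁻ x in Set.Ioi a, ∫⁻ y in Set.Ioc y₁ y₂,
      (‖Φ ((x : ℂ) + (y : ℂ) * I)‖ₑ + ‖Φ (((-x : ℝ) : ℂ) + (y : ℂ) * I)‖ₑ) ≠ ⊤ := by
  have hcont : ∀ s : ℝ, ContinuousOn (fun p : ℝ × ℝ => Φ (((s * p.1 : ℝ) : ℂ) + (p.2 : ℂ) * I))
      (Set.Ioi a ×ˢ Set.Ioc y₁ y₂) := fun s =>
    hΦ.comp (by fun_prop) fun p hp => by simpa using Set.Ioc_subset_Icc_self hp.2
  have hmeas : AEMeasurable (Function.uncurry fun x y : ℝ =>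
      ‖Φ ((x : ℂ) + (y : ℂ) * I)‖ₑ + ‖Φ (((-x : ℝ) : ℂ) + (y : ℂ) * I)‖ₑ)
      ((volume.restrict (Set.Ioi a)).prod (volume.restrict (Set.Ioc y₁ y₂))) := by
    rw [Measure.prod_restrict]
    refine (((hcont 1).enorm.add (hcont (-1)).enorm).aemeasurable
      (measurableSet_Ioi.prod measurableSet_Ioc)).congr (Eventually.of_forall fun p => ?_)
    simp [Function.uncurry]
  rw [lintegral_lintegral_swap hmeas]
  refine ne_top_of_le_ne_top ?_ (setLIntegral_mono measurable_const hbd)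
  rw [setLIntegral_const]
  exact ENNReal.mul_ne_top hC (by simp)

variable [NormedSpace ℂ E]

lemma enorm_integral_line_sub_le (hΦ : DifferentiableOn ℂ Φ (im ⁻¹' Set.Icc y₁ y₂))
    (h : y₁ ≤ y₂) (R : ℝ) :
    ‖(∫ x in -R..R, Φ ((x : ℂ) + (y₁ : ℂ) * I)) - ∫ x in -R..R, Φ ((x : ℂ) + (y₂ : ℂ) * I)‖ₑ ≤
      ∫⁻ y in Set.Ioc y₁ y₂,
        (‖Φ ((R : ℂ) + (y : ℂ) * I)‖ₑ + ‖Φ (((-R : ℝ) : ℂ) + (y : ℂ) * I)‖ₑ) := by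
  have hrect := integral_boundary_rect_eq_zero_of_differentiableOn Φ
    (((-R : ℝ) : ℂ) + (y₁ : ℂ) * I) ((R : ℂ) + (y₂ : ℂ) * I)
    (hΦ.mono fun z hz => by simpa [Set.uIcc_of_le h] using hz.2)
  simp only [add_re, ofReal_re, mul_re, I_re, mul_zero, ofReal_im, I_im, mul_one, sub_self,
    add_zero, add_im, mul_im, zero_add] at hrect
  have hside : (∫ x in -R..R, Φ ((x : ℂ) + (y₁ : ℂ) * I)) -
      (∫ x in -R..R, Φ ((x : ℂ) + (y₂ : ℂ) * I)) =
      I • (∫ y in y₁..y₂, Φ (((-R : ℝ) : ℂ) + (y : ℂ) * I)) -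
        I • ∫ y in y₁..y₂, Φ ((R : ℂ) + (y : ℂ) * I) := by
    rw [← sub_eq_zero, ← hrect]
    abel
  have hle : ∀ x : ℝ, ‖I • ∫ y in y₁..y₂, Φ ((x : ℂ) + (y : ℂ) * I)‖ₑ ≤
      ∫⁻ y in Set.Ioc y₁ y₂, ‖Φ ((x : ℂ) + (y : ℂ) * I)‖ₑ := by
    intro x
    rw [enorm_smul, ← ofReal_norm I, norm_I, ENNReal.ofReal_one, one_mul,
      intervalIntegral.integral_of_le h]
    exact enorm_integral_le_lintegral_enorm _
  have hmeas : AEMeasurable (fun y : ℝ => ‖Φ ((R : ℂ) + (y : ℂ) * I)‖ₑ)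
      (volume.restrict (Set.Ioc y₁ y₂)) :=
    ((hΦ.continuousOn.comp (by fun_prop) fun y hy => by
      simpa using Set.Ioc_subset_Icc_self hy).enorm).aemeasurable measurableSet_Ioc
  rw [hside, lintegral_add_left' hmeas, add_comm]
  exact enorm_sub_le.trans (add_le_add (hle (-R)) (hle R))

theorem integral_line_eq (hΦ : DifferentiableOn ℂ Φ (im ⁻¹' Set.Icc y₁ y₂)) (h : y₁ ≤ y₂)
    (hint₁ : Integrable fun x : ℝ => Φ ((x : ℂ) + (y₁ : ℂ) * I))
    (hint₂ : Integrable fun x : ℝ => Φ ((x : ℂ) + (y₂ : ℂ) * I)) {a : ℝ}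
    (hside : ∫⁻ x in Set.Ioi a, ∫⁻ y in Set.Ioc y₁ y₂,
      (‖Φ ((x : ℂ) + (y : ℂ) * I)‖ₑ + ‖Φ (((-x : ℝ) : ℂ) + (y : ℂ) * I)‖ₑ) ≠ ⊤) :
    ∫ x : ℝ, Φ ((x : ℂ) + (y₁ : ℂ) * I) = ∫ x : ℝ, Φ ((x : ℂ) + (y₂ : ℂ) * I) := by
  have hlim := ((intervalIntegral_tendsto_integral hint₁ tendsto_neg_atTop_atBot tendsto_id).sub
    (intervalIntegral_tendsto_integral hint₂ tendsto_neg_atTop_atBot tendsto_id)).enorm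
  rw [← sub_eq_zero, ← enorm_eq_zero]
  by_contra hne
  obtain ⟨ε, hε, hε'⟩ := exists_between (pos_iff_ne_zero.2 hne)
  obtain ⟨R, hR, hR'⟩ := ((frequently_lt_of_setLIntegral_Ioi_ne_top hside hε).and_eventually
    (hlim.eventually_const_lt hε')).exists
  exact lt_irrefl _ ((hR'.trans_le (enorm_integral_line_sub_le hΦ h R)).trans hR)

end Strip

lemma lintegral_enorm_mul_le {X : Type*} [MeasurableSpace X] {μ : Measure X} {f g : X → ℂ}
    (hf : AEStronglyMeasurable f μ) (hg : AEStronglyMeasurable g μ) :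
    ∫⁻ x, ‖f x * g x‖ₑ ∂μ ≤ eLpNorm f 2 μ * eLpNorm g 2 μ := by
  have h := eLpNorm_smul_le_mul_eLpNorm (p := 2) (q := 2) (r := 1) hg hf
  rwa [eLpNorm_one_eq_lintegral_enorm] at h

lemma eLpNorm_cauchyKernel_zero {a : ℂ} (ha : 0 < a.re) :
    eLpNorm (cauchyKernel a 0) 2 volume = ENNReal.ofReal √(Real.pi / a.re) := by
  rw [← norm_kernelLp_sq ha, Real.sqrt_sq (norm_nonneg _), ofReal_norm, Lp.enorm_def,
    eLpNorm_congr_ae (coeFn_kernelLp ha 0)]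

lemma inv_add_mul_I (x s : ℝ) : ((x : ℂ) + (s : ℂ) * I)⁻¹ = -I * cauchyKernel s 0 x := by
  have h : (x : ℂ) + (s : ℂ) * I = I * (s - I * x) := by
    linear_combination (x : ℂ) * I_mul_I
  rw [h, mul_inv, inv_I, cauchyKernel, zero_add, pow_one, one_div]

lemma cauchyKernel_sub_zero (s t x : ℝ) :
    cauchyKernel ((s - t : ℝ) : ℂ) 0 x = -cauchyKernel ((t - s : ℝ) : ℂ) 0 (-x) := by
  rw [cauchyKernel_neg, cauchyKernel, zero_add, pow_one, pow_one, ← div_neg]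
  congr 1
  push_cast
  ring

lemma norm_cauchyKernel_zero_le_two_mul (s : ℝ) {x : ℝ} (hx : 1 ≤ |x|) :
    ‖cauchyKernel s 0 x‖ ≤ 2 * ‖cauchyKernel 1 0 x‖ := by
  have hpos : 0 < |x| := one_pos.trans_le hx
  have hfar : |x| ≤ ‖(s : ℂ) - I * x‖ := by
    simpa using abs_im_le_norm ((s : ℂ) - I * x)
  have hnear : ‖(1 : ℂ) - I * x‖ ≤ 2 * |x| := by
    refine (norm_sub_le _ _).trans ?_
    simp only [norm_one, norm_mul, norm_I, norm_real, Real.norm_eq_abs, one_mul]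
    linarith
  have hne : 0 < ‖(1 : ℂ) - I * x‖ := norm_pos_iff.2 (sub_I_mul_ne_zero (by simp) x)
  simp only [cauchyKernel, zero_add, pow_one, norm_div, norm_one]
  rw [mul_one_div, div_le_div_iff₀ (hpos.trans_le hfar) hne]
  linarith

namespace IsHardyExtension

variable {F : ℂ → ℂ} {f : ℝ → ℂ}

lemma memLp_line (hF : IsHardyExtension F f) {y : ℝ} (hy : 0 < y) :
    MemLp (fun x : ℝ => F ((x : ℂ) + (y : ℂ) * I)) 2 volume := by
  obtain ⟨C, hC⟩ := hF.bounded
  exact ⟨(hF.continuous_line hy).aestronglyMeasurable, (hC y hy).trans_lt ENNReal.coe_lt_top⟩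

lemma exists_lintegral_enorm_cauchyKernel_mul_le (hF : IsHardyExtension F f) :
    ∃ C : ℝ≥0, ∀ a : ℂ, 0 < a.re → ∀ y : ℝ, 0 < y →
      ∫⁻ x : ℝ, ‖cauchyKernel a 0 x * F ((x : ℂ) + (y : ℂ) * I)‖ₑ ≤
        ENNReal.ofReal √(Real.pi / a.re) * C := by
  obtain ⟨C, hC⟩ := hF.bounded
  refine ⟨C, fun a ha y hy => ?_⟩
  refine (lintegral_enorm_mul_le (continuous_cauchyKernel ha 0).aestronglyMeasurable
    (hF.continuous_line hy).aestronglyMeasurable).trans ?_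
  rw [eLpNorm_cauchyKernel_zero ha]
  gcongr
  exact hC y hy

section Dslope

variable {c : ℝ}

lemma differentiableOn_dslope (hF : IsHardyExtension F f) (hc : 0 < c) :
    DifferentiableOn ℂ (dslope F (c * I)) {z : ℂ | 0 < z.im} :=
  (Complex.differentiableOn_dslope ((isOpen_im_gt 0).mem_nhds (by simpa using hc))).2 hF.holomorphic

lemma dslope_line (h0 : F (c * I) = 0) {x y : ℝ} (h : y ≠ c ∨ x ≠ 0) :
    dslope F (c * I) ((x : ℂ) + (y : ℂ) * I) =
      -I * (cauchyKernel ((y - c : ℝ) : ℂ) 0 x * F ((x : ℂ) + (y : ℂ) * I)) := by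
  have hne : (x : ℂ) + (y : ℂ) * I ≠ c * I := by
    rintro heq
    have hre := congrArg re heq
    have him := congrArg im heq
    simp at hre him
    tauto
  rw [dslope_of_ne _ hne, slope_def_module, h0, sub_zero, smul_eq_mul, ← mul_assoc,
    ← inv_add_mul_I]
  push_cast
  ring_nf

lemma enorm_dslope_line_le (h0 : F (c * I) = 0) (y : ℝ) {x : ℝ} (hx : 1 < |x|) :
    ‖dslope F (c * I) ((x : ℂ) + (y : ℂ) * I)‖ₑ ≤
      2 * ‖cauchyKernel 1 0 x * F ((x : ℂ) + (y : ℂ) * I)‖ₑ := by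
  have hI : ‖-I‖ₑ = 1 := by simp [← ofReal_norm]
  have hkernel : ‖cauchyKernel ((y - c : ℝ) : ℂ) 0 x‖ₑ ≤ 2 * ‖cauchyKernel 1 0 x‖ₑ := by
    rw [← ofReal_norm, ← ofReal_norm, ← ENNReal.ofReal_ofNat, ← ENNReal.ofReal_mul two_pos.le]
    exact ENNReal.ofReal_le_ofReal (norm_cauchyKernel_zero_le_two_mul _ hx.le)
  rw [dslope_line h0 (Or.inr (abs_pos.1 (one_pos.trans hx))), enorm_mul, hI, one_mul, enorm_mul,
    enorm_mul, ← mul_assoc]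
  gcongr

lemma lintegral_dslope_sides_ne_top (hF : IsHardyExtension F f) (hc : 0 < c) (h0 : F (c * I) = 0)
    {y₁ y₂ : ℝ} (hy₁ : 0 < y₁) :
    ∫⁻ x in Set.Ioi (1 : ℝ), ∫⁻ y in Set.Ioc y₁ y₂,
      (‖dslope F (c * I) ((x : ℂ) + (y : ℂ) * I)‖ₑ +
        ‖dslope F (c * I) (((-x : ℝ) : ℂ) + (y : ℂ) * I)‖ₑ) ≠ ⊤ := by
  obtain ⟨C, hC⟩ := hF.exists_lintegral_enorm_cauchyKernel_mul_le
  set D : ℝ≥0∞ := ENNReal.ofReal √(Real.pi / (1 : ℂ).re) * C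
  have hD : D ≠ ⊤ := ENNReal.mul_ne_top ENNReal.ofReal_ne_top ENNReal.coe_ne_top
  refine lintegral_sides_ne_top
    ((hF.differentiableOn_dslope hc).continuousOn.mono fun z hz => hy₁.trans_le hz.1)
    (C := 2 * D + 2 * D) (by finiteness) fun y hy => ?_
  have hy0 : 0 < y := hy₁.trans hy.1
  set g : ℝ → ℝ≥0∞ := fun x => 2 * ‖cauchyKernel 1 0 x * F ((x : ℂ) + (y : ℂ) * I)‖ₑ
  have hgm : Measurable g := (((continuous_cauchyKernel (by simp) 0).mul
    (hF.continuous_line hy0)).enorm.measurable).const_mul 2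
  have hgD : ∫⁻ x, g x ≤ 2 * D := by
    rw [lintegral_const_mul' _ _ (by simp)]
    gcongr
    exact hC 1 (by simp) y hy0
  calc _ ≤ ∫⁻ x in Set.Ioi (1 : ℝ), (g x + g (-x)) := by
        refine setLIntegral_mono' measurableSet_Ioi fun x hx => ?_
        have hx : 1 < |x| := lt_of_lt_of_le hx (le_abs_self x)
        exact add_le_add (enorm_dslope_line_le h0 y hx)
          (enorm_dslope_line_le h0 y (by rwa [abs_neg]))
    _ ≤ ∫⁻ x, (g x + g (-x)) := setLIntegral_le_lintegral _ _
    _ ≤ 2 * D + 2 * D := by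
        rw [lintegral_add_left hgm, lintegral_neg_eq_self g]
        exact add_le_add hgD hgD

lemma integrable_dslope_line (hF : IsHardyExtension F f) (h0 : F (c * I) = 0) {y : ℝ}
    (hy : 0 < y) (hyc : y ≠ c) :
    Integrable fun x : ℝ => dslope F (c * I) ((x : ℂ) + (y : ℂ) * I) := by
  simp only [dslope_line h0 (Or.inl hyc)]
  refine Integrable.const_mul ?_ (-I)
  rcases hyc.lt_or_gt with h | h
  · have hre : 0 < ((c - y : ℝ) : ℂ).re := by simpa using h
    simp only [cauchyKernel_sub_zero y c, neg_mul]
    exact ((memLp_cauchyKernel_neg hre 0).integrable_mul (hF.memLp_line hy)).neg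
  · have hre : 0 < ((y - c : ℝ) : ℂ).re := by simpa using h
    exact (memLp_cauchyKernel hre 0).integrable_mul (hF.memLp_line hy)

lemma integral_dslope_line (hF : IsHardyExtension F f) (h0 : F (c * I) = 0) {y : ℝ} (hy : 0 < y)
    (hyc : y < c) : ∫ x : ℝ, dslope F (c * I) ((x : ℂ) + (y : ℂ) * I) = 0 := by
  obtain ⟨C, hC⟩ := hF.exists_lintegral_enorm_cauchyKernel_mul_le
  have hle : ∀ τ : ℝ, c < τ → ‖∫ x : ℝ, dslope F (c * I) ((x : ℂ) + (y : ℂ) * I)‖ₑ ≤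
      ENNReal.ofReal √(Real.pi / (τ - c)) * C := by
    intro τ hτ
    have hτ0 : 0 < τ := by linarith
    rw [integral_line_eq ((hF.differentiableOn_dslope (hy.trans hyc)).mono fun z hz =>
        hy.trans_le hz.1) (hyc.trans hτ).le (hF.integrable_dslope_line h0 hy hyc.ne)
      (hF.integrable_dslope_line h0 hτ0 hτ.ne')
      (hF.lintegral_dslope_sides_ne_top (hy.trans hyc) h0 hy)]
    refine (enorm_integral_le_lintegral_enorm _).trans ?_
    simp only [dslope_line h0 (Or.inl hτ.ne'), enorm_mul (-I), ← ofReal_norm (-I), norm_neg, norm_I,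
      ENNReal.ofReal_one, one_mul]
    simpa only [ofReal_re] using hC ((τ - c : ℝ) : ℂ) (by simpa using hτ) τ hτ0
  have hlim : Tendsto (fun τ : ℝ => ENNReal.ofReal √(Real.pi / (τ - c)) * C) atTop (𝓝 0) := by
    have hsqrt : Tendsto (fun τ : ℝ => √(Real.pi / (τ - c))) atTop (𝓝 √0) :=
      (Real.continuous_sqrt.tendsto 0).comp
        ((tendsto_atTop_add_const_right _ _ tendsto_id).const_div_atTop Real.pi)
    simpa using ENNReal.Tendsto.mul_const (ENNReal.tendsto_ofReal hsqrt)
      (Or.inr (ENNReal.coe_ne_top (r := C)))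
  exact enorm_eq_zero.1 (nonpos_iff_eq_zero.1
    (ge_of_tendsto hlim ((eventually_gt_atTop c).mono hle)))

end Dslope

lemma integral_cauchyKernel_mul_line_of_eq_zero (hF : IsHardyExtension F f) {b y : ℝ} (hb : 0 < b)
    (hy : 0 < y) (h0 : F (((b + y : ℝ) : ℂ) * I) = 0) :
    ∫ x : ℝ, cauchyKernel b 0 (-x) * F ((x : ℂ) + (y : ℂ) * I) = 0 := by
  have hyc : y < b + y := lt_add_of_pos_left y hb
  have hdslope := hF.integral_dslope_line h0 hy hyc
  simpa only [dslope_line h0 (Or.inl hyc.ne), integral_const_mul, cauchyKernel_sub_zero y (b + y),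
    add_sub_cancel_right, neg_mul, mul_neg, integral_neg, neg_neg, mul_eq_zero, I_ne_zero, false_or]
    using hdslope

lemma integral_cauchyKernel_mul_line (hF : IsHardyExtension F f)
    (hf : AEStronglyMeasurable f volume) {b y : ℝ} (hb : 0 < b) (hy : 0 < y) :
    ∫ x : ℝ, cauchyKernel b 0 (-x) * F ((x : ℂ) + (y : ℂ) * I) =
      2 * Real.pi * F (((b + y : ℝ) : ℂ) * I) := by
  have hbre : 0 < ((b : ℝ) : ℂ).re := hb
  have hyre : 0 < ((1 + y : ℝ) : ℂ).re := by simpa using add_pos one_pos hy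
  have hne : (b : ℂ) + ((1 + y : ℝ) : ℂ) ≠ 0 := add_ne_zero_of_re_pos hbre hyre
  have hκ : IsHardyExtension (fun z => 1 / (-I * z + 1)) (cauchyKernel 1 0) := by
    simpa using isHardyExtension_cauchyKernel ⟨1, one_pos⟩
  have hκ_axis : (-I * (((b + y : ℝ) : ℂ) * I) + 1 : ℂ) = b + ((1 + y : ℝ) : ℂ) := by
    push_cast
    linear_combination (-(b : ℂ) - y) * I_mul_I
  have hκ_line : ∀ x : ℝ, 1 / (-I * ((x : ℂ) + (y : ℂ) * I) + 1) =
      cauchyKernel ((1 + y : ℝ) : ℂ) 0 x := by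
    intro x
    rw [cauchyKernel, zero_add, pow_one]
    congr 1
    push_cast
    linear_combination (-y : ℂ) * I_mul_I
  -- Subtract the multiple of the kernel that agrees with `F` at the evaluation point.
  set A : ℂ := F (((b + y : ℝ) : ℂ) * I) * (b + ((1 + y : ℝ) : ℂ)) with hA
  have hzero := (hF.add (hκ.const_smul (-A)) hf
    ((continuous_cauchyKernel (by simp) 0).aestronglyMeasurable.const_mul
      _)).integral_cauchyKernel_mul_line_of_eq_zero hb hy (by
        rw [hκ_axis, hA]
        field_simp
        ring)
  simp only [hκ_line] at hzero
  simp only [mul_add, mul_left_comm _ (-A)] at hzero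
  rw [integral_add (f := fun x => cauchyKernel b 0 (-x) * F ((x : ℂ) + (y : ℂ) * I))
    ((memLp_cauchyKernel_neg hbre 0).integrable_mul (hF.memLp_line hy))
    ((integrable_cauchyKernel_neg_mul_cauchyKernel hbre hyre 0 0).const_mul _), integral_const_mul,
    integral_cauchyKernel_neg_mul_cauchyKernel hbre hyre 0, zero_add, pow_one, hA] at hzero
  rw [eq_neg_of_add_eq_zero_left hzero]
  field_simp

lemma inner_kernelLp {f : L2R} (hF : IsHardyExtension F f) {b : ℝ} (hb : 0 < b) :
    inner ℂ (kernelLp (b : ℂ) hb 0) f = 2 * Real.pi * F ((b : ℂ) * I) := by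
  set u : ℝ → L2R := fun y => if hy : 0 < y then (hF.memLp_line hy).toLp _ else 0 with hu
  have hu_ae : ∀ {y : ℝ}, 0 < y → ⇑(u y) =ᵐ[volume] fun x => F ((x : ℂ) + (y : ℂ) * I) := by
    intro y hy
    simp only [hu, dif_pos hy]
    exact (hF.memLp_line hy).coeFn_toLp
  have hu_tendsto : Tendsto u (𝓝[>] 0) (𝓝 f) := by
    rw [Lp.tendsto_Lp_iff_tendsto_eLpNorm']
    refine hF.boundary.congr' ?_
    filter_upwards [self_mem_nhdsWithin] with y hy
    exact eLpNorm_congr_ae ((hu_ae hy).symm.sub EventuallyEq.rfl)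
  have hF_tendsto : Tendsto (fun y : ℝ => 2 * Real.pi * F (((b + y : ℝ) : ℂ) * I)) (𝓝[>] 0)
      (𝓝 (2 * Real.pi * F ((b : ℂ) * I))) := by
    have hcont : ContinuousAt F ((b : ℂ) * I) := (hF.holomorphic.differentiableAt
      ((isOpen_im_gt 0).mem_nhds (by simpa using hb))).continuousAt
    have haxis : Tendsto (fun y : ℝ => ((b + y : ℝ) : ℂ) * I) (𝓝 0) (𝓝 ((b : ℂ) * I)) :=
      Continuous.tendsto' (by fun_prop) _ _ (by simp)
    exact ((hcont.tendsto.comp haxis).const_mul _).mono_left nhdsWithin_le_nhds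
  refine tendsto_nhds_unique ((tendsto_const_nhds.inner hu_tendsto).congr' ?_) hF_tendsto
  filter_upwards [self_mem_nhdsWithin] with y (hy : 0 < y)
  rw [← hF.integral_cauchyKernel_mul_line (Lp.aestronglyMeasurable f) hb hy,
    inner_eq_integral_conj_mul]
  refine integral_congr_ae ?_
  filter_upwards [hu_ae hy, coeFn_kernelLp (a := b) hb 0] with x hux hkx
  rw [hux, hkx, conj_cauchyKernel, conj_ofReal]

lemma eq_zero_of_imaginary_axis {f : L2R} (hF : IsHardyExtension F f)
    (h : ∀ b : ℝ, 0 < b → F ((b : ℂ) * I) = 0) : f = 0 := by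
  have haxis : Tendsto (fun b : ℝ => (b : ℂ) * I) (𝓝[≠] 1) (𝓝[≠] I) := by
    refine tendsto_nhdsWithin_of_tendsto_nhds_of_eventually_within _
      ((Continuous.tendsto' (by fun_prop) _ _ (by simp)).mono_left nhdsWithin_le_nhds) ?_
    filter_upwards [self_mem_nhdsWithin] with b hb hI
    exact hb (by simpa using congrArg im hI)
  have hpos : ∀ᶠ b : ℝ in 𝓝[≠] 1, 0 < b := nhdsWithin_le_nhds (lt_mem_nhds one_pos)
  have hzero : Set.EqOn F 0 {z : ℂ | 0 < z.im} :=
    (hF.holomorphic.analyticOnNhd (isOpen_im_gt 0)).eqOn_zero_of_preconnected_of_frequently_eq_zero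
      (convex_halfSpace_im_gt 0).isPreconnected (by simp : I ∈ {z : ℂ | 0 < z.im})
      (haxis.frequently (hpos.mono h).frequently)
  have hconst : Tendsto (fun _ : ℝ => eLpNorm f 2 volume) (𝓝[>] 0) (𝓝 0) := by
    refine hF.boundary.congr' ?_
    filter_upwards [self_mem_nhdsWithin] with y hy
    rw [← eLpNorm_neg]
    congr 1
    ext x
    simp [hzero (line_im_pos hy x)]
  have hnorm := tendsto_nhds_unique hconst tendsto_const_nhds
  rwa [← Lp.enorm_def, eq_comm, enorm_eq_zero] at hnorm

end IsHardyExtension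

theorem hardySpace_eq_closure :
    hardySpace = (LinearMap.range kernelComb).topologicalClosure := by
  refine le_antisymm (fun f hf => ?_) closure_range_kernelComb_le
  set D := (LinearMap.range kernelComb).topologicalClosure
  have : CompleteSpace D := (Submodule.isClosed_topologicalClosure _).completeSpace_coe
  have hproj : D.starProjection f ∈ D := D.starProjection_apply_mem f
  obtain ⟨F, hF⟩ : f - D.starProjection f ∈ hardySpace :=
    hardySpace.sub_mem hf (closure_range_kernelComb_le hproj)
  have hzero : f - D.starProjection f = 0 := hF.eq_zero_of_imaginary_axis fun b hb => by
    have hkernel : kernelLp (b : ℂ) hb 0 ∈ D :=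
      Submodule.le_topologicalClosure _ ⟨Finsupp.single ⟨b, hb⟩ 1, by simp [kernelComb]⟩
    have hinner := hF.inner_kernelLp hb
    rw [(Submodule.mem_orthogonal _ _).1 (D.sub_starProjection_mem_orthogonal f) _
      hkernel] at hinner
    simpa [Real.pi_ne_zero] using hinner.symm
  rwa [sub_eq_zero.1 hzero]

instance completeSpace_hardySpace : CompleteSpace hardySpace := by
  have : IsClosed (hardySpace : Set L2R) := by
    rw [hardySpace_eq_closure]
    exact Submodule.isClosed_topologicalClosure _
  exact this.completeSpace_coe

end CauchyFormula

section Jets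

/-- The coefficients of the product of `∑ c_g / (s + g)` with `(p s + q) / (s + b)`, by partial
fractions. This is the product only if `b` is not one of the `g`: otherwise a denominator below is
`0`. -/
def mulComb (p q : ℂ) (b : PosReal) : (PosReal →₀ ℂ) →ₗ[ℂ] (PosReal →₀ ℂ) :=
  Finsupp.linearCombination ℂ fun g : PosReal =>
    Finsupp.single g ((q - p * ((g : ℝ) : ℂ)) / (((b : ℝ) : ℂ) - ((g : ℝ) : ℂ))) +
      Finsupp.single b ((q - p * ((b : ℝ) : ℂ)) / (((g : ℝ) : ℂ) - ((b : ℝ) : ℂ)))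

variable {c d : PosReal →₀ ℂ} {a α p q : ℂ} {b : PosReal}

lemma support_mulComb_subset (p q : ℂ) (b : PosReal) (c : PosReal →₀ ℂ) :
    (mulComb p q b c).support ⊆ insert b c.support := by
  classical
  rw [mulComb, Finsupp.linearCombination_apply, Finsupp.sum]
  refine Finsupp.support_finsetSum.trans (Finset.biUnion_subset.2 fun g hg => ?_)
  refine Finsupp.support_smul.trans (Finsupp.support_add.trans (Finset.union_subset ?_ ?_)) <;>
    refine Finsupp.support_single_subset.trans (Finset.singleton_subset_iff.2 ?_)
  · exact Finset.mem_insert_of_mem hg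
  · exact Finset.mem_insert_self b _

lemma jet_apply (a : ℂ) (k : ℕ) (c : PosReal →₀ ℂ) :
    jet a k c = ∑ g ∈ c.support, c g * (1 / (a + ((g : ℝ) : ℂ)) ^ (k + 1)) := by
  simp only [jet, Finsupp.linearCombination_apply, Finsupp.sum, smul_eq_mul]

lemma jet_mulComb (p q a : ℂ) (b : PosReal) (k : ℕ) (c : PosReal →₀ ℂ) :
    jet a k (mulComb p q b c) = ∑ g ∈ c.support, c g *
      ((q - p * ((g : ℝ) : ℂ)) / (((b : ℝ) : ℂ) - ((g : ℝ) : ℂ)) *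
          (1 / (a + ((g : ℝ) : ℂ)) ^ (k + 1)) +
        (q - p * ((b : ℝ) : ℂ)) / (((g : ℝ) : ℂ) - ((b : ℝ) : ℂ)) *
          (1 / (a + ((b : ℝ) : ℂ)) ^ (k + 1))) := by
  rw [mulComb, Finsupp.linearCombination_apply, Finsupp.sum]
  simp only [map_sum, map_smul, map_add, jet, Finsupp.linearCombination_single, smul_eq_mul]

lemma PosReal.coe_sub_coe_ne_zero {b g : PosReal} (h : b ≠ g) :
    ((b : ℝ) : ℂ) - ((g : ℝ) : ℂ) ≠ 0 :=
  sub_ne_zero.2 fun h' => h (Subtype.ext (ofReal_injective h'))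

lemma jet_zero_mulComb (p q : ℂ) (ha : 0 < a.re) (hb : b ∉ c.support) :
    jet a 0 (mulComb p q b c) = (p * a + q) / (a + ((b : ℝ) : ℂ)) * jet a 0 c := by
  rw [jet_mulComb, jet_apply, Finset.mul_sum]
  refine Finset.sum_congr rfl fun g hg => ?_
  have hab := add_ne_zero_of_re_pos ha b.re_pos
  have hag := add_ne_zero_of_re_pos ha g.re_pos
  have hbg := PosReal.coe_sub_coe_ne_zero (ne_of_mem_of_not_mem hg hb).symm
  rw [← neg_sub ((b : ℝ) : ℂ) ((g : ℝ) : ℂ)]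
  field_simp
  ring

lemma jet_succ_mulComb (p q : ℂ) (ha : 0 < a.re) (hb : b ∉ c.support) (k : ℕ) :
    (a + ((b : ℝ) : ℂ)) * jet a (k + 1) (mulComb p q b c) - jet a k (mulComb p q b c) =
      (p * a + q) * jet a (k + 1) c - p * jet a k c := by
  rw [jet_mulComb, jet_mulComb, jet_apply, jet_apply, Finset.mul_sum, Finset.mul_sum,
    Finset.mul_sum, ← Finset.sum_sub_distrib, ← Finset.sum_sub_distrib]
  refine Finset.sum_congr rfl fun g hg => ?_
  have hab := add_ne_zero_of_re_pos ha b.re_pos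
  have hag := add_ne_zero_of_re_pos ha g.re_pos
  have hbg := PosReal.coe_sub_coe_ne_zero (ne_of_mem_of_not_mem hg hb).symm
  rw [← neg_sub ((b : ℝ) : ℂ) ((g : ℝ) : ℂ)]
  field_simp
  ring

/-- The function `∑ c_b / (s + b)` vanishes at `a` to order `n`. -/
def VanishesTo (c : PosReal →₀ ℂ) (a : ℂ) (n : ℕ) : Prop := ∀ i < n, jet a i c = 0

lemma vanishesTo_zero_order (c : PosReal →₀ ℂ) (a : ℂ) : VanishesTo c a 0 :=
  fun i hi => absurd hi i.not_lt_zero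

lemma VanishesTo.succ {n : ℕ} (h : VanishesTo c a n) (hn : jet a n c = 0) :
    VanishesTo c a (n + 1) := fun i hi =>
  (Nat.lt_succ_iff_lt_or_eq.1 hi).elim (h i) fun hin => hin ▸ hn

lemma VanishesTo.smul {n : ℕ} (h : VanishesTo c a n) (z : ℂ) : VanishesTo (z • c) a n :=
  fun i hi => by rw [map_smul, h i hi, smul_zero]

lemma vanishesTo_mulComb_and_jet_mulComb (ha : 0 < a.re) (hb : b ∉ c.support) {n : ℕ}
    (h : VanishesTo c a n) :
    VanishesTo (mulComb p q b c) a n ∧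
      jet a n (mulComb p q b c) = (p * a + q) / (a + ((b : ℝ) : ℂ)) * jet a n c := by
  induction n with
  | zero => exact ⟨vanishesTo_zero_order _ _, jet_zero_mulComb p q ha hb⟩
  | succ n ih =>
    have hn : jet a n c = 0 := h n n.lt_succ_self
    obtain ⟨hvan, hjet⟩ := ih fun i hi => h i (Nat.lt_succ_of_lt hi)
    rw [hn, mul_zero] at hjet
    refine ⟨hvan.succ hjet, ?_⟩
    have hrec := jet_succ_mulComb p q ha hb n
    rw [hjet, hn] at hrec
    have hab := add_ne_zero_of_re_pos ha b.re_pos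
    field_simp
    linear_combination hrec

lemma VanishesTo.mulComb {n : ℕ} (h : VanishesTo c a n) (ha : 0 < a.re) (hb : b ∉ c.support) :
    VanishesTo (mulComb p q b c) a n :=
  (vanishesTo_mulComb_and_jet_mulComb ha hb h).1

lemma VanishesTo.jet_mulComb {n : ℕ} (h : VanishesTo c a n) (ha : 0 < a.re) (hb : b ∉ c.support) :
    jet a n (_root_.mulComb p q b c) = (p * a + q) / (a + ((b : ℝ) : ℂ)) * jet a n c :=
  (vanishesTo_mulComb_and_jet_mulComb ha hb h).2

lemma VanishesTo.mulComb_root {n : ℕ} (h : VanishesTo c a n) (ha : 0 < a.re)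
    (hb : b ∉ c.support) :
    VanishesTo (_root_.mulComb 1 (-a) b c) a (n + 1) ∧
      jet a (n + 1) (_root_.mulComb 1 (-a) b c) = -1 / (a + ((b : ℝ) : ℂ)) * jet a n c := by
  have hroot : (1 : ℂ) * a + -a = 0 := by ring
  have hjet := h.jet_mulComb (p := 1) (q := -a) ha hb
  rw [hroot, zero_div, zero_mul] at hjet
  refine ⟨(h.mulComb ha hb).succ hjet, ?_⟩
  have hrec := jet_succ_mulComb 1 (-a) ha hb n
  rw [hjet, hroot] at hrec
  have hab := add_ne_zero_of_re_pos ha b.re_pos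
  field_simp
  linear_combination hrec

instance infinite_posReal : Infinite PosReal := (Set.Ioi_infinite (0 : ℝ)).to_subtype

/-- Multiply by `((s - α) / (s + b)) ^ n`. -/
lemma exists_raise_vanishing (c : PosReal →₀ ℂ) (hα : 0 < α.re) (n : ℕ) :
    ∃ c' : PosReal →₀ ℂ, (∀ a : ℂ, 0 < a.re → ∀ k, VanishesTo c a k → VanishesTo c' a k) ∧
      VanishesTo c' α n ∧ (∀ a : ℂ, 0 < a.re → a ≠ α → jet a 0 c ≠ 0 → jet a 0 c' ≠ 0) ∧
      (jet α 0 c ≠ 0 → jet α n c' ≠ 0) := by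
  induction n with
  | zero => exact ⟨c, fun _ _ _ h => h, vanishesTo_zero_order c α, fun _ _ _ h => h, fun h => h⟩
  | succ n ih =>
    obtain ⟨d, hkeep, hvan, hne, hlead⟩ := ih
    obtain ⟨b, hb⟩ := Infinite.exists_notMem_finset d.support
    obtain ⟨hvan', hlead'⟩ := hvan.mulComb_root hα hb
    refine ⟨mulComb 1 (-α) b d, fun a ha k hk => (hkeep a ha k hk).mulComb ha hb, hvan',
      fun a ha haα h => ?_, fun h => ?_⟩
    · rw [jet_zero_mulComb _ _ ha hb, one_mul, ← sub_eq_add_neg]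
      exact mul_ne_zero (div_ne_zero (sub_ne_zero.2 haα) (add_ne_zero_of_re_pos ha b.re_pos))
        (hne a ha haα h)
    · rw [hlead']
      exact mul_ne_zero (div_ne_zero (neg_ne_zero.2 one_ne_zero)
        (add_ne_zero_of_re_pos hα b.re_pos)) (hlead h)

lemma exists_vanishesTo_forall_ne (A : Finset ℂ) (hA : ∀ a ∈ A, 0 < a.re) (n : ℕ)
    (hα : 0 < α.re) :
    ∃ c : PosReal →₀ ℂ, (∀ a ∈ A, a ≠ α → VanishesTo c a n) ∧ jet α 0 c ≠ 0 := by
  classical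
  induction A using Finset.induction_on with
  | empty =>
    refine ⟨Finsupp.single ⟨1, one_pos⟩ 1, by simp, ?_⟩
    rw [jet, Finsupp.linearCombination_single, one_smul]
    exact one_div_ne_zero (pow_ne_zero _ (add_ne_zero_of_re_pos hα (PosReal.re_pos _)))
  | insert a₁ A _ ih =>
    obtain ⟨c, hvan, hne⟩ := ih fun a ha => hA a (Finset.mem_insert_of_mem ha)
    have ha₁ := hA a₁ (Finset.mem_insert_self _ _)
    rcases eq_or_ne a₁ α with rfl | ha₁α
    · refine ⟨c, fun a ha haα => hvan a (Finset.mem_of_mem_insert_of_ne ha haα) haα, hne⟩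
    · obtain ⟨c', hkeep, hvan', hne', -⟩ := exists_raise_vanishing c ha₁ n
      refine ⟨c', fun a ha haα => ?_, hne' α hα ha₁α.symm hne⟩
      rcases Finset.mem_insert.1 ha with rfl | ha
      · exact hvan'
      · exact hkeep a (hA a (Finset.mem_insert_of_mem ha)) n (hvan a ha haα)

lemma exists_leading_jet (A : Finset ℂ) (hA : ∀ a ∈ A, 0 < a.re) (n : ℕ) (hα : 0 < α.re)
    (k : ℕ) :
    ∃ c : PosReal →₀ ℂ, (∀ a ∈ A, a ≠ α → VanishesTo c a n) ∧ VanishesTo c α k ∧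
      jet α k c ≠ 0 := by
  obtain ⟨c, hvan, hne⟩ := exists_vanishesTo_forall_ne A hA n hα
  obtain ⟨c', hkeep, hvan', -, hlead⟩ := exists_raise_vanishing c hα k
  exact ⟨c', fun a ha haα => hkeep a (hA a ha) n (hvan a ha haα), hvan', hlead hne⟩

/-- Passing from the function of `c` to that of `d` lowers no order of vanishing in the right
half-plane and keeps the leading coefficient at `α`, as multiplication by a function that is
holomorphic there and equals `1` at `α` does. -/
structure KeepsLeadingJet (α : ℂ) (c d : PosReal →₀ ℂ) : Prop where
  vanishesTo : ∀ {a : ℂ}, 0 < a.re → ∀ {k : ℕ}, VanishesTo c a k → VanishesTo d a k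
  jet_eq : ∀ {k : ℕ}, VanishesTo c α k → jet α k d = jet α k c

lemma KeepsLeadingJet.refl (α : ℂ) (c : PosReal →₀ ℂ) : KeepsLeadingJet α c c :=
  ⟨fun _ _ h => h, fun _ => rfl⟩

lemma KeepsLeadingJet.trans {e : PosReal →₀ ℂ} (hα : 0 < α.re) (hcd : KeepsLeadingJet α c d)
    (hde : KeepsLeadingJet α d e) : KeepsLeadingJet α c e :=
  ⟨fun ha _ h => hde.vanishesTo ha (hcd.vanishesTo ha h),
    fun h => (hde.jet_eq (hcd.vanishesTo hα h)).trans (hcd.jet_eq h)⟩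

lemma keepsLeadingJet_mulComb_mulComb {p' q' : ℂ} {b' : PosReal} (hα : 0 < α.re)
    (hb : b ∉ c.support) (hb' : b' ∉ (mulComb p q b c).support)
    (hone : (p' * α + q') * (p * α + q) = (α + ((b' : ℝ) : ℂ)) * (α + ((b : ℝ) : ℂ))) :
    KeepsLeadingJet α c (mulComb p' q' b' (mulComb p q b c)) where
  vanishesTo ha _ h := (h.mulComb ha hb).mulComb ha hb'
  jet_eq h := by
    have hab := add_ne_zero_of_re_pos hα b.re_pos
    have hab' := add_ne_zero_of_re_pos hα b'.re_pos
    rw [(h.mulComb hα hb).jet_mulComb hα hb', h.jet_mulComb hα hb, ← mul_assoc, div_mul_div_comm,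
      hone, div_self (mul_ne_zero hab' hab), one_mul]

/-- The majorant on the half-line of a peaking factor for a point of modulus `r`: it is less than
`1` except at `s = r`. -/
def peakBound (r s : ℝ) : ℝ := 5 * r * s / (s ^ 2 + 3 * r * s + r ^ 2)

variable {r s t : ℝ}

lemma peakBound_nonneg (hr : 0 < r) (hs : 0 < s) : 0 ≤ peakBound r s := by
  unfold peakBound
  positivity

lemma peakBound_lt_one (hr : 0 < r) (hs : 0 < s) (hne : s ≠ r) : peakBound r s < 1 := by
  rw [peakBound, div_lt_one (by positivity)]
  nlinarith [sq_pos_of_ne_zero (sub_ne_zero.2 hne)]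

lemma div_mul_div_le_peakBound {w : ℝ} (hr : 0 < r) (hs : 0 < s) (ht : t ∈ Set.Ioo (1 : ℝ) 2)
    (hw : w ≤ r * (2 + (t + 1 / t))) :
    w / (s + r / t) * (s / (s + r * t)) ≤ peakBound r s := by
  have ht0 : 0 < t := one_pos.trans ht.1
  set v : ℝ := t + 1 / t with hv
  have : 0 < v := by positivity
  have hv3 : v ≤ 3 := by
    have : 1 / t ≤ 1 := (div_le_one ht0).2 ht.1.le
    linarith [ht.2]
  have hden : (s + r / t) * (s + r * t) = s ^ 2 + r * v * s + r ^ 2 := by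
    rw [hv]
    field_simp
    ring
  rw [div_mul_div_comm, hden, peakBound, div_le_div_iff₀ (by positivity) (by positivity)]
  calc w * s * (s ^ 2 + 3 * r * s + r ^ 2)
      ≤ r * (2 + v) * s * (s ^ 2 + 3 * r * s + r ^ 2) := by gcongr
    _ ≤ 5 * r * s * (s ^ 2 + r * v * s + r ^ 2) := by
      have hgap : 0 ≤ r * s * ((3 - v) * (s - r) ^ 2) :=
        mul_nonneg (by positivity) (mul_nonneg (sub_nonneg.2 hv3) (sq_nonneg _))
      nlinarith

lemma add_div_mul_add_mul (α : ℂ) (ht : t ≠ 0) :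
    (α + ((‖α‖ / t : ℝ) : ℂ)) * (α + ((‖α‖ * t : ℝ) : ℂ)) =
      ((2 * α.re + ‖α‖ * (t + 1 / t) : ℝ) : ℂ) * α := by
  have hnorm : α * conj α = (‖α‖ : ℂ) ^ 2 := mul_conj' α
  have hre : (2 * α.re : ℂ) = α + conj α := by simp [add_conj]
  have htc : (t : ℂ) ≠ 0 := ofReal_ne_zero.2 ht
  have hcancel : (‖α‖ : ℂ) / t * (‖α‖ * t) = (‖α‖ : ℂ) ^ 2 := by field_simp
  push_cast
  rw [hre]
  linear_combination hcancel - hnorm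

lemma exists_mem_Ioo_forall_ne (S : Finset PosReal) (hr : 0 < r) :
    ∃ t ∈ Set.Ioo (1 : ℝ) 2, ∀ g ∈ S, (g : ℝ) ≠ r * t ∧ (g : ℝ) ≠ r / t := by
  classical
  obtain ⟨t, htmem, ht⟩ := (Set.Ioo_infinite one_lt_two).exists_notMem_finset
    (S.image (fun g : PosReal => (g : ℝ) / r) ∪ S.image (fun g : PosReal => r / (g : ℝ)))
  have ht0 : t ≠ 0 := (one_pos.trans htmem.1).ne'
  simp only [Finset.mem_union, Finset.mem_image, not_or, not_exists, not_and] at ht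
  refine ⟨t, htmem, fun g hg => ⟨fun h => ht.1 g hg ?_, fun h => ht.2 g hg ?_⟩⟩ <;>
    · rw [h]
      field_simp

/-- The factor is `s w / ((s + r / t) (s + r t))` with `r = ‖α‖`, for a generic `t` close to `1`
and `w > 0` chosen so that its value at `α` is `1`. -/
lemma exists_peak_factor (hα : 0 < α.re) (c : PosReal →₀ ℂ) :
    ∃ d : PosReal →₀ ℂ, KeepsLeadingJet α c d ∧
      ∀ s : ℝ, 0 < s → ‖jet s 0 d‖ ≤ peakBound ‖α‖ s * ‖jet s 0 c‖ := by
  classical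
  have hr : 0 < ‖α‖ := norm_pos_iff.2 fun h => by simp [h] at hα
  obtain ⟨t, ht, hfresh⟩ := exists_mem_Ioo_forall_ne c.support hr
  have ht0 : 0 < t := one_pos.trans ht.1
  set b₁ : PosReal := ⟨‖α‖ * t, by positivity⟩ with hb₁
  set b₂ : PosReal := ⟨‖α‖ / t, by positivity⟩ with hb₂
  have hb₁c : b₁ ∉ c.support := fun h => (hfresh b₁ h).1 rfl
  have hlt : b₂ < b₁ :=
    Subtype.mk_lt_mk.2 ((div_lt_self hr ht.1).trans (lt_mul_of_one_lt_right hr ht.1))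
  have hb₂d : b₂ ∉ (mulComb 1 0 b₁ c).support := fun h =>
    (Finset.mem_insert.1 (support_mulComb_subset 1 0 b₁ c h)).elim hlt.ne
      fun h' => (hfresh b₂ h').2 rfl
  set w : ℝ := 2 * α.re + ‖α‖ * (t + 1 / t)
  have : 0 ≤ w := by positivity
  have hwle : w ≤ ‖α‖ * (2 + (t + 1 / t)) := by linarith [re_le_norm α]
  refine ⟨mulComb 0 w b₂ (mulComb 1 0 b₁ c), keepsLeadingJet_mulComb_mulComb hα hb₁c hb₂d ?_,
    fun s hs => ?_⟩
  · rw [zero_mul, zero_add, one_mul, add_zero, add_div_mul_add_mul α ht0.ne']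
  · have hsre : 0 < ((s : ℝ) : ℂ).re := hs
    have hreal : (0 * (s : ℂ) + w) / ((s : ℂ) + ((b₂ : ℝ) : ℂ)) *
        ((1 * (s : ℂ) + 0) / ((s : ℂ) + ((b₁ : ℝ) : ℂ))) =
        ((w / (s + ‖α‖ / t) * (s / (s + ‖α‖ * t)) : ℝ) : ℂ) := by
      rw [hb₁, hb₂]
      push_cast
      ring
    rw [jet_zero_mulComb _ _ hsre hb₂d, jet_zero_mulComb _ _ hsre hb₁c, ← mul_assoc, norm_mul,
      hreal, norm_real, Real.norm_of_nonneg (by positivity)]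
    gcongr
    exact div_mul_div_le_peakBound hr hs ht hwle

lemma exists_peak_factor_pow (hα : 0 < α.re) (c : PosReal →₀ ℂ) (n : ℕ) :
    ∃ d : PosReal →₀ ℂ, KeepsLeadingJet α c d ∧
      ∀ s : ℝ, 0 < s → ‖jet s 0 d‖ ≤ peakBound ‖α‖ s ^ n * ‖jet s 0 c‖ := by
  induction n with
  | zero => exact ⟨c, .refl α c, fun s _ => by simp⟩
  | succ n ih =>
    obtain ⟨d, hcd, hd⟩ := ih
    obtain ⟨e, hde, he⟩ := exists_peak_factor hα d
    have hr : 0 < ‖α‖ := norm_pos_iff.2 fun h => by simp [h] at hα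
    refine ⟨e, hcd.trans hα hde, fun s hs => ?_⟩
    calc _ ≤ peakBound ‖α‖ s * ‖jet s 0 d‖ := he s hs
      _ ≤ peakBound ‖α‖ s * (peakBound ‖α‖ s ^ n * ‖jet s 0 c‖) :=
        mul_le_mul_of_nonneg_left (hd s hs) (peakBound_nonneg hr hs)
      _ = _ := by ring

lemma norm_sq_eq_integral {X : Type*} [MeasurableSpace X] {μ : Measure X} (f : Lp ℂ 2 μ) :
    ‖f‖ ^ 2 = ∫ x, ‖f x‖ ^ 2 ∂μ := by
  have h := inner_eq_integral_conj_mul f f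
  simp only [inner_self_eq_ofReal_norm_sq, conj_mul', ← ofReal_pow, integral_complex_ofReal] at h
  exact ofReal_injective h

lemma tendsto_norm_of_le_pow_mul {X : Type*} [MeasurableSpace X] {μ : Measure X} {ρ : X → ℝ}
    (hρ0 : ∀ᵐ x ∂μ, 0 ≤ ρ x) (hρ1 : ∀ᵐ x ∂μ, ρ x < 1) (f : Lp ℂ 2 μ) (g : ℕ → Lp ℂ 2 μ)
    (hg : ∀ n, ∀ᵐ x ∂μ, ‖g n x‖ ≤ ρ x ^ n * ‖f x‖) :
    Tendsto (fun n => ‖g n‖) atTop (𝓝 0) := by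
  have hsq : Tendsto (fun n => ∫ x, ‖g n x‖ ^ 2 ∂μ) atTop (𝓝 (∫ _, (0 : ℝ) ∂μ)) := by
    refine tendsto_integral_of_dominated_convergence (fun x => ‖f x‖ ^ 2)
      (fun n => (Lp.aestronglyMeasurable _).norm.pow 2)
      ((memLp_two_iff_integrable_sq_norm (Lp.aestronglyMeasurable f)).1 (Lp.memLp f))
      (fun n => ?_) ?_
    · filter_upwards [hg n, hρ0, hρ1] with x hgx h0 h1
      rw [norm_pow, norm_norm]
      exact pow_le_pow_left₀ (norm_nonneg _) (hgx.trans (mul_le_of_le_one_left (norm_nonneg _)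
        (pow_le_one₀ h0 h1.le))) 2
    · filter_upwards [ae_all_iff.2 hg, hρ0, hρ1] with x hgx h0 h1
      have hmaj : Tendsto (fun n => (ρ x ^ n * ‖f x‖) ^ 2) atTop (𝓝 0) := by
        simpa using ((tendsto_pow_atTop_nhds_zero_of_lt_one h0 h1).mul_const ‖f x‖).pow 2
      exact squeeze_zero (fun n => sq_nonneg _)
        (fun n => pow_le_pow_left₀ (norm_nonneg _) (hgx n) 2) hmaj
  simp only [← norm_sq_eq_integral, integral_zero] at hsq
  simpa using hsq.sqrt

lemma memLp_stieltjes {b : ℝ} (hb : 0 < b) :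
    MemLp (fun s : ℝ => 1 / ((s : ℂ) + b) ^ (0 + 1)) 2 (volume.restrict (Set.Ioi (0 : ℝ))) := by
  have hmeas : Measurable (fun s : ℝ => 1 / ((s : ℂ) + b) ^ (0 + 1)) := by fun_prop
  rw [memLp_two_iff_integrable_sq_norm hmeas.aestronglyMeasurable]
  refine (integrableOn_Ioi_one_div_add_mul_self hb).congr ?_
  filter_upwards [ae_restrict_mem measurableSet_Ioi] with s (hs : 0 < s)
  rw [norm_div, norm_one, zero_add, pow_one, ← ofReal_add, norm_real,
    Real.norm_of_nonneg (by positivity), sq]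

/-- The restriction of `∑ c_b / (s + b)` to the positive half-axis. -/
def stieltjesComb : (PosReal →₀ ℂ) →ₗ[ℂ] Lp ℂ 2 (volume.restrict (Set.Ioi (0 : ℝ))) :=
  Finsupp.linearCombination ℂ fun b : PosReal => (memLp_stieltjes b.2).toLp _

lemma coeFn_stieltjesComb (c : PosReal →₀ ℂ) :
    ⇑(stieltjesComb c) =ᵐ[volume.restrict (Set.Ioi (0 : ℝ))] fun s : ℝ => jet s 0 c :=
  coeFn_linearCombination_toLp (fun b : PosReal => memLp_stieltjes b.2) c

lemma exists_keepsLeadingJet_norm_stieltjesComb_lt (hα : 0 < α.re) (c : PosReal →₀ ℂ) {ε : ℝ}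
    (hε : 0 < ε) : ∃ d : PosReal →₀ ℂ, KeepsLeadingJet α c d ∧ ‖stieltjesComb d‖ < ε := by
  choose d hcd hd using exists_peak_factor_pow hα c
  have hr : 0 < ‖α‖ := norm_pos_iff.2 fun h => by simp [h] at hα
  have hρ0 : ∀ᵐ s ∂volume.restrict (Set.Ioi (0 : ℝ)), 0 ≤ peakBound ‖α‖ s := by
    filter_upwards [ae_restrict_mem measurableSet_Ioi] with s hs using peakBound_nonneg hr hs
  have hρ1 : ∀ᵐ s ∂volume.restrict (Set.Ioi (0 : ℝ)), peakBound ‖α‖ s < 1 := by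
    filter_upwards [ae_restrict_mem measurableSet_Ioi,
      ae_restrict_of_ae (Measure.ae_ne volume ‖α‖)] with s hs using peakBound_lt_one hr hs
  have hlim := tendsto_norm_of_le_pow_mul hρ0 hρ1 (stieltjesComb c) (fun n => stieltjesComb (d n))
    fun n => by
      filter_upwards [coeFn_stieltjesComb c, coeFn_stieltjesComb (d n),
        ae_restrict_mem measurableSet_Ioi] with s hc hdn hs
      rw [hc, hdn]
      exact hd n s hs
  obtain ⟨n, hn⟩ := (hlim.eventually_lt_const hε).exists
  exact ⟨d n, hcd n, hn⟩

/-- Descending induction on the number `m` of leading zeros of the prescribed jet: a peaked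
combination realises its first nonzero entry. -/
lemma exists_jet_eq_at_point (A : Finset ℂ) (hA : ∀ a ∈ A, 0 < a.re) (n : ℕ) (hα : 0 < α.re)
    (j : ℕ) : ∀ m, m + j = n → ∀ x : ℕ → ℂ, (∀ i < m, x i = 0) → ∀ ε : ℝ, 0 < ε →
      ∃ c : PosReal →₀ ℂ, (∀ a ∈ A, a ≠ α → VanishesTo c a n) ∧
        (∀ i < n, jet α i c = x i) ∧ ‖stieltjesComb c‖ < ε := by
  induction j with
  | zero =>
    intro m hm x hx ε hε
    refine ⟨0, fun a _ _ i _ => map_zero _, fun i hi => ?_, by simpa⟩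
    rw [map_zero, hx i (by lia)]
  | succ j ih =>
    intro m hm x hx ε hε
    obtain ⟨d, hdA, hdα, hlead⟩ := exists_leading_jet A hA n hα m
    obtain ⟨d', hkeep, hd'⟩ := exists_keepsLeadingJet_norm_stieltjesComb_lt hα
      ((x m / jet α m d) • d) (half_pos hε)
    have hrest : ∀ i < m + 1, x i - jet α i d' = 0 := fun i hi => by
      rcases Nat.lt_succ_iff_lt_or_eq.1 hi with h | rfl
      · rw [hx i h, hkeep.vanishesTo hα (hdα.smul _) i h, sub_zero]
      · rw [hkeep.jet_eq (hdα.smul _), map_smul, smul_eq_mul, div_mul_cancel₀ _ hlead, sub_self]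
    obtain ⟨e, heA, heα, he⟩ := ih (m + 1) (by lia) _ hrest (ε / 2) (half_pos hε)
    refine ⟨d' + e, fun a ha haα i hi => ?_, fun i hi => ?_, ?_⟩
    · rw [map_add, heA a ha haα i hi, hkeep.vanishesTo (hA a ha) ((hdA a ha haα).smul _) i hi,
        add_zero]
    · rw [map_add, heα i hi, add_sub_cancel]
    · rw [map_add]
      exact (norm_add_le _ _).trans_lt ((add_lt_add hd' he).trans_eq (add_halves ε))

theorem exists_jet_eq_norm_stieltjesComb_lt (A : Finset ℂ) (hA : ∀ a ∈ A, 0 < a.re) (n : ℕ)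
    (x : ℂ → ℕ → ℂ) {ε : ℝ} (hε : 0 < ε) :
    ∃ c : PosReal →₀ ℂ, (∀ a ∈ A, ∀ i < n, jet a i c = x a i) ∧ ‖stieltjesComb c‖ < ε := by
  classical
  have hpoint : ∀ α : A, ∃ c : PosReal →₀ ℂ, (∀ a ∈ A, a ≠ α → VanishesTo c a n) ∧
      (∀ i < n, jet α i c = x α i) ∧ ‖stieltjesComb c‖ < ε / (A.card + 1) := fun α =>
    exists_jet_eq_at_point A hA n (hA α α.2) n 0 (zero_add n) (x α)
      (fun i hi => absurd hi i.not_lt_zero) _ (by positivity)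
  choose c hvan hjet hnorm using hpoint
  refine ⟨∑ α : A, c α, fun a ha i hi => ?_, ?_⟩
  · rw [map_sum, Finset.sum_eq_single_of_mem (⟨a, ha⟩ : A) (Finset.mem_univ _)
      fun α _ hα => hvan α a ha (fun h => hα (Subtype.ext h.symm)) i hi]
    exact hjet ⟨a, ha⟩ i hi
  · rw [map_sum]
    calc _ ≤ ∑ α : A, ‖stieltjesComb (c α)‖ := norm_sum_le _ _
      _ ≤ ∑ _α : A, ε / (A.card + 1) := Finset.sum_le_sum fun α _ => (hnorm α).le
      _ = A.card * (ε / (A.card + 1)) := by simp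
      _ < ε := by
        rw [mul_div_assoc', div_lt_iff₀ (by positivity)]
        linarith

end Jets

section HankelOperator

variable {σ : ℝ → ℂ} (hσ : MemLp σ ⊤ (volume : Measure ℝ))

/-- The operator `w ↦ σ(x) w(-x)` in `L²(ℝ)`. -/
def hankelLp (σ : ℝ → ℂ) (hσ : MemLp σ ⊤ (volume : Measure ℝ)) : L2R →L[ℂ] L2R :=
  ((ContinuousLinearMap.mul ℂ ℂ).holderL (volume : Measure ℝ) ⊤ 2 2 hσ.toLp) ∘L
    (Lp.compMeasurePreservingₗᵢ ℂ Neg.neg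
      (Measure.measurePreserving_neg (volume : Measure ℝ))).toContinuousLinearMap

lemma coeFn_hankelLp (w : L2R) : ⇑(hankelLp σ hσ w) =ᵐ[volume] fun x => σ x * w (-x) := by
  have hneg := Measure.measurePreserving_neg (volume : Measure ℝ)
  filter_upwards [(ContinuousLinearMap.mul ℂ ℂ).coeFn_holder (r := 2) hσ.toLp
    (Lp.compMeasurePreserving Neg.neg hneg w), Lp.coeFn_compMeasurePreserving w hneg,
    hσ.coeFn_toLp] with x hmul hw hσx
  refine hmul.trans ?_
  rw [hw, hσx]
  rfl

lemma inner_hankelLp (v w : L2R) :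
    inner ℂ v (hankelLp σ hσ w) = ∫ x : ℝ, σ x * w (-x) * conj (v x) := by
  rw [inner_eq_integral_conj_mul]
  refine integral_congr_ae ?_
  filter_upwards [coeFn_hankelLp hσ w] with x hx
  rw [hx, mul_comm]

/-- The Hankel operator with symbol `σ`, as the compression of `hankelLp σ` to the Hardy space. -/
def hankelOp (σ : ℝ → ℂ) (hσ : MemLp σ ⊤ (volume : Measure ℝ)) : hardySpace →L[ℂ] hardySpace :=
  hardySpace.orthogonalProjectionOnto ∘L hankelLp σ hσ ∘L hardySpace.subtypeL

lemma inner_hankelOp (v w : hardySpace) :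
    inner ℂ v (hankelOp σ hσ w) = inner ℂ (v : L2R) (hankelLp σ hσ w) :=
  Submodule.inner_orthogonalProjectionOnto_eq_of_mem_left v _

lemma isHankelOperator_hankelOp : IsHankelOperator σ (hankelOp σ hσ) :=
  ⟨hσ, fun w => by rw [inner_hankelOp, inner_hankelLp]⟩

lemma IsHankelOperator.eq_hankelOp {H : hardySpace →L[ℂ] hardySpace} (hH : IsHankelOperator σ H) :
    H = hankelOp σ hH.memLp_symbol := by
  rw [← ContinuousLinearMap.coe_inj, ← ext_inner_map]
  intro w
  have hform : inner ℂ w (H w) = inner ℂ w (hankelOp σ hH.memLp_symbol w) :=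
    (hH.form_eq w).trans ((isHankelOperator_hankelOp _).form_eq w).symm
  exact (inner_conj_symm (H w) w).symm.trans
    ((congrArg conj hform).trans (inner_conj_symm (hankelOp σ _ w) w))

lemma IsHankelOperator.inner_eq {H : hardySpace →L[ℂ] hardySpace} (hH : IsHankelOperator σ H)
    (v w : hardySpace) : inner ℂ v (H w) = inner ℂ (v : L2R) (hankelLp σ hH.memLp_symbol w) := by
  rw [← inner_hankelOp, ← hH.eq_hankelOp]

end HankelOperator

section Symbol

/-- The coefficient of `(a - i x)^{-k-1}` in the expansion of `Q(x) (a - i x)^{-n-1}` in powers of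
`(a - i x)^{-1}`. -/
def laurentCoeff (a : ℂ) (n : ℕ) (Q : ℂ[X]) (k : ℕ) : ℂ :=
  I ^ (n - k) * (Polynomial.taylor (-I * a) Q).coeff (n - k)

lemma laurentCoeff_self (a : ℂ) (n : ℕ) (Q : ℂ[X]) :
    laurentCoeff a n Q n = Q.eval (-I * a) := by
  simp [laurentCoeff, Polynomial.taylor_coeff_zero]

lemma eval_div_eq_sum_cauchyKernel {a : ℂ} (ha : 0 < a.re) {n : ℕ} {Q : ℂ[X]}
    (hQ : Q.natDegree ≤ n) (x : ℝ) :
    Q.eval (x : ℂ) / (a - I * (x : ℂ)) ^ (n + 1) =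
      ∑ k ∈ Finset.range (n + 1), laurentCoeff a n Q k * cauchyKernel a k x := by
  have hne := sub_I_mul_ne_zero ha x
  have htaylor : Q.eval (x : ℂ) = ∑ j ∈ Finset.range (n + 1),
      (Polynomial.taylor (-I * a) Q).coeff j * (I * (a - I * x)) ^ j := by
    have hx : I * (a - I * x) + -I * a = x := by linear_combination -(x : ℂ) * I_sq
    rw [← Polynomial.eval_eq_sum_range' (by rwa [Polynomial.natDegree_taylor, Nat.lt_succ_iff]),
      Polynomial.taylor_eval, hx]
  rw [htaylor, ← Finset.sum_range_reflect, Finset.sum_div]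
  refine Finset.sum_congr rfl fun k hk => ?_
  obtain ⟨j, rfl⟩ := Nat.exists_eq_add_of_le (Finset.mem_range_succ_iff.1 hk)
  rw [laurentCoeff, cauchyKernel, mul_pow, show k + j + 1 - 1 - k = j by omega,
    show k + j - k = j by omega, show k + j + 1 = j + (k + 1) by omega, pow_add]
  field_simp

variable {M : ℕ} {α : Fin M → ℂ} {K : Fin M → ℕ} {Q : Fin M → ℂ[X]}

/-- The symbol `π i sgn x + φ(x)`. -/
abbrev hankelSymbol (α : Fin M → ℂ) (K : Fin M → ℕ) (Q : Fin M → ℂ[X]) (x : ℝ) : ℂ :=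
  carlemanSymbol x + rationalSymbol α K Q x

/-- The coefficients of `φ` in the expansion in the functions `(αₘ - i x)^{-k-1}`, `k ≤ Kₘ`. -/
def symbolCoeff (α : Fin M → ℂ) (K : Fin M → ℕ) (Q : Fin M → ℂ[X]) (m : Fin M) : ℕ → ℂ :=
  laurentCoeff (α m) (K m) (Q m)

variable (hα : ∀ m, 0 < (α m).re) (hdeg : ∀ m, (Q m).natDegree ≤ K m)
include hα hdeg

lemma rationalSymbol_eq (x : ℝ) :
    rationalSymbol α K Q x = ∑ m, ∑ k ∈ Finset.range (K m + 1),
      symbolCoeff α K Q m k * cauchyKernel (α m) k x :=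
  Finset.sum_congr rfl fun m _ => eval_div_eq_sum_cauchyKernel (hα m) (hdeg m) x

lemma memLp_top_hankelSymbol : MemLp (hankelSymbol α K Q) ⊤ (volume : Measure ℝ) := by
  have hcarleman : MemLp carlemanSymbol ⊤ (volume : Measure ℝ) :=
    memLp_top_of_bound measurable_carlemanSymbol.aestronglyMeasurable Real.pi
      (Eventually.of_forall norm_carlemanSymbol_le)
  have hkernel (m k) : MemLp (cauchyKernel (α m) k) ⊤ (volume : Measure ℝ) :=
    memLp_top_of_bound (continuous_cauchyKernel (hα m) k).aestronglyMeasurable _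
      (Eventually.of_forall (norm_cauchyKernel_le (hα m) k))
  have hrational : MemLp (rationalSymbol α K Q) ⊤ (volume : Measure ℝ) := by
    rw [funext (rationalSymbol_eq hα hdeg)]
    exact memLp_finsetSum _ fun m _ => memLp_finsetSum _ fun k _ => (hkernel m k).const_mul _
  exact hcarleman.add hrational

variable {b c : ℂ} (hb : 0 < b.re) (hc : 0 < c.re)
include hb hc

omit hdeg in
lemma integrable_symbolCoeff_mul (m : Fin M) (k : ℕ) :
    Integrable fun x => symbolCoeff α K Q m k * cauchyKernel (α m) k x *
      (cauchyKernel b 0 (-x) * cauchyKernel c 0 (-x)) := by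
  simpa only [mul_assoc] using (integrable_cauchyKernel_mul_neg (hα m) hb hc k).const_mul _

lemma integrable_rationalSymbol_mul_neg :
    Integrable fun x => rationalSymbol α K Q x *
      (cauchyKernel b 0 (-x) * cauchyKernel c 0 (-x)) := by
  simp only [rationalSymbol_eq hα hdeg, Finset.sum_mul]
  exact integrable_finsetSum _ fun m _ => integrable_finsetSum _ fun k _ =>
    integrable_symbolCoeff_mul hα hb hc m k

lemma integral_rationalSymbol_mul_neg :
    ∫ x, rationalSymbol α K Q x * (cauchyKernel b 0 (-x) * cauchyKernel c 0 (-x)) =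
      2 * Real.pi * ∑ m, ∑ k ∈ Finset.range (K m + 1), symbolCoeff α K Q m k *
        ∑ p ∈ Finset.HasAntidiagonal.antidiagonal k,
          1 / (α m + b) ^ (p.1 + 1) * (1 / (α m + c) ^ (p.2 + 1)) := by
  have hint := integrable_symbolCoeff_mul (K := K) (Q := Q) hα hb hc
  simp only [rationalSymbol_eq hα hdeg, Finset.sum_mul]
  rw [integral_finsetSum _ fun m _ => integrable_finsetSum _ fun k _ => hint m k, Finset.mul_sum]
  refine Finset.sum_congr rfl fun m _ => ?_
  rw [integral_finsetSum _ fun k _ => hint m k, Finset.mul_sum]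
  refine Finset.sum_congr rfl fun k _ => ?_
  simp only [mul_assoc]
  rw [integral_const_mul, integral_cauchyKernel_mul_neg (hα m) hb hc]
  ring

end Symbol

section JetForm

variable {ι : Type*} [Fintype ι] {α : ι → ℂ} {K : ι → ℕ}

/-- All jets of a combination of kernels. -/
def jets : (PosReal →₀ ℂ) →ₗ[ℂ] (ℂ → ℕ → ℂ) := LinearMap.pi fun a => LinearMap.pi (jet a)

lemma jets_apply (c : PosReal →₀ ℂ) (a : ℂ) (k : ℕ) : jets c a k = jet a k c := rfl

lemma jets_single (b : PosReal) (a : ℂ) (k : ℕ) :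
    jets (Finsupp.single b 1) a k = 1 / (a + ((b : ℝ) : ℂ)) ^ (k + 1) := by
  simp [jets_apply, jet]

/-- The sesquilinear form in the jets at the points `αₘ` that corresponds to the rational symbol
`∑ κₘₖ (αₘ - i x)^{-k-1}`. -/
def jetForm (α : ι → ℂ) (K : ι → ℕ) (κ : ι → ℕ → ℂ) :
    (ℂ → ℕ → ℂ) →ₗ[ℂ] (ℂ → ℕ → ℂ) →ₗ⋆[ℂ] ℂ :=
  LinearMap.mk₂'ₛₗ (RingHom.id ℂ) (starRingEnd ℂ)
    (fun x y => ∑ m, ∑ k ∈ Finset.range (K m + 1), κ m k *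
      ∑ p ∈ Finset.HasAntidiagonal.antidiagonal k, x (α m) p.1 * conj (y (conj (α m)) p.2))
    (fun x x' y => by simp only [Pi.add_apply, add_mul, Finset.sum_add_distrib, mul_add])
    (fun z x y => by
      simp only [Pi.smul_apply, smul_eq_mul, Finset.mul_sum, mul_assoc, mul_left_comm z,
        RingHom.id_apply])
    (fun x y y' => by simp only [Pi.add_apply, map_add, Finset.sum_add_distrib, mul_add])
    (fun z x y => by
      simp only [Pi.smul_apply, smul_eq_mul, Finset.mul_sum, map_mul, mul_left_comm (conj z)])

lemma jetForm_apply (κ : ι → ℕ → ℂ) (x y : ℂ → ℕ → ℂ) :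
    jetForm α K κ x y = ∑ m, ∑ k ∈ Finset.range (K m + 1), κ m k *
      ∑ p ∈ Finset.HasAntidiagonal.antidiagonal k, x (α m) p.1 * conj (y (conj (α m)) p.2) := rfl

lemma jetForm_congr {κ : ι → ℕ → ℂ} {x x' y y' : ℂ → ℕ → ℂ}
    (hx : ∀ m, ∀ k ≤ K m, x (α m) k = x' (α m) k)
    (hy : ∀ m, ∀ k ≤ K m, y (conj (α m)) k = y' (conj (α m)) k) :
    jetForm α K κ x y = jetForm α K κ x' y' := by
  rw [jetForm_apply, jetForm_apply]
  refine Finset.sum_congr rfl fun m _ => Finset.sum_congr rfl fun k hk => ?_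
  refine congrArg _ (Finset.sum_congr rfl fun p hp => ?_)
  rw [Finset.mem_range] at hk
  rw [Finset.HasAntidiagonal.mem_antidiagonal] at hp
  rw [hx m p.1 (by omega), hy m p.2 (by omega)]

lemma jetForm_jets_single (κ : ι → ℕ → ℂ) (b c : PosReal) :
    jetForm α K κ (jets (Finsupp.single b 1)) (jets (Finsupp.single c 1)) =
      ∑ m, ∑ k ∈ Finset.range (K m + 1), κ m k *
        ∑ p ∈ Finset.HasAntidiagonal.antidiagonal k,
          1 / (α m + (b : ℝ)) ^ (p.1 + 1) * (1 / (α m + (c : ℝ)) ^ (p.2 + 1)) := by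
  simp [jetForm_apply, jets_single]

end JetForm

section HankelForm

variable {M : ℕ} {α : Fin M → ℂ} {K : Fin M → ℕ} {Q : Fin M → ℂ[X]}

lemma inner_stieltjesComb_single (b c : PosReal) :
    inner ℂ (stieltjesComb (Finsupp.single c 1)) (stieltjesComb (Finsupp.single b 1)) =
      ∫ s in Set.Ioi (0 : ℝ), 1 / ((s : ℂ) + (b : ℝ)) * (1 / ((s : ℂ) + (c : ℝ))) := by
  rw [inner_eq_integral_conj_mul]
  refine integral_congr_ae ?_
  filter_upwards [coeFn_stieltjesComb (Finsupp.single b 1),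
    coeFn_stieltjesComb (Finsupp.single c 1)] with s hb hc
  rw [hb, hc, ← jets_apply, ← jets_apply, jets_single, jets_single]
  simp [mul_comm]

lemma inner_kernelComb_single_hankelLp {σ : ℝ → ℂ} (hσ : MemLp σ ⊤ (volume : Measure ℝ))
    (b c : PosReal) :
    inner ℂ (kernelComb (Finsupp.single c 1)) (hankelLp σ hσ (kernelComb (Finsupp.single b 1))) =
      ∫ x, σ x * (cauchyKernel (b : ℝ) 0 (-x) * cauchyKernel (c : ℝ) 0 (-x)) := by
  have hsingle (b : PosReal) : kernelComb (Finsupp.single b 1) = kernelLp (b : ℝ) b.re_pos 0 := by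
    simp [kernelComb]
  rw [inner_hankelLp, hsingle, hsingle]
  refine integral_congr_ae ?_
  filter_upwards [coeFn_kernelLp c.re_pos 0, (Measure.measurePreserving_neg
    (volume : Measure ℝ)).quasiMeasurePreserving.ae (coeFn_kernelLp b.re_pos 0)] with x hc hb
  rw [hc, hb, conj_cauchyKernel, conj_ofReal, mul_assoc]

/-- The positive form `‖stieltjesComb c‖ ^ 2` comes from the symbol `π i sgn x` of the Carleman
operator. -/
theorem inner_kernelComb_hankelLp (hα : ∀ m, 0 < (α m).re) (hdeg : ∀ m, (Q m).natDegree ≤ K m)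
    (hσ : MemLp (hankelSymbol α K Q) ⊤ (volume : Measure ℝ)) (c d : PosReal →₀ ℂ) :
    inner ℂ (kernelComb d) (hankelLp _ hσ (kernelComb c)) =
      2 * Real.pi * (inner ℂ (stieltjesComb d) (stieltjesComb c) +
        jetForm α K (symbolCoeff α K Q) (jets c) (jets d)) := by
  have hkernel (b g : PosReal) : inner ℂ (kernelComb (Finsupp.single g 1))
      (hankelLp _ hσ (kernelComb (Finsupp.single b 1))) =
      2 * Real.pi * (inner ℂ (stieltjesComb (Finsupp.single g 1))
        (stieltjesComb (Finsupp.single b 1)) + jetForm α K (symbolCoeff α K Q)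
          (jets (Finsupp.single b 1)) (jets (Finsupp.single g 1))) := by
    rw [inner_kernelComb_single_hankelLp, inner_stieltjesComb_single, jetForm_jets_single, mul_add,
      ← integral_carlemanSymbol_mul_neg b.2 g.2,
      ← integral_rationalSymbol_mul_neg hα hdeg b.re_pos g.re_pos]
    simp only [add_mul]
    exact integral_add (integrable_carlemanSymbol_mul
      ((memLp_cauchyKernel_neg b.re_pos 0).integrable_mul (memLp_cauchyKernel_neg g.re_pos 0)))
      (integrable_rationalSymbol_mul_neg hα hdeg b.re_pos g.re_pos)
  induction c using Finsupp.induction_linear with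
  | zero => simp
  | add c c' hc hc' =>
    simp only [map_add, inner_add_right, hc, hc', LinearMap.add_apply]
    ring
  | single b z =>
    induction d using Finsupp.induction_linear with
    | zero => simp
    | add d d' hd hd' =>
      simp only [map_add, inner_add_left, hd, hd']
      ring
    | single g u =>
      rw [← Finsupp.smul_single_one b, ← Finsupp.smul_single_one g]
      simp only [map_smul, map_smulₛₗ, inner_smul_left, inner_smul_right, hkernel,
        LinearMap.smul_apply, smul_eq_mul]
      ring

/-- The combinations of kernels as elements of the Hardy space. -/
def hardyComb : (PosReal →₀ ℂ) →ₗ[ℂ] hardySpace :=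
  kernelComb.codRestrict hardySpace fun c =>
    hardySpace_eq_closure ▸ Submodule.le_topologicalClosure _ (LinearMap.mem_range_self _ c)

lemma denseRange_hardyComb : DenseRange hardyComb := by
  rw [DenseRange, Subtype.dense_iff, ← Set.range_comp]
  exact hardySpace_eq_closure.le

/-- The continuous extension of `jet a k` from combinations of kernels to `L²(ℝ)`; it has the junk
value `0` unless `0 < Re a`. -/
def hardyJet (a : ℂ) (k : ℕ) : L2R →L[ℂ] ℂ :=
  if ha : 0 < a.re then
    (1 / (2 * Real.pi) : ℂ) • innerSL ℂ (kernelLp (conj a) (conj_re_pos ha) k)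
  else 0

lemma hardyJet_kernelComb {a : ℂ} (ha : 0 < a.re) (k : ℕ) (c : PosReal →₀ ℂ) :
    hardyJet a k (kernelComb c) = jet a k c := by
  have hpi : (Real.pi : ℂ) ≠ 0 := ofReal_ne_zero.2 Real.pi_ne_zero
  rw [hardyJet, dif_pos ha, smul_apply, innerSL_apply_apply, inner_kernelLp_kernelComb ha,
    smul_eq_mul]
  field_simp

variable {H : hardySpace →L[ℂ] hardySpace} (hα : ∀ m, 0 < (α m).re)
  (hdeg : ∀ m, (Q m).natDegree ≤ K m) (hH : IsHankelOperator (hankelSymbol α K Q) H)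
include hα hdeg hH

lemma IsHankelOperator.inner_hardyComb (c d : PosReal →₀ ℂ) :
    inner ℂ (hardyComb d) (H (hardyComb c)) =
      2 * Real.pi * (inner ℂ (stieltjesComb d) (stieltjesComb c) +
        jetForm α K (symbolCoeff α K Q) (jets c) (jets d)) := by
  rw [hH.inner_eq]
  exact inner_kernelComb_hankelLp hα hdeg hH.memLp_symbol c d

lemma IsHankelOperator.re_inner_hardyComb (c : PosReal →₀ ℂ) :
    (inner ℂ (hardyComb c) (H (hardyComb c))).re =
      2 * Real.pi * (‖stieltjesComb c‖ ^ 2 +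
        (jetForm α K (symbolCoeff α K Q) (jets c) (jets c)).re) := by
  rw [hH.inner_hardyComb hα hdeg, inner_self_eq_ofReal_norm_sq, ← ofReal_ofNat, ← ofReal_mul,
    re_ofReal_mul, add_re, ofReal_re]

theorem IsHankelOperator.re_jetForm_le_re_inner (w : hardySpace) :
    2 * Real.pi * (jetForm α K (symbolCoeff α K Q) (fun a k => hardyJet a k w)
      (fun a k => hardyJet a k w)).re ≤ (inner ℂ w (H w)).re := by
  refine denseRange_hardyComb.induction_on w (isClosed_le ?_ ?_) fun c => ?_
  · have : Continuous (conj : ℂ → ℂ) := continuous_conj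
    simp only [jetForm_apply]
    fun_prop
  · exact continuous_re.comp (continuous_id.inner H.continuous)
  · rw [hH.re_inner_hardyComb hα hdeg, jetForm_congr (x' := jets c) (y' := jets c)
      (fun m k _ => hardyJet_kernelComb (hα m) k c)
      (fun m k _ => hardyJet_kernelComb (conj_re_pos (hα m)) k c)]
    have := Real.two_pi_pos
    gcongr
    exact le_add_of_nonneg_left (sq_nonneg _)

end HankelForm

section DiagonalForms

variable {S ι : Type*} [Fintype S] [DecidableEq ι] {G : Matrix S S ℂ}

/-- The vectors `u i` are orthogonal with respect to the Hermitian form of `G`, which takes the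
values `l i` on them. -/
def IsDiagonalFamily (G : Matrix S S ℂ) (u : ι → S → ℂ) (l : ι → ℝ) : Prop :=
  ∀ i j, star (u i) ⬝ᵥ G.mulVec (u j) = if i = j then (l i : ℂ) else 0

lemma isDiagonalFamily_eigenvectorBasis [DecidableEq S] (hG : G.IsHermitian) :
    IsDiagonalFamily G (fun i => (hG.eigenvectorBasis i).ofLp) hG.eigenvalues := fun i j => by
  have horth := orthonormal_iff_ite.1 hG.eigenvectorBasis.orthonormal i j
  rw [EuclideanSpace.inner_eq_star_dotProduct, dotProduct_comm] at horth
  rw [hG.mulVec_eigenvectorBasis j, dotProduct_smul, horth]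
  split_ifs with hij
  · simp [hij]
  · simp

namespace IsDiagonalFamily

variable {u : ι → S → ℂ} {l : ι → ℝ}

lemma comp_injective {ι' : Type*} [DecidableEq ι'] (hu : IsDiagonalFamily G u l) {f : ι' → ι}
    (hf : Function.Injective f) : IsDiagonalFamily G (u ∘ f) (l ∘ f) := fun i j => by
  simpa only [Function.comp_apply, hf.eq_iff] using hu (f i) (f j)

variable [Fintype ι] (hu : IsDiagonalFamily G u l)
include hu

lemma dotProduct_mulVec_sum_smul (z : ι → ℂ) :
    star (∑ i, z i • u i) ⬝ᵥ G.mulVec (∑ i, z i • u i) = ((∑ i, l i * ‖z i‖ ^ 2 : ℝ) : ℂ) := by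
  have hmulVec : G.mulVec (∑ i, z i • u i) = ∑ i, z i • G.mulVec (u i) := by
    rw [← Matrix.mulVecLin_apply, map_sum]
    simp only [map_smul, Matrix.mulVecLin_apply]
  rw [hmulVec, star_sum, sum_dotProduct]
  simp only [dotProduct_sum, star_smul, smul_dotProduct, dotProduct_smul, hu _ _, smul_eq_mul,
    mul_ite, mul_zero, Finset.sum_ite_eq, Finset.mem_univ, if_true]
  push_cast
  refine Finset.sum_congr rfl fun i _ => ?_
  rw [← Complex.mul_conj', RCLike.star_def]
  ring

lemma card_le_finrank_of_pos (hl : ∀ i, 0 < l i) {F : Type*} [AddCommGroup F] [Module ℂ F]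
    [FiniteDimensional ℂ F] (R : (S → ℂ) →ₗ[ℂ] F)
    (hR : ∀ ξ, R ξ = 0 → (star ξ ⬝ᵥ G.mulVec ξ).re ≤ 0) :
    Fintype.card ι ≤ Module.finrank ℂ F := by
  have hinj : Function.Injective (R ∘ₗ Fintype.linearCombination ℂ u) := by
    rw [injective_iff_map_eq_zero]
    intro z hz
    have hle := hR _ hz
    rw [Fintype.linearCombination_apply, hu.dotProduct_mulVec_sum_smul, ofReal_re] at hle
    have hnonneg (i : ι) : 0 ≤ l i * ‖z i‖ ^ 2 := mul_nonneg (hl i).le (sq_nonneg _)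
    have hzero := (Finset.sum_eq_zero_iff_of_nonneg fun i _ => hnonneg i).1
      (hle.antisymm (Finset.sum_nonneg fun i _ => hnonneg i))
    funext i
    simpa [(hl i).ne'] using hzero i (Finset.mem_univ i)
  simpa using LinearMap.finrank_le_finrank_of_injective hinj

end IsDiagonalFamily

lemma eigenvalues_ne_zero_of_mulVec_injective [DecidableEq S] (hG : G.IsHermitian)
    (hinj : Function.Injective G.mulVec) (i : S) : hG.eigenvalues i ≠ 0 := fun hi => by
  have hker : G.mulVec (hG.eigenvectorBasis i).ofLp = G.mulVec 0 := by
    rw [hG.mulVec_eigenvectorBasis i, hi, zero_smul, Matrix.mulVec_zero]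
  exact hG.eigenvectorBasis.orthonormal.ne_zero i (WithLp.ofLp_injective 2 (hinj hker))

lemma exists_isDiagonalFamily_neg [DecidableEq S] (hG : G.IsHermitian)
    (hinj : Function.Injective G.mulVec) {F : Type*} [AddCommGroup F] [Module ℂ F]
    [FiniteDimensional ℂ F] (R : (S → ℂ) →ₗ[ℂ] F)
    (hR : ∀ ξ, R ξ = 0 → (star ξ ⬝ᵥ G.mulVec ξ).re ≤ 0) :
    ∃ (s : Finset S) (u : s → S → ℂ) (l : s → ℝ), IsDiagonalFamily G u l ∧ (∀ i, l i < 0) ∧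
      Fintype.card S ≤ Module.finrank ℂ F + s.card := by
  have hdiag := isDiagonalFamily_eigenvectorBasis hG
  have hpos : Fintype.card {i // 0 < hG.eigenvalues i} ≤ Module.finrank ℂ F :=
    (hdiag.comp_injective Subtype.val_injective).card_le_finrank_of_pos (fun i => i.2) R hR
  refine ⟨Finset.univ.filter fun i => hG.eigenvalues i < 0, _, _,
    hdiag.comp_injective Subtype.val_injective, fun i => (Finset.mem_filter.1 i.2).2, ?_⟩
  have hnot (i : S) : ¬ hG.eigenvalues i < 0 ↔ 0 < hG.eigenvalues i := by
    rw [not_lt, (eigenvalues_ne_zero_of_mulVec_injective hG hinj i).symm.le_iff_lt]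
  rw [Fintype.card_subtype] at hpos
  rw [← Finset.card_univ, ← Finset.card_filter_add_card_filter_not fun i => hG.eigenvalues i < 0]
  simp only [hnot]
  omega

end DiagonalForms

section HankelMatrix

variable {ι : Type*}

lemma negIndex_le (k : ℕ) (p : ℝ) : negIndex k p ≤ k + 1 := by
  unfold negIndex
  split_ifs <;> omega

lemma negIndex_add_negIndex_neg (k : ℕ) {p : ℝ} (hp : p ≠ 0) :
    negIndex k p + negIndex k (-p) = k + 1 := by
  unfold negIndex
  by_cases hk : Odd k
  · obtain ⟨r, rfl⟩ := hk
    simp only [odd_two_mul_add_one, if_true]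
    omega
  · obtain ⟨r, rfl⟩ := Nat.not_odd_iff_even.1 hk
    rcases hp.lt_or_gt with h | h
    · simp only [hk, h.not_gt, neg_pos.2 h, if_true, if_false]
      omega
    · simp only [hk, h, (neg_neg_of_pos h).not_gt, if_true, if_false]
      omega

/-- The contribution to the negative index of `hankelMatrix` of the point with index `m`, whose
imaginary part is `e m`. A conjugate pair contributes one whole block, which is assigned to the
point in the upper half-plane. -/
def negJetCount (K : ι → ℕ) (κ : ι → ℕ → ℂ) (e : ι → ℝ) (m : ι) : ℕ :=
  if e m = 0 then negIndex (K m) (κ m (K m)).re else if 0 < e m then K m + 1 else 0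

/-- The symmetry of the orders `K` and of the coefficients `κ` under the conjugation `τ` of the
points with imaginary parts `e`. -/
structure ConjSymmetric (K : ι → ℕ) (τ : ι → ι) (κ : ι → ℕ → ℂ) (e : ι → ℝ) : Prop where
  invol : Function.Involutive τ
  order_eq : ∀ m, K (τ m) = K m
  coeff_eq : ∀ m, ∀ k ≤ K m, κ (τ m) k = conj (κ m k)
  im_eq : ∀ m, e (τ m) = -e m
  fixed : ∀ m, e m = 0 → τ m = m
  lead_ne : ∀ m, κ m (K m) ≠ 0

variable {K : ι → ℕ} {τ : ι → ι} {κ : ι → ℕ → ℂ} {e : ι → ℝ}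

lemma negJetCount_le (m : ι) : negJetCount K κ e m ≤ K m + 1 := by
  unfold negJetCount
  split_ifs
  · exact negIndex_le _ _
  · exact le_rfl
  · exact Nat.zero_le _

lemma sum_negJetCount [Fintype ι] (K : ι → ℕ) (κ : ι → ℕ → ℂ) (e : ι → ℝ) :
    ∑ m, negJetCount K κ e m = (∑ m with e m = 0, negIndex (K m) (κ m (K m)).re)
      + (∑ m with 0 < e m, K m) + (Finset.univ.filter fun m => 0 < e m).card := by
  rw [add_assoc, Finset.card_eq_sum_ones, ← Finset.sum_add_distrib, Finset.sum_filter,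
    Finset.sum_filter, ← Finset.sum_add_distrib]
  refine Finset.sum_congr rfl fun m _ => ?_
  rw [negJetCount]
  by_cases hm : e m = 0 <;> simp [hm]

namespace ConjSymmetric

variable (h : ConjSymmetric K τ κ e)
include h

lemma neg : ConjSymmetric K τ (-κ) (-e) where
  invol := h.invol
  order_eq := h.order_eq
  coeff_eq m k hk := by simp [h.coeff_eq m k hk]
  im_eq m := by simp [h.im_eq]
  fixed m hm := h.fixed m (by simpa using hm)
  lead_ne m := by simpa using h.lead_ne m

lemma lead_eq_re {m : ι} (hm : e m = 0) : κ m (K m) = ((κ m (K m)).re : ℂ) := by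
  have hconj := h.coeff_eq m (K m) le_rfl
  rw [h.fixed m hm] at hconj
  exact (conj_eq_iff_re.1 hconj.symm).symm

lemma negJetCount_add (m : ι) : negJetCount K κ e m + negJetCount K (-κ) (-e) m = K m + 1 := by
  unfold negJetCount
  by_cases hm : e m = 0
  · have hre : (κ m (K m)).re ≠ 0 := fun h0 =>
      h.lead_ne m (by rw [h.lead_eq_re hm, h0, ofReal_zero])
    simp only [Pi.neg_apply, hm, neg_zero, if_true, neg_re]
    exact negIndex_add_negIndex_neg _ hre
  · rcases lt_or_gt_of_ne hm with hneg | hpos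
    · simp [hm, hneg, hneg.not_gt]
    · simp [hm, hpos, hpos.le]

lemma eq_and_lead_pos_of_negJetCount_le {m : ι} {i j : ℕ}
    (hi : negJetCount K κ e m ≤ i) (hj : negJetCount K κ e (τ m) ≤ j) (hij : i + j ≤ K m) :
    e m = 0 ∧ i = j ∧ i + j = K m ∧ 0 < (κ m (K m)).re := by
  rcases lt_trichotomy (e m) 0 with hm | hm | hm
  · have hm' : 0 < e (τ m) := by rw [h.im_eq]; linarith
    rw [negJetCount, if_neg hm'.ne', if_pos hm', h.order_eq] at hj
    omega
  · rw [h.fixed m hm] at hj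
    rw [negJetCount, if_pos hm, negIndex] at hi hj
    split_ifs at hi hj with hodd hpos
    · obtain ⟨r, hr⟩ := hodd
      omega
    · obtain ⟨r, hr⟩ := Nat.not_odd_iff_even.1 hodd
      exact ⟨hm, by omega, by omega, hpos⟩
    · obtain ⟨r, hr⟩ := Nat.not_odd_iff_even.1 hodd
      omega
  · rw [negJetCount, if_neg hm.ne', if_pos hm] at hi
    omega

end ConjSymmetric

variable [DecidableEq ι]

/-- The block matrix whose block in the position `(τ m, m)` is the upper left triangular Hankel
matrix with entries `κₘ,ᵢ₊ⱼ`, `i + j ≤ Kₘ`, the other blocks being zero. -/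
def hankelMatrix (K : ι → ℕ) (τ : ι → ι) (κ : ι → ℕ → ℂ) :
    Matrix (Σ m, Fin (K m + 1)) (Σ m, Fin (K m + 1)) ℂ := Matrix.of fun t s =>
  if t.1 = τ s.1 ∧ (s.2 + t.2 : ℕ) ≤ K s.1 then κ s.1 (s.2 + t.2) else 0

lemma hankelMatrix_neg (K : ι → ℕ) (τ : ι → ι) (κ : ι → ℕ → ℂ) :
    hankelMatrix K τ (-κ) = -hankelMatrix K τ κ := by
  ext t s
  simp only [hankelMatrix, Matrix.of_apply, Matrix.neg_apply, Pi.neg_apply, neg_ite, neg_zero]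

namespace ConjSymmetric

variable (h : ConjSymmetric K τ κ e)
include h

lemma isHermitian : (hankelMatrix K τ κ).IsHermitian := by
  have hswap {t s : Σ m, Fin (K m + 1)} (hts : t.1 = τ s.1 ∧ (s.2 + t.2 : ℕ) ≤ K s.1) :
      s.1 = τ t.1 ∧ (t.2 + s.2 : ℕ) ≤ K t.1 := by
    have hK : K t.1 = K s.1 := by rw [hts.1, h.order_eq]
    exact ⟨by rw [hts.1, h.invol], by omega⟩
  ext t s
  simp only [hankelMatrix, Matrix.conjTranspose_apply, Matrix.of_apply]
  by_cases hts : t.1 = τ s.1 ∧ (s.2 + t.2 : ℕ) ≤ K s.1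
  · have hcoeff := h.coeff_eq s.1 _ hts.2
    rw [← hts.1] at hcoeff
    rw [if_pos hts, if_pos (hswap hts), add_comm, hcoeff, RCLike.star_def, conj_conj]
  · rw [if_neg hts, if_neg (mt hswap hts), star_zero]

variable [Fintype ι]

lemma hankelMatrix_mulVec (ξ : (Σ m, Fin (K m + 1)) → ℂ) {m : ι} (j : Fin (K (τ m) + 1)) :
    (hankelMatrix K τ κ).mulVec ξ ⟨τ m, j⟩ =
      ∑ i : Fin (K m + 1), if (i + j : ℕ) ≤ K m then κ m (i + j) * ξ ⟨m, i⟩ else 0 := by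
  rw [Matrix.mulVec, dotProduct, Fintype.sum_sigma, Finset.sum_eq_single m]
  · refine Finset.sum_congr rfl fun i _ => ?_
    simp [hankelMatrix, ite_mul]
  · intro b _ hb
    refine Finset.sum_eq_zero fun i _ => ?_
    simp only [hankelMatrix, Matrix.of_apply]
    rw [if_neg fun hτ => hb (h.invol.injective hτ.1).symm, zero_mul]
  · simp

lemma mulVec_injective : Function.Injective (hankelMatrix K τ κ).mulVec := by
  rw [← Matrix.coe_mulVecLin, injective_iff_map_eq_zero]
  intro ξ hξ
  suffices hzero : ∀ m n, ∀ hn : n < K m + 1, ξ ⟨m, ⟨n, hn⟩⟩ = 0 from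
    funext fun s => hzero s.1 s.2 s.2.2
  intro m n
  induction n using Nat.strong_induction_on with
  | _ n ih =>
    intro hn
    have hrow := h.hankelMatrix_mulVec ξ (m := m) ⟨K m - n, by rw [h.order_eq]; omega⟩
    rw [← Matrix.mulVecLin_apply, hξ, Pi.zero_apply,
      Finset.sum_eq_single (⟨n, hn⟩ : Fin (K m + 1))] at hrow
    · simp only [Nat.add_sub_cancel' (Nat.lt_succ_iff.1 hn), le_refl, if_true] at hrow
      exact (mul_eq_zero.1 hrow.symm).resolve_left (h.lead_ne m)
    · intro i _ hi
      split_ifs with hle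
      · have hne : (i : ℕ) ≠ n := fun heq => hi (Fin.ext heq)
        rw [ih i (by simp only at hle; omega) i.2, mul_zero]
      · rfl
    · simp

lemma form_nonneg (ξ : (Σ m, Fin (K m + 1)) → ℂ)
    (hξ : ∀ s, (s.2 : ℕ) < negJetCount K κ e s.1 → ξ s = 0) :
    0 ≤ (star ξ ⬝ᵥ (hankelMatrix K τ κ).mulVec ξ).re := by
  simp only [dotProduct, Matrix.mulVec, Finset.mul_sum, re_sum]
  refine Finset.sum_nonneg fun ⟨m', j⟩ _ => Finset.sum_nonneg fun ⟨m, i⟩ _ => ?_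
  by_cases hs : ξ ⟨m, i⟩ = 0
  · simp [hs]
  by_cases ht : ξ ⟨m', j⟩ = 0
  · simp [ht]
  simp only [hankelMatrix, Matrix.of_apply]
  split_ifs with hts
  swap
  · simp
  obtain ⟨hτ, hle⟩ := hts
  have hi := not_lt.1 (mt (hξ ⟨m, i⟩) hs)
  have hj := not_lt.1 (mt (hξ ⟨m', j⟩) ht)
  obtain ⟨hm, hij, hK, hpos⟩ := h.eq_and_lead_pos_of_negJetCount_le hi (hτ ▸ hj) hle
  obtain rfl : m' = m := hτ.trans (h.fixed m hm)
  obtain rfl : i = j := Fin.ext hij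
  rw [hK, h.lead_eq_re hm, Pi.star_apply, RCLike.star_def, mul_left_comm, Complex.conj_mul',
    re_ofReal_mul, ← ofReal_pow, ofReal_re]
  positivity

end ConjSymmetric

end HankelMatrix

section JetMatrix

lemma sum_mul_sum_antidiagonal {R : Type*} [CommSemiring R] (n : ℕ) (κ x y : ℕ → R) :
    ∑ k ∈ Finset.range (n + 1), κ k * ∑ p ∈ Finset.HasAntidiagonal.antidiagonal k, x p.1 * y p.2 =
      ∑ j ∈ Finset.range (n + 1), y j * ∑ i ∈ Finset.range (n + 1),
        if i + j ≤ n then κ (i + j) * x i else 0 := by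
  simp only [Finset.mul_sum, Finset.sum_sigma', ← Finset.sum_filter]
  refine Finset.sum_nbij' (fun q => ⟨q.2.2, q.2.1⟩) (fun p => ⟨p.2 + p.1, (p.2, p.1)⟩)
    ?_ ?_ ?_ ?_ ?_
  · rintro ⟨k, i, j⟩ h
    simp only [Finset.mem_sigma, Finset.mem_range, Finset.HasAntidiagonal.mem_antidiagonal,
      Finset.mem_filter] at h ⊢
    omega
  · rintro ⟨j, i⟩ h
    simp only [Finset.mem_sigma, Finset.mem_range, Finset.HasAntidiagonal.mem_antidiagonal,
      Finset.mem_filter, and_true] at h ⊢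
    omega
  · rintro ⟨k, i, j⟩ h
    obtain rfl : i + j = k := by simpa using (Finset.mem_sigma.1 h).2
    rfl
  · exact fun _ _ => rfl
  · rintro ⟨k, i, j⟩ h
    obtain rfl : i + j = k := by simpa using (Finset.mem_sigma.1 h).2
    ring

variable {ι : Type*} [Fintype ι] {α : ι → ℂ} {K : ι → ℕ} {κ : ι → ℕ → ℂ}

lemma jetForm_eq_dotProduct [DecidableEq ι] {τ : ι → ι} {e : ι → ℝ} (h : ConjSymmetric K τ κ e)
    (hτ : ∀ m, α (τ m) = conj (α m)) (x y : ℂ → ℕ → ℂ) :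
    jetForm α K κ x y =
      star (fun t : Σ m, Fin (K m + 1) => y (α t.1) t.2) ⬝ᵥ
        (hankelMatrix K τ κ).mulVec fun s => x (α s.1) s.2 := by
  rw [dotProduct, Fintype.sum_sigma, ← Equiv.sum_comp h.invol.toPerm, jetForm_apply]
  refine Finset.sum_congr rfl fun m _ => ?_
  simp only [Function.Involutive.coe_toPerm, h.hankelMatrix_mulVec, Pi.star_apply, RCLike.star_def,
    hτ]
  rw [sum_mul_sum_antidiagonal (K m) (κ m) (x (α m)) fun j => conj (y (conj (α m)) j)]
  simp only [Finset.sum_range]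
  exact (Fin.sum_congr' _ (congrArg (· + 1) (h.order_eq m))).symm

/-- The total coefficient of order `k` at the point `a`. -/
def pointCoeff (α : ι → ℂ) (K : ι → ℕ) (κ : ι → ℕ → ℂ) (a : ℂ) (k : ℕ) : ℂ :=
  ∑ m with α m = a ∧ k ≤ K m, κ m k

lemma jetForm_single_single (α : ι → ℂ) (K : ι → ℕ) (κ : ι → ℕ → ℂ) (a : ℂ) (i j : ℕ) :
    jetForm α K κ (Pi.single a (Pi.single i 1)) (Pi.single (conj a) (Pi.single j 1)) =
      pointCoeff α K κ a (i + j) := by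
  rw [jetForm_apply, pointCoeff, Finset.sum_filter]
  refine Finset.sum_congr rfl fun m _ => ?_
  by_cases hm : α m = a
  · have hentry (p : ℕ × ℕ) : (Pi.single i 1 : ℕ → ℂ) p.1 * conj ((Pi.single j 1 : ℕ → ℂ) p.2) =
        if p = (i, j) then 1 else 0 := by
      simp only [Pi.single_apply, Prod.ext_iff]
      split_ifs <;> simp_all
    simp only [hm, Pi.single_eq_same, hentry, Finset.sum_ite_eq',
      Finset.HasAntidiagonal.mem_antidiagonal, mul_ite, mul_one, mul_zero, Finset.sum_ite_eq,
      Finset.mem_range, Order.lt_add_one_iff, true_and]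
  · simp [hm]

lemma pointCoeff_apply (hinj : Function.Injective α) {m : ι} {k : ℕ} (hk : k ≤ K m) :
    pointCoeff α K κ (α m) k = κ m k := by
  rw [pointCoeff, Finset.sum_eq_single_of_mem m (by simp [hk])]
  intro b hb hne
  exact absurd (hinj (Finset.mem_filter.1 hb).2.1) hne

lemma exists_conjSymmetric (hinj : Function.Injective α) (hlead : ∀ m, κ m (K m) ≠ 0)
    (hherm : ∀ x y, jetForm α K κ x y = conj (jetForm α K κ y x)) :
    ∃ τ : ι → ι, (∀ m, α (τ m) = conj (α m)) ∧ ConjSymmetric K τ κ fun m => (α m).im := by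
  have hconj (a : ℂ) (k : ℕ) : pointCoeff α K κ (conj a) k = conj (pointCoeff α K κ a k) := by
    have hleft := jetForm_single_single α K κ (conj a) 0 k
    have hright := jetForm_single_single α K κ a k 0
    rw [Complex.conj_conj, zero_add] at hleft
    rw [add_zero] at hright
    rw [← hleft, ← hright, hherm]
  have hex (m : ι) : ∃ m', α m' = conj (α m) ∧ K m ≤ K m' := by
    have hne : pointCoeff α K κ (conj (α m)) (K m) ≠ 0 := by
      rw [hconj, pointCoeff_apply hinj le_rfl]
      simpa using hlead m
    obtain ⟨m', hm', -⟩ := Finset.exists_ne_zero_of_sum_ne_zero hne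
    exact ⟨m', (Finset.mem_filter.1 hm').2⟩
  choose τ hτ hle using hex
  have hinvol (m : ι) : τ (τ m) = m := hinj (by rw [hτ, hτ, Complex.conj_conj])
  have horder (m : ι) : K (τ m) = K m := ((hle _).trans_eq (by rw [hinvol])).antisymm (hle m)
  refine ⟨τ, hτ, hinvol, horder, fun m k hk => ?_, fun m => by simp [hτ], fun m hm => ?_, hlead⟩
  · rw [← pointCoeff_apply (κ := κ) hinj (hk.trans_eq (horder m).symm), hτ, hconj,
      pointCoeff_apply hinj hk]
  · exact hinj (by rw [hτ, conj_eq_iff_im.2 hm])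

lemma ConjSymmetric.exists_isDiagonalFamily_neg [DecidableEq ι] {τ : ι → ι} {e : ι → ℝ}
    (h : ConjSymmetric K τ κ e) :
    ∃ (s : Finset (Σ m, Fin (K m + 1))) (u : s → (Σ m, Fin (K m + 1)) → ℂ) (l : s → ℝ),
      IsDiagonalFamily (hankelMatrix K τ κ) u l ∧ (∀ i, l i < 0) ∧
        ∑ m, negJetCount K κ e m ≤ s.card := by
  -- Vectors with vanishing jets below `negJetCount K (-κ) (-e)` have a nonpositive form.
  let R : ((Σ m, Fin (K m + 1)) → ℂ) →ₗ[ℂ] ((Σ m, Fin (negJetCount K (-κ) (-e) m)) → ℂ) :=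
    LinearMap.funLeft ℂ ℂ fun s => ⟨s.1, Fin.castLE (negJetCount_le s.1) s.2⟩
  obtain ⟨s, u, l, hu, hl, hcard⟩ := _root_.exists_isDiagonalFamily_neg h.isHermitian
    h.mulVec_injective R fun ξ hξ => by
      have hnonneg := h.neg.form_nonneg ξ fun s hs => congrFun hξ ⟨s.1, s.2, hs⟩
      rw [hankelMatrix_neg, Matrix.neg_mulVec, dotProduct_neg, neg_re] at hnonneg
      linarith
  refine ⟨s, u, l, hu, hl, ?_⟩
  simp only [Fintype.card_sigma, Fintype.card_fin, Module.finrank_fintype_fun_eq_card,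
    ← h.negJetCount_add, Finset.sum_add_distrib] at hcard
  omega

end JetMatrix

section NegativeSubspace

lemma norm_sum_smul_sq_le {𝕜 V ι : Type*} [NormedField 𝕜] [SeminormedAddCommGroup V]
    [NormedSpace 𝕜 V] (s : Finset ι) (z : ι → 𝕜) (v : ι → V) :
    ‖∑ i ∈ s, z i • v i‖ ^ 2 ≤ (∑ i ∈ s, ‖z i‖ ^ 2) * ∑ i ∈ s, ‖v i‖ ^ 2 := by
  have hle : ‖∑ i ∈ s, z i • v i‖ ≤ ∑ i ∈ s, ‖z i‖ * ‖v i‖ :=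
    (norm_sum_le _ _).trans_eq (by simp only [norm_smul])
  exact (pow_le_pow_left₀ (norm_nonneg _) hle 2).trans (Finset.sum_mul_sq_le_sq_mul_sq _ _ _)

lemma exists_pos_norm_sum_smul_sq_add_sum_neg {𝕜 V ι : Type*} [NormedField 𝕜]
    [SeminormedAddCommGroup V] [NormedSpace 𝕜 V] [Fintype ι] {l : ι → ℝ} (hl : ∀ i, l i < 0) :
    ∃ ε : ℝ, 0 < ε ∧ ∀ v : ι → V, (∀ i, ‖v i‖ < ε) → ∀ z : ι → 𝕜, z ≠ 0 →
      ‖∑ i, z i • v i‖ ^ 2 + ∑ i, l i * ‖z i‖ ^ 2 < 0 := by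
  have hlim : Tendsto (fun ε : ℝ => Fintype.card ι * ε ^ 2) (𝓝[>] 0) (𝓝 0) := by
    have hcont : Continuous fun ε : ℝ => (Fintype.card ι : ℝ) * ε ^ 2 := by fun_prop
    simpa using (hcont.tendsto 0).mono_left nhdsWithin_le_nhds
  obtain ⟨ε, hεl, hε⟩ := ((eventually_all.2 fun i =>
    hlim.eventually_lt_const (neg_pos.2 (hl i))).and self_mem_nhdsWithin).exists
  refine ⟨ε, hε, fun v hv z hz => ?_⟩
  obtain ⟨j, hj⟩ := Function.ne_iff.1 hz
  have hv2 : ∑ i, ‖v i‖ ^ 2 ≤ Fintype.card ι * ε ^ 2 := by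
    rw [← nsmul_eq_mul, ← Finset.card_univ]
    exact Finset.sum_le_card_nsmul _ _ _ fun i _ => pow_le_pow_left₀ (norm_nonneg _) (hv i).le 2
  have hneg (i : ι) : Fintype.card ι * ε ^ 2 + l i < 0 := by linarith [hεl i]
  calc ‖∑ i, z i • v i‖ ^ 2 + ∑ i, l i * ‖z i‖ ^ 2
      ≤ (∑ i, ‖z i‖ ^ 2) * (Fintype.card ι * ε ^ 2) + ∑ i, l i * ‖z i‖ ^ 2 := by
        gcongr
        exact (norm_sum_smul_sq_le _ z v).trans (by gcongr)
    _ = ∑ i, (Fintype.card ι * ε ^ 2 + l i) * ‖z i‖ ^ 2 := by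
        rw [Finset.sum_mul, ← Finset.sum_add_distrib]
        exact Finset.sum_congr rfl fun i _ => by ring
    _ < 0 := Finset.sum_neg' (fun i _ => mul_nonpos_of_nonpos_of_nonneg (hneg i).le (sq_nonneg _))
        ⟨j, Finset.mem_univ j, mul_neg_of_neg_of_pos (hneg j) (pow_pos (norm_pos_iff.2 hj) 2)⟩

section Interpolation

variable {ι : Type*} [Finite ι] {α : ι → ℂ} (hα : ∀ m, 0 < (α m).re) (K : ι → ℕ)
include hα

lemma exists_jets_eq_norm_stieltjesComb_lt (x : ℂ → ℕ → ℂ) {ε : ℝ} (hε : 0 < ε) :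
    ∃ c, (∀ m, ∀ k ≤ K m, jets c (α m) k = x (α m) k) ∧
      (∀ m, ∀ k ≤ K m, jets c (conj (α m)) k = x (conj (α m)) k) ∧ ‖stieltjesComb c‖ < ε := by
  cases nonempty_fintype ι
  have hpts : ∀ a ∈ Finset.univ.image α ∪ Finset.univ.image fun m => conj (α m), 0 < a.re := by
    intro a ha
    simp only [Finset.mem_union, Finset.mem_image, Finset.mem_univ, true_and] at ha
    rcases ha with ⟨m, rfl⟩ | ⟨m, rfl⟩
    · exact hα m
    · exact conj_re_pos (hα m)
  obtain ⟨c, hjet, hsmall⟩ := exists_jet_eq_norm_stieltjesComb_lt _ hpts (∑ m, K m + 1) x hε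
  have hlt {m : ι} {k : ℕ} (hk : k ≤ K m) : k < ∑ m, K m + 1 := Nat.lt_succ_of_le
    (hk.trans (Finset.single_le_sum (fun _ _ => Nat.zero_le _) (Finset.mem_univ m)))
  exact ⟨c, fun m k hk => hjet _ (by simp) k (hlt hk), fun m k hk => hjet _ (by simp) k (hlt hk),
    hsmall⟩

lemma exists_jets_eq_of_injective (hinj : Function.Injective α)
    (u : (Σ m, Fin (K m + 1)) → ℂ) {ε : ℝ} (hε : 0 < ε) :
    ∃ c, (fun s : Σ m, Fin (K m + 1) => jets c (α s.1) s.2) = u ∧ ‖stieltjesComb c‖ < ε := by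
  have hnode : Function.Injective fun s : Σ m, Fin (K m + 1) => (α s.1, (s.2 : ℕ)) := by
    rintro ⟨m, i⟩ ⟨m', i'⟩ h
    obtain rfl : m = m' := hinj (congrArg Prod.fst h)
    obtain rfl : i = i' := Fin.ext (congrArg Prod.snd h)
    rfl
  obtain ⟨c, hjet, -, hsmall⟩ := exists_jets_eq_norm_stieltjesComb_lt hα K
    (fun a k => Function.extend (fun s : Σ m, Fin (K m + 1) => (α s.1, (s.2 : ℕ))) u 0 (a, k)) hε
  refine ⟨c, funext fun s => ?_, hsmall⟩
  exact (hjet s.1 s.2 (Nat.lt_succ_iff.1 s.2.2)).trans (hnode.extend_apply u 0 s)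

end Interpolation

variable {M : ℕ} {α : Fin M → ℂ} {K : Fin M → ℕ} {Q : Fin M → ℂ[X]}
  {H : hardySpace →L[ℂ] hardySpace}

/-- The jets, up to the orders `n`, of a function in the Hardy space. -/
def hardyJets {ι : Type*} (α : ι → ℂ) (n : ι → ℕ) :
    hardySpace →L[ℂ] ((Σ m, Fin (n m)) → ℂ) :=
  ContinuousLinearMap.pi fun s => hardyJet (α s.1) s.2 ∘L hardySpace.subtypeL

namespace IsHankelOperator

variable (hα : ∀ m, 0 < (α m).re) (hdeg : ∀ m, (Q m).natDegree ≤ K m)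
  (hH : IsHankelOperator (hankelSymbol α K Q) H)
include hα hdeg hH

lemma jetForm_conj_symm (hsymm : (H : hardySpace →ₗ[ℂ] hardySpace).IsSymmetric)
    (x y : ℂ → ℕ → ℂ) :
    jetForm α K (symbolCoeff α K Q) x y = conj (jetForm α K (symbolCoeff α K Q) y x) := by
  obtain ⟨c, hcα, hcα', -⟩ := exists_jets_eq_norm_stieltjesComb_lt hα K x one_pos
  obtain ⟨d, hdα, hdα', -⟩ := exists_jets_eq_norm_stieltjesComb_lt hα K y one_pos
  rw [← jetForm_congr hcα hdα', ← jetForm_congr hdα hcα']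
  have hpi : (2 * Real.pi : ℂ) ≠ 0 := mod_cast Real.two_pi_pos.ne'
  have hinner : inner ℂ (hardyComb d) (H (hardyComb c)) =
      conj (inner ℂ (hardyComb c) (H (hardyComb d))) :=
    (hsymm (hardyComb d) (hardyComb c)).symm.trans (inner_conj_symm _ _).symm
  rw [hH.inner_hardyComb hα hdeg, hH.inner_hardyComb hα hdeg, map_mul, map_add, inner_conj_symm,
    map_mul, conj_ofReal, map_ofNat] at hinner
  exact add_left_cancel (mul_left_cancel₀ hpi hinner)

variable {τ : Fin M → Fin M} (hτ : ∀ m, α (τ m) = conj (α m))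
include hτ

lemma re_inner_nonneg_of_hardyJets_eq_zero {e : Fin M → ℝ}
    (hsym : ConjSymmetric K τ (symbolCoeff α K Q) e) (w : hardySpace)
    (hw : hardyJets α (negJetCount K (symbolCoeff α K Q) e) w = 0) :
    0 ≤ (inner ℂ w (H w)).re := by
  refine le_trans ?_ (hH.re_jetForm_le_re_inner hα hdeg w)
  rw [jetForm_eq_dotProduct hsym hτ]
  have hnonneg := hsym.form_nonneg (fun s => hardyJet (α s.1) s.2 w)
    fun s hs => congrFun hw ⟨s.1, s.2, hs⟩
  have := Real.two_pi_pos
  positivity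

/-- The jets of the vectors `u i` are attained by combinations of kernels whose Stieltjes
transforms are too small to spoil the negativity. -/
lemma exists_forall_re_inner_neg (hinj : Function.Injective α) {e : Fin M → ℝ}
    (hsym : ConjSymmetric K τ (symbolCoeff α K Q) e) {ι : Type*} [Finite ι] [DecidableEq ι]
    {u : ι → (Σ m, Fin (K m + 1)) → ℂ} {l : ι → ℝ} (hl : ∀ i, l i < 0)
    (hu : IsDiagonalFamily (hankelMatrix K τ (symbolCoeff α K Q)) u l) :
    ∃ J : (ι → ℂ) →ₗ[ℂ] hardySpace, ∀ z, z ≠ 0 → (inner ℂ (J z) (H (J z))).re < 0 := by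
  cases nonempty_fintype ι
  obtain ⟨ε, hε, hneg⟩ := exists_pos_norm_sum_smul_sq_add_sum_neg (𝕜 := ℂ)
    (V := Lp ℂ 2 (volume.restrict (Set.Ioi (0 : ℝ)))) hl
  choose c hcu hcε using fun i => exists_jets_eq_of_injective hα K hinj (u i) hε
  refine ⟨hardyComb ∘ₗ Fintype.linearCombination ℂ c, fun z hz => ?_⟩
  have hjets : (fun s : Σ m, Fin (K m + 1) => jets (Fintype.linearCombination ℂ c z) (α s.1) s.2) =
      ∑ i, z i • u i := by
    simp only [Fintype.linearCombination_apply, map_sum, map_smul, ← hcu]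
    funext s
    simp only [Finset.sum_apply, Pi.smul_apply]
  have hstieltjes : stieltjesComb (Fintype.linearCombination ℂ c z) =
      ∑ i, z i • stieltjesComb (c i) := by
    simp only [Fintype.linearCombination_apply, map_sum, map_smul]
  rw [LinearMap.comp_apply, hH.re_inner_hardyComb hα hdeg, jetForm_eq_dotProduct hsym hτ, hjets,
    hu.dotProduct_mulVec_sum_smul, ofReal_re, hstieltjes]
  exact mul_neg_of_pos_of_neg Real.two_pi_pos (hneg _ hcε z hz)

end IsHankelOperator

end NegativeSubspace

end

theorem theorem5p2 (M : ℕ) (α : Fin M → ℂ) (K : Fin M → ℕ) (Q : Fin M → ℂ[X])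
    (hα : ∀ m, 0 < (α m).re) (hαinj : Function.Injective α)
    (hdeg : ∀ m, (Q m).natDegree ≤ K m) (hQ : ∀ m, (Q m).eval (-I * α m) ≠ 0) :
    -- the Hankel operator with symbol `π i sgn x + φ(x)` exists as a bounded operator
    (∃ H : hardySpace →L[ℂ] hardySpace,
      IsHankelOperator (fun x => carlemanSymbol x + rationalSymbol α K Q x) H) ∧
    ∀ H : hardySpace →L[ℂ] hardySpace,
      IsHankelOperator (fun x => carlemanSymbol x + rationalSymbol α K Q x) H →
      -- `H` is self-adjoint
      (H : hardySpace →ₗ[ℂ] hardySpace).IsSymmetric →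
        -- the strictly negative spectrum consists of eigenvalues
        (∀ μ : ℝ, μ < 0 → (μ : ℂ) ∈ spectrum ℂ H →
          Module.End.HasEigenvalue (H : hardySpace →ₗ[ℂ] hardySpace) (μ : ℂ)) ∧
        -- and its total multiplicity is
        negEigenvalueCount H =
          (((∑ m with (α m).im = 0, negIndex (K m) ((Q m).eval (-I * α m)).re)
            + (∑ m with 0 < (α m).im, K m)
            + (Finset.univ.filter fun m => 0 < (α m).im).card : ℕ) : Cardinal) := by
  refine ⟨⟨_, isHankelOperator_hankelOp (memLp_top_hankelSymbol hα hdeg)⟩, fun H hH hsymm => ?_⟩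
  have hlead (m : Fin M) : symbolCoeff α K Q m (K m) = (Q m).eval (-I * α m) :=
    laurentCoeff_self _ _ _
  obtain ⟨τ, hτ, hsym⟩ := exists_conjSymmetric hαinj (fun m => (hlead m).trans_ne (hQ m))
    (IsHankelOperator.jetForm_conj_symm hα hdeg hH hsymm)
  have hnonneg := IsHankelOperator.re_inner_nonneg_of_hardyJets_eq_zero hα hdeg hH hτ hsym
  refine ⟨fun μ hμ hmem => hasEigenvalue_of_mem_spectrum_of_neg hsymm _ hnonneg hμ hmem, ?_⟩
  obtain ⟨s, u, l, hu, hl, hcard⟩ := hsym.exists_isDiagonalFamily_neg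
  obtain ⟨J, hJ⟩ :=
    IsHankelOperator.exists_forall_re_inner_neg hα hdeg hH hτ hαinj hsym hl hu
  rw [negEigenvalueCount_eq hsymm _ hnonneg J hJ (by simpa using hcard)]
  simp only [← hlead, ← sum_negJetCount, Module.finrank_fintype_fun_eq_card, Fintype.card_sigma,
    Fintype.card_fin]
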